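/- For $N\in\mathbb{N}$ let $A$ be an $N\times N$ GUE matrix, normalized as follows: $A$ is a random Hermitian matrix whose entries below the diagonal are $A_{ij}=X_{ij}+\mathrm{i}\,Y_{ij}$ for $i>j$, where $X_{ij},Y_{ij}\sim\mathcal N(0,1/4)$, whose diagonal entries are $A_{ii}\sim\mathcal N(0,1/2)$ (the second parameter is the variance), and where all the real Gaussian variables $A_{ii}$ and $X_{ij},Y_{ij}$ ($i>j$) are independent. Let $\lambda_{\mathrm{GUE},N}$ denote the largest eigenvalue of $A$. Then there are absolute constants $c_1,c_2,n_0,C>0$ such that for all $t\in(0,1)$ and all $N\in\mathbb{N}$ satisfying $Nt^{3/2}\ge n_0$, $$\frac{c_1}{Nt^{3/2}}\,e^{-\frac{8\sqrt2}{3}N\left(t^{3/2}+C\,t^{5/2}\right)}\;\le\;\mathbb{P}\!\left(\lambda_{\mathrm{GUE},N}\ge\sqrt{2N}\,(1+t)\right)\;\le\;\frac{c_2}{Nt^{3/2}}\,e^{-\frac{8\sqrt2}{3}Nt^{3/2}} .$$ -/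

import Mathlib

open MeasureTheory ProbabilityTheory

/-- The positions `(i, j)` strictly below the diagonal of an `N × N` matrix, i.e. `j < i`. -/
abbrev LowerPair (N : ℕ) : Type := {p : Fin N × Fin N // p.2 < p.1}

/-- The `N ^ 2` real random variables that determine a Hermitian random matrix: the diagonal
entries, and the real and the imaginary parts of the entries strictly below the diagonal. -/
def hermitianCoord {Ω : Type*} {N : ℕ} (A : Ω → Matrix (Fin N) (Fin N) ℂ) :
    Fin N ⊕ LowerPair N ⊕ LowerPair N → Ω → ℝ
  | Sum.inl i => fun ω => (A ω i i).re
  | Sum.inr (Sum.inl p) => fun ω => (A ω p.1.1 p.1.2).re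
  | Sum.inr (Sum.inr p) => fun ω => (A ω p.1.1 p.1.2).im

/-- `A` is an `N × N` GUE random matrix on the probability space `(Ω, P)`: it is Hermitian, its
diagonal entries are `𝒩(0, 1/2)`, its entries strictly below the diagonal are
`𝒩(0, 1/4) + i 𝒩(0, 1/4)`, and all these real Gaussian variables are jointly independent.
The second parameter of `gaussianReal` is the variance. -/
structure IsGUE {Ω : Type*} [MeasurableSpace Ω] (P : Measure Ω) {N : ℕ}
    (A : Ω → Matrix (Fin N) (Fin N) ℂ) : Prop where
  isHermitian : ∀ ω, (A ω).IsHermitian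
  law_diag : ∀ i, HasLaw (fun ω => (A ω i i).re) (gaussianReal 0 (1 / 2)) P
  law_re : ∀ i j, j < i → HasLaw (fun ω => (A ω i j).re) (gaussianReal 0 (1 / 4)) P
  law_im : ∀ i j, j < i → HasLaw (fun ω => (A ω i j).im) (gaussianReal 0 (1 / 4)) P
  indep : iIndepFun (hermitianCoord A) P

/-- The largest (real) eigenvalue of a Hermitian matrix. -/
noncomputable def largestEigenvalue {N : ℕ} (A : Matrix (Fin N) (Fin N) ℂ) : ℝ :=
  sSup (spectrum ℝ A)

/-- For a nonempty Hermitian matrix the supremum above is attained. -/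
theorem isGreatest_largestEigenvalue {N : ℕ} (hN : 0 < N) {A : Matrix (Fin N) (Fin N) ℂ}
    (hA : A.IsHermitian) : IsGreatest (spectrum ℝ A) (largestEigenvalue A) := by
  have : Nonempty (Fin N) := ⟨⟨0, hN⟩⟩
  have h : spectrum ℝ A = Set.range hA.eigenvalues := hA.spectrum_real_eq_range_eigenvalues
  have hf : (spectrum ℝ A).Finite := h ▸ Set.finite_range _
  have hne : (spectrum ℝ A).Nonempty := h ▸ Set.range_nonempty _
  exact ⟨hne.csSup_mem hf, fun x hx => le_csSup hf.bddAbove hx⟩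

/-! The coordinates of a GUE matrix have density proportional to exp(-tr X²), so P(λ < s) is a
normalised mass of the set of Hermitian matrices below s. No joint eigenvalue density is used.
Instead the top eigenvalue is peeled off: the border (a, b) of [[a, b*], [b, D]] is replaced by the
top eigenvalue x and its eigenvector (1, w), with Jacobian (1 + |w|²)|det(x - D)|². For fixed w and
x, the compression of the matrix to the orthogonal complement of (1, w) is, up to a unitary, an
affine image of D. Hence the masses M_n(s, p) of the weight exp(-tr X²)|det p(X)|² below s satisfy
M_{n+1}(s, p) = const · ∫_{x<s} exp(-x²) p(x)² M_n(x, p·(X - x)) dx (`exists_cutMass_succ`). The n ×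
n Gram determinants of the monomials for the weight p² exp(-x²) on (-∞, s] obey the same recursion
(`hasDerivAt_det_gram`), so the two agree up to a constant (`exists_cutMass_eq`). Letting s → ∞
fixes the constant: P(λ < s) = det G, with G the Gram matrix on (-∞, s] of the orthonormal Hermite
polynomials (`prob_lt_eq_det`).

Since 0 ≤ G ≤ 1, the tail 1 - det G lies between 1 - exp(-τ) and τ, where τ = tr(1 - G) is the
integral over (s, ∞) of the one-point density (`det_gram_bounds`). The derivative of this density is
a single product of two consecutive Hermite functions (`hasDerivAt_density`). Beyond its turning
point a Hermite function is comparable to its WKB approximation, with an explicit relative error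
(`herm_wkb_bounds`) and a connection constant controlled by Stirling's formula.

With m = √(s² - a²) at the turning point a, the density drops like exp(-2m(x - s)). Recovering τ
from the drop takes two integrations, which give √(2N) exp(-2·action)/m³; at s = √(2N)(1 + t) one
has m ≈ √(4Nt), hence the prefactor 1/(N t^{3/2}). Twice the action is (8√2/3) N t^{3/2} up to a
bounded error from above, and up to a further multiple of N t^{5/2} from below. -/

namespace GUETail
open Matrix Polynomial
open scoped ComplexOrder

/-! ### Bordered Hermitian matrices parametrised by their top eigenvalue and eigenvector. -/

section Bordered
variable {m : Type*} [Fintype m] [DecidableEq m]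

/-- The unnormalised GUE density of a matrix `X`, times the square of `|det (p X)|`. -/
noncomputable def weight (p : ℝ[X]) (X : Matrix m m ℂ) : ℝ :=
  Real.exp (-(X * X).trace.re) * ‖(aeval X p).det‖ ^ 2

theorem weight_nonneg (p : ℝ[X]) (X : Matrix m m ℂ) : 0 ≤ weight p X := by
  unfold weight; positivity

/-- Intertwined matrices have the same polynomials up to intertwining. -/
theorem aeval_intertwine {A N B : Matrix m m ℂ} (h : A * N = N * B) (p : ℝ[X]) :
    aeval A p * N = N * aeval B p := by
  induction p using Polynomial.induction_on' with
  | add p q hp hq => simp [add_mul, mul_add, hp, hq]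
  | monomial k a =>
    have : A ^ k * N = N * B ^ k := by
      induction k with
      | zero => simp
      | succ k ih => rw [pow_succ, mul_assoc, h, ← mul_assoc, ih, mul_assoc, ← pow_succ]
    simp only [aeval_monomial, this, Algebra.algebraMap_eq_smul_one,
      smul_mul_assoc, one_mul, mul_smul_comm]

/-- Trace and determinant are similarity invariants. No unitarity of `N` is asked, so eigenvectors
need not be normalised later. -/
theorem weight_eq_of_intertwine {A N B : Matrix m m ℂ} (h : A * N = N * B) (hN : N.det ≠ 0)
    (p : ℝ[X]) : weight p A = weight p B := by
  have hdet : (aeval A p).det = (aeval B p).det := by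
    have := congrArg Matrix.det (aeval_intertwine h p)
    rw [det_mul, det_mul, mul_comm] at this
    exact mul_left_cancel₀ hN this
  have hu : IsUnit N.det := isUnit_iff_ne_zero.mpr hN
  have hA : A = N * B * N⁻¹ := by rw [← h, mul_assoc, mul_nonsing_inv _ hu, mul_one]
  have htr : (A * A).trace = (B * B).trace := by
    have : A * A = N * (B * B) * N⁻¹ := by
      rw [hA]
      simp only [mul_assoc]
      rw [← mul_assoc N⁻¹ N, nonsing_inv_mul _ hu, one_mul]
    rw [this, trace_mul_comm, ← mul_assoc, nonsing_inv_mul _ hu, one_mul]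
  simp [weight, hdet, htr]

theorem aeval_fromBlocks_diag {l : Type*} [Fintype l] [DecidableEq l] (X : Matrix l l ℂ)
    (Y : Matrix m m ℂ) (p : ℝ[X]) :
    aeval (fromBlocks X 0 0 Y) p = fromBlocks (aeval X p) 0 0 (aeval Y p) := by
  induction p using Polynomial.induction_on' with
  | add p q hp hq => simp [hp, hq, fromBlocks_add]
  | monomial k a =>
    have : (fromBlocks X 0 0 Y) ^ k = fromBlocks (X ^ k) 0 0 (Y ^ k) := by
      induction k with
      | zero => simp
      | succ k ih => rw [pow_succ, ih, fromBlocks_multiply]; simp [pow_succ]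
    simp [aeval_monomial, this, Algebra.algebraMap_eq_smul_one, fromBlocks_smul]

theorem weight_fromBlocks (x : ℝ) (Y : Matrix m m ℂ) (p : ℝ[X]) :
    weight p (fromBlocks ((x : ℂ) • (1 : Matrix Unit Unit ℂ)) 0 0 Y) =
      Real.exp (-x ^ 2) * p.eval x ^ 2 * weight p Y := by
  have h1 : aeval ((x : ℂ) • (1 : Matrix Unit Unit ℂ)) p =
      ((p.eval x : ℝ) : ℂ) • (1 : Matrix Unit Unit ℂ) := by
    have : (x : ℂ) • (1 : Matrix Unit Unit ℂ) = algebraMap ℝ _ x := by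
      rw [Algebra.algebraMap_eq_smul_one]; ext; simp
    rw [this, aeval_algebraMap_apply, Algebra.algebraMap_eq_smul_one]; ext; simp
  unfold weight
  rw [aeval_fromBlocks_diag, h1, det_fromBlocks_zero₂₁, fromBlocks_multiply]
  simp [Real.exp_add, mul_pow, trace, Complex.ofReal_re, Complex.mul_re]
  ring_nf

/-- This is why the weight carries a polynomial: the Jacobian factor |det(x - D)|² is absorbed by
passing from p to p·(X - x), which closes the recursion. -/
theorem weight_mul (p q : ℝ[X]) (X : Matrix m m ℂ) :
    weight (p * q) X = weight p X * ‖(aeval X q).det‖ ^ 2 := by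
  simp [weight, mul_pow, mul_assoc]

/-- The matrix `[[a, b*], [b, D]]`. -/
noncomputable def bordered (a : ℝ) (b : m → ℂ) (D : Matrix m m ℂ) :
    Matrix (Unit ⊕ m) (Unit ⊕ m) ℂ :=
  fromBlocks ((a : ℂ) • 1) (replicateCol Unit b)ᴴ (replicateCol Unit b) D

/-- The data `(a, b)` such that `[[a, b*], [b, D]]` has eigenvector `(1, w)` and eigenvalue `x`. -/
noncomputable def fromEigen (D : Matrix m m ℂ) (z : ℝ × (m → ℂ)) : ℝ × (m → ℂ) :=
  (z.1 - (star z.2 ⬝ᵥ (((z.1 : ℂ) • 1 - D) *ᵥ z.2)).re, ((z.1 : ℂ) • 1 - D) *ᵥ z.2)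

theorem isHermitian_shift {m : Type*} [DecidableEq m] {D : Matrix m m ℂ} (hD : D.IsHermitian) (x : ℝ) :
    ((x : ℂ) • 1 - D).IsHermitian := by
  refine IsHermitian.sub ?_ hD
  simp [IsHermitian, conjTranspose_smul]

/-- The row `[-w, 1]`. -/
noncomputable def killer (w : m → ℂ) : Matrix m (Unit ⊕ m) ℂ := fromCols (-replicateCol Unit w) 1

/-- Since (1, w) is in the kernel of x minus the bordered matrix, that matrix is determined by its
lower block x - D, as the pullback of this form along the projection killing (1, w). -/
theorem shift_bordered {D : Matrix m m ℂ} (hD : D.IsHermitian) (x : ℝ) (w : m → ℂ) :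
    (x : ℂ) • 1 - bordered (fromEigen D (x, w)).1 (fromEigen D (x, w)).2 D =
      (killer w)ᴴ * ((x : ℂ) • 1 - D) * killer w := by
  have hT := isHermitian_shift hD x
  set T := (x : ℂ) • 1 - D with hTdef
  have hcol : replicateCol Unit (T *ᵥ w) = T * replicateCol Unit w := by
    ext i j; simp [mul_apply, mulVec, dotProduct]
  have hreal : ((star w ⬝ᵥ (T *ᵥ w)).re : ℂ) = star w ⬝ᵥ (T *ᵥ w) := by
    have := hT.im_star_dotProduct_mulVec_self w
    apply Complex.ext <;> simp_all
  have h1 : (1 : Matrix (Unit ⊕ m) (Unit ⊕ m) ℂ) = fromBlocks 1 0 0 1 := fromBlocks_one.symm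
  have h11 : (x : ℂ) • (1 : Matrix Unit Unit ℂ) - ((x - (star w ⬝ᵥ (T *ᵥ w)).re : ℝ) : ℂ) • 1 =
      (replicateCol Unit w)ᴴ * T * replicateCol Unit w := by
    rw [Matrix.mul_assoc, ← hcol]
    push_cast
    rw [hreal]
    ext i j; simp [mul_apply, dotProduct]
  simp only [bordered, fromEigen, killer, ← hTdef]
  rw [h1, fromBlocks_smul, sub_eq_add_neg, fromBlocks_neg, fromBlocks_add, ← sub_eq_add_neg, h11, conjTranspose_fromCols_eq_fromRows_conjTranspose,
    fromRows_mul, fromRows_mul_fromCols, hcol]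
  rw [conjTranspose_mul, hT.eq]
  clear_value T
  subst hTdef
  simp [sub_eq_add_neg]

theorem mulVec_killer (w : m → ℂ) (u : Unit ⊕ m → ℂ) :
    killer w *ᵥ u = (fun i => u (Sum.inr i)) - u (Sum.inl ()) • w := by
  ext i
  simp [killer, mulVec, dotProduct, one_apply, sub_eq_add_neg]
  ring


theorem quadForm_shift {D : Matrix m m ℂ} (hD : D.IsHermitian) (x : ℝ) (w : m → ℂ)
    (u : Unit ⊕ m → ℂ) :
    star u ⬝ᵥ (((x : ℂ) • 1 - bordered (fromEigen D (x, w)).1 (fromEigen D (x, w)).2 D) *ᵥ u) =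
      star (killer w *ᵥ u) ⬝ᵥ (((x : ℂ) • 1 - D) *ᵥ (killer w *ᵥ u)) := by
  rw [shift_bordered hD, ← mulVec_mulVec, ← mulVec_mulVec, dotProduct_mulVec, star_mulVec]

theorem isHermitian_bordered {m : Type*} {D : Matrix m m ℂ} (hD : D.IsHermitian) (a : ℝ) (b : m → ℂ) :
    (bordered a b D).IsHermitian := by
  refine IsHermitian.fromBlocks ?_ (by simp) hD
  simp [IsHermitian, conjTranspose_smul]

/-- The vector `(1, w)`. -/
def lift (w : m → ℂ) : Unit ⊕ m → ℂ := Sum.elim 1 w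

theorem killer_lift (w : m → ℂ) : killer w *ᵥ lift w = 0 := by
  rw [mulVec_killer]; ext; simp [lift]

theorem lift_ne_zero {m : Type*} (w : m → ℂ) : lift w ≠ 0 := fun h => by
  simpa [lift] using congrFun h (Sum.inl ())

theorem star_dotProduct_lift_pos {m : Type*} [Fintype m] (w : m → ℂ) : 0 < (star (lift w) ⬝ᵥ lift w).re := by
  have := (dotProduct_star_self_pos_iff (v := lift w)).2 (lift_ne_zero w)
  exact (Complex.pos_iff.1 this).1

theorem quadForm_shift_lift {D : Matrix m m ℂ} (hD : D.IsHermitian) (x s : ℝ) (w : m → ℂ) :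
    (star (lift w) ⬝ᵥ
      (((s : ℂ) • 1 - bordered (fromEigen D (x, w)).1 (fromEigen D (x, w)).2 D) *ᵥ lift w)).re =
      (s - x) * (star (lift w) ⬝ᵥ lift w).re := by
  have h := quadForm_shift hD x w (lift w)
  rw [killer_lift, star_zero, zero_dotProduct, sub_mulVec, dotProduct_sub, sub_eq_zero] at h
  rw [sub_mulVec, dotProduct_sub, ← h, smul_mulVec, smul_mulVec, one_mulVec, dotProduct_smul,
    dotProduct_smul, ← sub_smul, ← Complex.ofReal_sub]
  simp

/-- In the new variables the cutoff at s is just x < s, because x is the top eigenvalue: test on (1,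
w) for one direction; for the other, add (s - x)·1 to a positive semidefinite form. -/
theorem posDef_shift_bordered_iff {D : Matrix m m ℂ} {x : ℝ} (hD : D.IsHermitian)
    (h : ((x : ℂ) • 1 - D).PosDef) (w : m → ℂ) (s : ℝ) :
    ((s : ℂ) • 1 - bordered (fromEigen D (x, w)).1 (fromEigen D (x, w)).2 D).PosDef ↔ x < s := by
  constructor
  · intro hs
    have := (Complex.pos_iff.1 (hs.dotProduct_mulVec_pos (lift_ne_zero w))).1
    rw [quadForm_shift_lift hD] at this
    have := pos_of_mul_pos_left this (star_dotProduct_lift_pos w).le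
    linarith
  · intro hs
    have h1 : ((s : ℂ) • 1 - bordered (fromEigen D (x, w)).1 (fromEigen D (x, w)).2 D) =
        (((s - x : ℝ) : ℂ) • 1) +
          ((x : ℂ) • 1 - bordered (fromEigen D (x, w)).1 (fromEigen D (x, w)).2 D) := by
      push_cast; rw [sub_smul]; abel
    rw [h1]
    refine PosDef.add_posSemidef (PosDef.smul PosDef.one ?_) ?_
    · exact_mod_cast sub_pos.2 hs
    · rw [shift_bordered hD]
      exact h.posSemidef.conjTranspose_mul_mul_same _

/-- x is recovered as the top eigenvalue (each of two candidates bounds the other, by testing on the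
other's eigenvector), and then w from b because x - D is invertible. -/
theorem injOn_fromEigen {D : Matrix m m ℂ} (hD : D.IsHermitian) :
    Set.InjOn (fromEigen D) {z | ((z.1 : ℂ) • 1 - D).PosDef} := by
  have key : ∀ x y : ℝ, ∀ w v : m → ℂ, ((x : ℂ) • 1 - D).PosDef →
      fromEigen D (x, w) = fromEigen D (y, v) → y ≤ x := by
    intro x y w v hx h
    have h1 := quadForm_shift_lift hD y x v
    rw [← h, shift_bordered hD] at h1
    have h2 := ((hx.posSemidef.conjTranspose_mul_mul_same (killer w)).dotProduct_mulVec_nonneg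
      (lift v))
    rw [Complex.le_def, Complex.zero_re, h1] at h2
    have := nonneg_of_mul_nonneg_left h2.1 (star_dotProduct_lift_pos v)
    linarith
  rintro ⟨x, w⟩ hx ⟨y, v⟩ hy h
  simp only [Set.mem_ofPred_eq] at hx hy
  obtain rfl : x = y := le_antisymm (key y x v w hy h.symm) (key x y w v hx h)
  have h2 := congrArg Prod.snd h
  simp only [fromEigen] at h2
  have := mulVec_injective_iff_isUnit.2 hx.isUnit h2
  rw [this]

theorem posDef_shift_iff {A : Matrix m m ℂ} (hA : A.IsHermitian) (s : ℝ) :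
    ((s : ℂ) • 1 - A).PosDef ↔ ∀ i, hA.eigenvalues i < s := by
  have hU : IsUnit (hA.eigenvectorUnitary : Matrix m m ℂ) :=
    (Unitary.toUnits hA.eigenvectorUnitary).isUnit
  have h := hA.spectral_theorem
  rw [Unitary.conjStarAlgAut_apply] at h
  have h1 : (s : ℂ) • 1 - A = (hA.eigenvectorUnitary : Matrix m m ℂ) *
      diagonal (fun i => ((s - hA.eigenvalues i : ℝ) : ℂ)) *
        star (hA.eigenvectorUnitary : Matrix m m ℂ) := by
    have h2 : diagonal (fun i => ((s - hA.eigenvalues i : ℝ) : ℂ)) =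
        (s : ℂ) • 1 - diagonal (RCLike.ofReal ∘ hA.eigenvalues) := by
      ext i j; by_cases hij : i = j <;> simp [hij]
    rw [h2, Matrix.mul_sub, Matrix.sub_mul, ← h]
    simp
  rw [h1, Matrix.IsUnit.posDef_star_right_conjugate_iff hU, posDef_diagonal_iff]
  simp [sub_pos]

theorem posSemidef_shift_of_le {A : Matrix m m ℂ} (hA : A.IsHermitian) {s : ℝ}
    (h : ∀ i, hA.eigenvalues i ≤ s) : ((s : ℂ) • 1 - A).PosSemidef := by
  rw [posSemidef_iff_dotProduct_mulVec]
  refine ⟨isHermitian_shift hA s, fun v => ?_⟩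
  have hre : ∀ ε > 0, 0 ≤ (star v ⬝ᵥ (((s : ℂ) • 1 - A) *ᵥ v)).re + ε * (star v ⬝ᵥ v).re := by
    intro ε hε
    have h1 := ((posDef_shift_iff hA (s + ε)).2
      (fun i => by linarith [h i])).posSemidef.dotProduct_mulVec_nonneg v
    rw [Complex.le_def] at h1
    have h2 : (((s + ε : ℝ) : ℂ) • 1 - A) = ((s : ℂ) • 1 - A) + (ε : ℂ) • 1 := by
      push_cast; rw [add_smul]; abel
    rw [h2, add_mulVec, dotProduct_add, smul_mulVec, one_mulVec, dotProduct_smul] at h1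
    simpa using h1.1
  have him := (isHermitian_shift hA s).im_star_dotProduct_mulVec_self v
  rw [Complex.le_def]
  refine ⟨?_, by simpa using him.symm⟩
  simp only [Complex.zero_re]
  by_contra! hneg
  set q := (star v ⬝ᵥ v).re
  have hq : 0 ≤ q := by
    have := dotProduct_star_self_nonneg v
    exact (Complex.le_def.1 this).1
  set r := (star v ⬝ᵥ (((s : ℂ) • 1 - A) *ᵥ v)).re
  -- With this ε the perturbation ε·q is at most -r/2, too small to make r + ε·q nonnegative when r
  -- < 0.
  have := hre (-r / (2 * (q + 1))) (by apply div_pos <;> linarith)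
  have h3 : -r / (2 * (q + 1)) * q ≤ -r / 2 := by
    rw [div_mul_eq_mul_div, div_le_div_iff₀ (by linarith) (by norm_num)]
    nlinarith
  linarith

theorem exists_top_eigenvector [Nonempty m] {A : Matrix m m ℂ} (hA : A.IsHermitian) :
    ∃ (x : ℝ) (v : m → ℂ), ((x : ℂ) • 1 - A).PosSemidef ∧ v ≠ 0 ∧ ((x : ℂ) • 1 - A) *ᵥ v = 0 := by
  obtain ⟨i, -, hi⟩ := Finset.exists_max_image Finset.univ hA.eigenvalues Finset.univ_nonempty
  refine ⟨hA.eigenvalues i, (hA.eigenvectorBasis i).ofLp,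
    posSemidef_shift_of_le hA fun j => hi j (Finset.mem_univ j), ?_, ?_⟩
  · intro h
    have := hA.eigenvectorBasis.orthonormal.ne_zero i
    exact this (by ext j; simpa using congrFun h j)
  · rw [sub_mulVec, hA.mulVec_eigenvectorBasis i, smul_mulVec, one_mulVec]
    ext j; simp

/-- Surjectivity up to a hyperplane of borders. Let x be the top eigenvalue of the bordered matrix;
x - D is positive semidefinite as a compression. If it is nonsingular, the eigenvector has nonzero
first entry and can be scaled to (1, w). Otherwise x is also the top eigenvalue of D, and any top
eigenvector u of D satisfies b* u = 0. -/
theorem exists_fromEigen {D : Matrix m m ℂ} (hD : D.IsHermitian) :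
    ∃ u : m → ℂ, ∀ (a : ℝ) (b : m → ℂ),
      (∃ z : ℝ × (m → ℂ), ((z.1 : ℂ) • 1 - D).PosDef ∧ fromEigen D z = (a, b)) ∨
        (u ≠ 0 ∧ star b ⬝ᵥ u = 0) := by
  have main : ∀ (a : ℝ) (b : m → ℂ),
      (∃ z : ℝ × (m → ℂ), ((z.1 : ℂ) • 1 - D).PosDef ∧ fromEigen D z = (a, b)) ∨
      ∃ x : ℝ, ((x : ℂ) • 1 - bordered a b D).PosSemidef ∧ ((x : ℂ) • 1 - D).PosSemidef ∧
        ((x : ℂ) • 1 - D).det = 0 := by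
    intro a b
    obtain ⟨x, v, hx, hv, hxv⟩ := exists_top_eigenvector (isHermitian_bordered hD a b)
    have hsub : ((x : ℂ) • 1 - D).PosSemidef := by
      have h := hx.submatrix Sum.inr
      convert h using 1
      ext i j
      simp [bordered, one_apply]
    by_cases hdet : ((x : ℂ) • 1 - D).det = 0
    · exact Or.inr ⟨x, hx, hsub, hdet⟩
    left
    have hpd := hsub.posDef_iff_det_ne_zero.2 hdet
    have hrow2 : ((x : ℂ) • 1 - D) *ᵥ (fun i => v (Sum.inr i)) = v (Sum.inl ()) • b := by
      ext i
      have := congrFun hxv (Sum.inr i)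
      simp only [sub_mulVec, bordered, smul_mulVec, one_mulVec, Pi.sub_apply, Pi.smul_apply,
        fromBlocks_mulVec, Sum.elim_inr, Pi.add_apply] at this ⊢
      simp only [mulVec, dotProduct] at this
      simp only [mulVec, dotProduct]
      simp at this ⊢
      linear_combination this
    have hrow1 : (x - a : ℂ) * v (Sum.inl ()) = star b ⬝ᵥ (fun i => v (Sum.inr i)) := by
      have := congrFun hxv (Sum.inl ())
      simp only [sub_mulVec, bordered, smul_mulVec, one_mulVec, Pi.sub_apply, Pi.smul_apply,
        fromBlocks_mulVec, Sum.elim_inl, Pi.add_apply] at this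
      simp only [mulVec, dotProduct] at this
      simp [dotProduct] at this ⊢
      linear_combination this
    have hv0 : v (Sum.inl ()) ≠ 0 := by
      intro h0
      rw [h0, zero_smul, ← mulVec_zero ((x : ℂ) • 1 - D)] at hrow2
      have h3 := mulVec_injective_iff_isUnit.2 hpd.isUnit hrow2
      apply hv
      ext i
      rcases i with ⟨⟩ | i
      · exact h0
      · exact congrFun h3 i
    set w : m → ℂ := (v (Sum.inl ()))⁻¹ • (fun i => v (Sum.inr i)) with hw
    have hb : ((x : ℂ) • 1 - D) *ᵥ w = b := by
      rw [hw, mulVec_smul, hrow2, smul_smul, inv_mul_cancel₀ hv0, one_smul]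
    have ha : (x - a : ℂ) = star b ⬝ᵥ w := by
      rw [hw, dotProduct_smul, ← hrow1, smul_eq_mul]
      field_simp
    refine ⟨(x, w), hpd, ?_⟩
    have hstar : (star w ⬝ᵥ b).re = (star b ⬝ᵥ w).re := by
      have : star w ⬝ᵥ b = star (star b ⬝ᵥ w) := by
        rw [star_dotProduct]
      rw [this]; simp
    simp only [fromEigen, hb, hstar, ← ha]
    simp
  rcases isEmpty_or_nonempty m with hm | hm
  · refine ⟨0, fun a b => ?_⟩
    rcases main a b with h | ⟨x, -, -, h⟩
    · exact Or.inl h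
    · simp at h
  obtain ⟨y, u, hy, hu, hyu⟩ := exists_top_eigenvector hD
  refine ⟨u, fun a b => ?_⟩
  rcases main a b with h | ⟨x, hxA, hx, hdet⟩
  · exact Or.inl h
  right
  refine ⟨hu, ?_⟩
  obtain ⟨v, hv, hxv⟩ := exists_mulVec_eq_zero_iff.2 hdet
  have key : ∀ (x y : ℝ) (u : m → ℂ), u ≠ 0 → ((x : ℂ) • 1 - D).PosSemidef →
      ((y : ℂ) • 1 - D) *ᵥ u = 0 → y ≤ x := by
    intro x y u hu hx hyu
    have h1 := hx.dotProduct_mulVec_nonneg u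
    have h2 : ((x : ℂ) • 1 - D) = ((x - y : ℝ) : ℂ) • 1 + ((y : ℂ) • 1 - D) := by
      push_cast; rw [sub_smul]; abel
    rw [h2, add_mulVec, hyu, add_zero, smul_mulVec, one_mulVec, dotProduct_smul] at h1
    have h3 := (dotProduct_star_self_pos_iff (v := u)).2 hu
    have h4 := (Complex.le_def.1 h1).1
    simp only [Complex.zero_re, smul_eq_mul, Complex.re_ofReal_mul] at h4
    have := nonneg_of_mul_nonneg_left h4 (Complex.pos_iff.1 h3).1
    linarith
  obtain rfl : x = y := le_antisymm (key y x v hv hy hxv) (key x y u hu hx hyu)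
  -- The vector (0, u) is isotropic for the positive semidefinite form x - A, hence in its kernel;
  -- the first row of that kernel equation is the orthogonality sought.
  have h5 : star (Sum.elim (0 : Unit → ℂ) u) ⬝ᵥ
      (((x : ℂ) • 1 - bordered a b D) *ᵥ Sum.elim (0 : Unit → ℂ) u) = 0 := by
    have h6 : (((x : ℂ) • 1 - bordered a b D) *ᵥ Sum.elim (0 : Unit → ℂ) u) =
        Sum.elim (fun _ => - (star b ⬝ᵥ u)) (((x : ℂ) • 1 - D) *ᵥ u) := by
      ext i
      rcases i with i | i <;>
      simp [sub_mulVec, bordered, smul_mulVec, mulVec, dotProduct, one_apply, sub_mul]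
    rw [h6, hyu]
    simp [dotProduct]
  have h7 := (hxA.dotProduct_mulVec_zero_iff _).1 h5
  have := congrFun h7 (Sum.inl ())
  simpa [sub_mulVec, bordered, smul_mulVec, fromBlocks_mulVec, mulVec, dotProduct] using this

theorem exists_conjTranspose_mul_self {G : Matrix m m ℂ} (hG : G.PosDef) :
    ∃ C : Matrix m m ℂ, G = Cᴴ * C ∧ C.det ≠ 0 := by
  open scoped MatrixOrder in
  obtain ⟨C, hC⟩ := CStarAlgebra.nonneg_iff_eq_star_mul_self.mp hG.posSemidef.nonneg
  refine ⟨C, hC, fun h => ?_⟩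
  have := hG.det_pos
  rw [hC, det_mul, h, mul_zero] at this
  exact lt_irrefl _ this

theorem posDef_one_add (w : m → ℂ) :
    (1 + replicateCol Unit w * (replicateCol Unit w)ᴴ).PosDef :=
  PosDef.one.add_posSemidef (posSemidef_self_mul_conjTranspose _)

/-- Deflation: in a basis made of (1, w) and of its orthogonal complement, the bordered matrix
becomes block diagonal with blocks x and x - C(x - D)C*. -/
theorem weight_bordered {D C : Matrix m m ℂ} (hD : D.IsHermitian) {w : m → ℂ}
    (hC : 1 + replicateCol Unit w * (replicateCol Unit w)ᴴ = Cᴴ * C) (hC0 : C.det ≠ 0) (x : ℝ)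
    (p : ℝ[X]) :
    weight p (bordered (fromEigen D (x, w)).1 (fromEigen D (x, w)).2 D) =
      Real.exp (-x ^ 2) * p.eval x ^ 2 *
        weight p ((x : ℂ) • 1 - C * ((x : ℂ) • 1 - D) * Cᴴ) := by
  have hu : IsUnit C.det := isUnit_iff_ne_zero.mpr hC0
  set V := replicateCol Unit w with hV
  set T := (x : ℂ) • 1 - D
  rw [← weight_fromBlocks]
  have hS := shift_bordered hD x w
  set A := bordered (fromEigen D (x, w)).1 (fromEigen D (x, w)).2 D
  -- The first column is (1, w); the others form an orthonormal basis of its orthogonal complement,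
  -- orthonormality being C*C = 1 + ww*.
  set S : Matrix (Unit ⊕ m) (Unit ⊕ m) ℂ := fromBlocks 1 (-(Vᴴ * C⁻¹)) V C⁻¹ with hSdef
  have hkS : killer w * S = fromCols 0 Cᴴ := by
    rw [killer, hSdef, ← fromRows_fromCols_eq_fromBlocks, fromCols_mul_fromRows, mul_fromCols, mul_fromCols]
    have h2 : V * (Vᴴ * C⁻¹) + C⁻¹ = Cᴴ := by
      have : V * (Vᴴ * C⁻¹) + C⁻¹ = (1 + V * Vᴴ) * C⁻¹ := by
        rw [Matrix.add_mul, Matrix.one_mul, Matrix.mul_assoc, add_comm]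
      rw [this, hC, Matrix.mul_assoc, mul_nonsing_inv _ hu, Matrix.mul_one]
    ext i j
    rcases j with j | j
    · simp [← hV]
    · rw [← h2]
      simp [← hV, Matrix.add_apply]
  have hinter : ((x : ℂ) • 1 - A) * S =
      S * ((x : ℂ) • 1 - fromBlocks ((x : ℂ) • (1 : Matrix Unit Unit ℂ)) 0 0
        ((x : ℂ) • 1 - C * T * Cᴴ)) := by
    have h1 : (x : ℂ) • (1 : Matrix (Unit ⊕ m) (Unit ⊕ m) ℂ) -
        fromBlocks ((x : ℂ) • (1 : Matrix Unit Unit ℂ)) 0 0 ((x : ℂ) • 1 - C * T * Cᴴ) =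
        fromBlocks 0 0 0 (C * T * Cᴴ) := by
      rw [← fromBlocks_one, fromBlocks_smul, sub_eq_add_neg, fromBlocks_neg, fromBlocks_add]
      simp
    rw [h1, hS, Matrix.mul_assoc, hkS, Matrix.mul_assoc, mul_fromCols, killer,
      conjTranspose_fromCols_eq_fromRows_conjTranspose, fromRows_mul_fromCols, hSdef,
      fromBlocks_multiply]
    have h3 : C⁻¹ * (C * T * Cᴴ) = T * Cᴴ := by
      rw [← Matrix.mul_assoc, ← Matrix.mul_assoc, nonsing_inv_mul _ hu, Matrix.one_mul]
    congr 1
    · simp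
    · simp only [Matrix.mul_zero, zero_add, Matrix.neg_mul, Matrix.mul_assoc,
        conjTranspose_neg, ← hV]
      rw [← Matrix.mul_assoc C⁻¹ C, nonsing_inv_mul _ hu, Matrix.one_mul]
    · simp
    · rw [h3, Matrix.mul_zero, zero_add, conjTranspose_one, Matrix.one_mul]
  have hint2 : A * S = S * fromBlocks ((x : ℂ) • (1 : Matrix Unit Unit ℂ)) 0 0
        ((x : ℂ) • 1 - C * T * Cᴴ) := by
    rw [Matrix.sub_mul, Matrix.mul_sub] at hinter
    simpa using hinter
  refine weight_eq_of_intertwine hint2 ?_ p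
  rw [hSdef, det_fromBlocks_one₁₁, Matrix.mul_neg, sub_neg_eq_add]
  have : C⁻¹ + V * (Vᴴ * C⁻¹) = Cᴴ := by
    have : C⁻¹ + V * (Vᴴ * C⁻¹) = (1 + V * Vᴴ) * C⁻¹ := by
      rw [Matrix.add_mul, Matrix.one_mul, Matrix.mul_assoc]
    rw [this, hC, Matrix.mul_assoc, mul_nonsing_inv _ hu, Matrix.mul_one]
  rw [this, det_conjTranspose]
  simpa using hC0

theorem posDef_conj_iff {C : Matrix m m ℂ} (hC0 : C.det ≠ 0) (T : Matrix m m ℂ) :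
    (C * T * Cᴴ).PosDef ↔ T.PosDef :=
  Matrix.IsUnit.posDef_star_right_conjugate_iff
    ((isUnit_iff_isUnit_det C).2 (isUnit_iff_ne_zero.2 hC0))

end Bordered
end GUETail

namespace GUETail
open Matrix Polynomial
open scoped ComplexOrder

/-! ### The Jacobian of the eigenvalue–eigenvector substitution. -/

section Jacobian

theorem det_lower_triangular {M M' : Type*} [AddCommGroup M] [Module ℝ M] [FiniteDimensional ℝ M]
    [AddCommGroup M'] [Module ℝ M'] [FiniteDimensional ℝ M'] (f : M →ₗ[ℝ] M) (g : M' →ₗ[ℝ] M')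
    (k : M →ₗ[ℝ] M') :
    ((f.comp (LinearMap.fst ℝ M M')).prod
      (g.comp (LinearMap.snd ℝ M M') + k.comp (LinearMap.fst ℝ M M'))).det = f.det * g.det := by
  classical
  let b := Module.finBasis ℝ M
  let b' := Module.finBasis ℝ M'
  rw [← LinearMap.det_toMatrix (b.prod b'), ← LinearMap.det_toMatrix b, ← LinearMap.det_toMatrix b',
    ← det_fromBlocks_zero₁₂ _ (LinearMap.toMatrix b b' k)]
  congr 1
  ext i j
  rcases i with i | i <;> rcases j with j | j <;> simp [LinearMap.toMatrix_apply]

theorem det_upper_triangular {M M' : Type*} [AddCommGroup M] [Module ℝ M] [FiniteDimensional ℝ M]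
    [AddCommGroup M'] [Module ℝ M'] [FiniteDimensional ℝ M'] (f : M →ₗ[ℝ] M) (g : M' →ₗ[ℝ] M')
    (k : M' →ₗ[ℝ] M) :
    ((f.comp (LinearMap.fst ℝ M M') + k.comp (LinearMap.snd ℝ M M')).prod
      (g.comp (LinearMap.snd ℝ M M'))).det = f.det * g.det := by
  classical
  let b := Module.finBasis ℝ M
  let b' := Module.finBasis ℝ M'
  rw [← LinearMap.det_toMatrix (b.prod b'), ← LinearMap.det_toMatrix b, ← LinearMap.det_toMatrix b',
    ← det_fromBlocks_zero₂₁ _ (LinearMap.toMatrix b' b k)]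
  congr 1
  ext i j
  rcases i with i | i <;> rcases j with j | j <;> simp [LinearMap.toMatrix_apply]

variable {m : Type*} [Fintype m] [DecidableEq m]

/-- The map `(dx, dw) ↦ (dx, (x - D) dw + dx w)`. -/
noncomputable def fromEigenInner (D : Matrix m m ℂ) (z : ℝ × (m → ℂ)) :
    ℝ × (m → ℂ) →ₗ[ℝ] ℝ × (m → ℂ) :=
  (LinearMap.id.comp (LinearMap.fst ℝ ℝ (m → ℂ))).prod
    (((toLin' ((z.1 : ℂ) • 1 - D)).restrictScalars ℝ).comp (LinearMap.snd ℝ ℝ (m → ℂ)) +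
      (LinearMap.toSpanSingleton ℝ (m → ℂ) z.2).comp (LinearMap.fst ℝ ℝ (m → ℂ)))

/-- The map `(dx, y) ↦ ((1 + |w|²) dx - 2 Re (w* y), y)`. -/
noncomputable def fromEigenOuter (w : m → ℂ) : ℝ × (m → ℂ) →ₗ[ℝ] ℝ × (m → ℂ) :=
  (((1 + (star w ⬝ᵥ w).re) • LinearMap.id).comp (LinearMap.fst ℝ ℝ (m → ℂ)) +
      ((-2 : ℝ) • (Complex.reLm.comp ((dotProductBilin ℂ ℂ (star w)).restrictScalars ℝ))).comp
        (LinearMap.snd ℝ ℝ (m → ℂ))).prod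
    (LinearMap.id.comp (LinearMap.snd ℝ ℝ (m → ℂ)))

/-- The derivative of `fromEigen D`. -/
noncomputable def fromEigenDeriv (D : Matrix m m ℂ) (z : ℝ × (m → ℂ)) :
    ℝ × (m → ℂ) →L[ℝ] ℝ × (m → ℂ) :=
  LinearMap.toContinuousLinearMap (fromEigenOuter z.2 ∘ₗ fromEigenInner D z)

/-- Writing da in terms of db, as (1 + |w|²) dx - 2 Re(w* db), splits the derivative into two
triangular maps. The square comes from taking the real determinant of a complex linear map. -/
theorem abs_det_fromEigenDeriv (D : Matrix m m ℂ) (z : ℝ × (m → ℂ)) :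
    |(fromEigenDeriv D z).det| =
      (1 + (star z.2 ⬝ᵥ z.2).re) * ‖((z.1 : ℂ) • 1 - D).det‖ ^ 2 := by
  have h0 : 0 ≤ (star z.2 ⬝ᵥ z.2).re :=
    (Complex.le_def.1 (dotProduct_star_self_nonneg z.2)).1
  have h1 : (fromEigenInner D z).det = ‖((z.1 : ℂ) • 1 - D).det‖ ^ 2 := by
    rw [fromEigenInner, det_lower_triangular, LinearMap.det_id, one_mul,
      LinearMap.det_restrictScalars, LinearMap.det_toLin', Algebra.norm_complex_apply,
      Complex.normSq_eq_norm_sq]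
  have h2 : (fromEigenOuter z.2).det = 1 + (star z.2 ⬝ᵥ z.2).re := by
    rw [fromEigenOuter]
    refine (det_upper_triangular _ _ _).trans ?_
    rw [LinearMap.det_id, LinearMap.det_smul]
    simp
  rw [fromEigenDeriv, LinearMap.det_toContinuousLinearMap, LinearMap.det_comp, h1, h2,
    abs_of_nonneg (by positivity)]

theorem shift_mulVec_apply (D : Matrix m m ℂ) (x : ℝ) (v : m → ℂ) (i : m) :
    (((x : ℂ) • 1 - D) *ᵥ v) i = x * v i - ∑ j, D i j * v j := by
  rw [sub_mulVec, Pi.sub_apply, smul_mulVec, one_mulVec]; rfl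

theorem hasFDerivAt_fromEigen {D : Matrix m m ℂ} (hD : D.IsHermitian) (z : ℝ × (m → ℂ)) :
    HasFDerivAt (fromEigen D) (fromEigenDeriv D z) z := by
  have hfst : HasFDerivAt (fun y : ℝ × (m → ℂ) => y.1) (ContinuousLinearMap.fst ℝ ℝ (m → ℂ)) z :=
    hasFDerivAt_fst
  have hsnd : HasFDerivAt (fun y : ℝ × (m → ℂ) => y.2) (ContinuousLinearMap.snd ℝ ℝ (m → ℂ)) z :=
    hasFDerivAt_snd
  have hofReal : HasFDerivAt (fun y : ℝ × (m → ℂ) => (y.1 : ℂ))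
      (Complex.ofRealCLM.comp (ContinuousLinearMap.fst ℝ ℝ (m → ℂ))) z :=
    Complex.ofRealCLM.hasFDerivAt.comp z hfst
  have hcoord : ∀ i, HasFDerivAt (fun y : ℝ × (m → ℂ) => y.2 i)
      ((ContinuousLinearMap.proj i).comp (ContinuousLinearMap.snd ℝ ℝ (m → ℂ))) z := fun i =>
    (ContinuousLinearMap.proj (R := ℝ) (φ := fun _ : m => ℂ) i).hasFDerivAt.comp z hsnd
  have hconj : ∀ i, HasFDerivAt (fun y : ℝ × (m → ℂ) => star (y.2 i)) _ z := fun i =>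
    (Complex.conjCLE : ℂ →L[ℝ] ℂ).hasFDerivAt.comp z (hcoord i)
  have hrow : ∀ i, HasFDerivAt (fun y : ℝ × (m → ℂ) => (y.1 : ℂ) * y.2 i - ∑ j, D i j * y.2 j) _ z :=
    fun i => (hofReal.mul (hcoord i)).sub
      (HasFDerivAt.fun_sum fun j _ => (hcoord j).const_mul (D i j))
  have hmain := (hfst.sub (Complex.reCLM.hasFDerivAt.comp z
    (HasFDerivAt.fun_sum (u := Finset.univ) fun i _ => (hconj i).mul (hrow i)))).prodMk
      (hasFDerivAt_pi.2 hrow)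
  have hT := isHermitian_shift hD z.1
  refine (hmain.congr_fderiv ?_).congr_of_eventuallyEq (Filter.Eventually.of_forall fun y => ?_)
  · refine ContinuousLinearMap.ext fun h => Prod.ext ?_ ?_
    · have e2 : (fromEigenDeriv D z h).1 = (1 + (star z.2 ⬝ᵥ z.2).re) * h.1 - 2 *
          (star z.2 ⬝ᵥ ((((z.1 : ℂ) • 1 - D) *ᵥ h.2) + (h.1 : ℂ) • z.2)).re := by
        simp only [fromEigenDeriv, fromEigenOuter, fromEigenInner]
        generalize (z.1 : ℂ) • 1 - D = T
        simp [-Complex.coe_smul, sub_eq_add_neg (_ * _)]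
      -- The two halves of the derivative of the quadratic form w*(x - D)w are conjugate because x -
      -- D is Hermitian; this produces the factor 2.
      have e3 : (star z.2 ⬝ᵥ (((z.1 : ℂ) • 1 - D) *ᵥ h.2)).re =
          (star h.2 ⬝ᵥ (((z.1 : ℂ) • 1 - D) *ᵥ z.2)).re := by
        have : star z.2 ⬝ᵥ (((z.1 : ℂ) • 1 - D) *ᵥ h.2) =
            star (star h.2 ⬝ᵥ (((z.1 : ℂ) • 1 - D) *ᵥ z.2)) := by
          rw [← star_dotProduct, star_mulVec, hT.eq, ← dotProduct_mulVec]
        rw [this]; simp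
      rw [e2, dotProduct_add, dotProduct_smul, Complex.add_re, smul_eq_mul, Complex.re_ofReal_mul]
      have e1 : h.1 - (star z.2 ⬝ᵥ ((((z.1 : ℂ) • 1 - D) *ᵥ h.2) + (h.1 : ℂ) • z.2) +
          star h.2 ⬝ᵥ (((z.1 : ℂ) • 1 - D) *ᵥ z.2)).re = (1 + (star z.2 ⬝ᵥ z.2).re) * h.1 -
          2 * ((star z.2 ⬝ᵥ (((z.1 : ℂ) • 1 - D) *ᵥ h.2)).re + h.1 * (star z.2 ⬝ᵥ z.2).re) := by
        rw [dotProduct_add, dotProduct_smul, Complex.add_re, Complex.add_re, smul_eq_mul,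
          Complex.re_ofReal_mul, ← e3]
        ring
      rw [← e1]
      simp only [dotProduct, Pi.add_apply, shift_mulVec_apply, ← Finset.sum_add_distrib]
      simp only [ContinuousLinearMap.prod_apply, _root_.sub_apply,
        ContinuousLinearMap.coe_fst', ContinuousLinearMap.comp_apply, _root_.sum_apply,
        Complex.reCLM_apply, _root_.add_apply, _root_.smul_apply,
        ContinuousLinearMap.proj_apply, ContinuousLinearMap.coe_snd', Complex.ofRealCLM_apply,
        ContinuousLinearEquiv.coe_coe, Complex.conjCLE_apply]
      congr 2
      refine Finset.sum_congr rfl fun i _ => ?_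
      simp
      ring
    · ext i
      simp only [fromEigenDeriv, fromEigenOuter, fromEigenInner]
      simp [-Complex.coe_smul, mulVec, dotProduct]
      ring
  · refine Prod.ext ?_ (funext fun i => ?_)
    · simp [fromEigen, dotProduct, -Complex.coe_smul, shift_mulVec_apply]
    · simp only [fromEigen, shift_mulVec_apply]

end Jacobian
end GUETail

namespace GUETail
open Matrix Polynomial
open scoped ComplexOrder

/-! ### Real linear coordinates on Hermitian matrices. -/

section Coordinates

/-- The real vector space of Hermitian matrices. -/
noncomputable abbrev Herm (m : Type*) := selfAdjoint.submodule ℝ (Matrix m m ℂ)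

theorem isHermitian_coe {m : Type*} (X : Herm m) : (X : Matrix m m ℂ).IsHermitian := X.2

/-- The coordinate space of `n × n` Hermitian matrices. -/
abbrev HermCoord (n : ℕ) := Fin n ⊕ LowerPair n ⊕ LowerPair n → ℝ

/-- The Hermitian matrix with given diagonal and lower-triangular coordinates. -/
noncomputable def toMatrix {n : ℕ} (x : HermCoord n) : Matrix (Fin n) (Fin n) ℂ := fun i j =>
  if h : j < i then x (.inr (.inl ⟨(i, j), h⟩)) + Complex.I * x (.inr (.inr ⟨(i, j), h⟩))
  else if h : i < j then x (.inr (.inl ⟨(j, i), h⟩)) - Complex.I * x (.inr (.inr ⟨(j, i), h⟩))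
  else x (.inl i)

theorem toMatrix_isHermitian {n : ℕ} (x : HermCoord n) : (toMatrix x).IsHermitian := by
  ext i j
  rcases lt_trichotomy i j with h | h | h
  · simp [toMatrix, h, h.not_gt, sub_eq_add_neg]
  · simp [toMatrix, h]
  · simp [toMatrix, h, h.not_gt, sub_eq_add_neg]

/-- Coordinates of a matrix. -/
def coord {n : ℕ} (X : Matrix (Fin n) (Fin n) ℂ) : HermCoord n
  | .inl i => (X i i).re
  | .inr (.inl p) => (X p.1.1 p.1.2).re
  | .inr (.inr p) => (X p.1.1 p.1.2).im

theorem toMatrix_coord {n : ℕ} {X : Matrix (Fin n) (Fin n) ℂ} (hX : X.IsHermitian) :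
    toMatrix (coord X) = X := by
  ext i j
  rcases lt_trichotomy i j with h | h | h
  · rw [← hX.apply i j]
    apply Complex.ext <;> simp [toMatrix, coord, h, h.not_gt]
  · subst h
    apply Complex.ext
    · simp [toMatrix, coord]
    · have := congrArg Complex.im (hX.apply i i)
      simp at this
      simp [toMatrix]
      linarith
  · apply Complex.ext <;> simp [toMatrix, coord, h]

theorem coord_toMatrix {n : ℕ} (x : HermCoord n) : coord (toMatrix x) = x := by
  ext i
  rcases i with i | ⟨⟨⟨i, j⟩, h⟩⟩ | ⟨⟨⟨i, j⟩, h⟩⟩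
  · simp [coord, toMatrix]
  · simp only at h; simp [coord, toMatrix, h]
  · simp only at h; simp [coord, toMatrix, h]

/-- Hermitian matrices in coordinates, as a linear equivalence. -/
noncomputable def coordEquiv (n : ℕ) : HermCoord n ≃ₗ[ℝ] Herm (Fin n) where
  toFun x := ⟨toMatrix x, toMatrix_isHermitian x⟩
  invFun X := coord X.1
  left_inv := coord_toMatrix
  right_inv X := Subtype.ext (toMatrix_coord X.2)
  map_add' x y := by
    refine Subtype.ext ?_
    ext i j
    simp only [toMatrix, Submodule.coe_add, Matrix.add_apply]
    split_ifs <;> simp <;> ring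
  map_smul' c x := by
    refine Subtype.ext ?_
    ext i j
    simp only [toMatrix, Submodule.coe_smul, Matrix.smul_apply]
    split_ifs <;> simp <;> ring

/-- Hermitian matrices on `Unit ⊕ m` as bordered matrices. -/
noncomputable def borderedEquiv (m : Type*) : ((ℝ × (m → ℂ)) × Herm m) ≃ₗ[ℝ] Herm (Unit ⊕ m) where
  toFun z := ⟨bordered z.1.1 z.1.2 z.2.1, isHermitian_bordered z.2.2 _ _⟩
  invFun X := (((X.1 (.inl ()) (.inl ())).re, fun i => X.1 (.inr i) (.inl ())),
    ⟨X.1.submatrix .inr .inr, (isHermitian_coe X).submatrix _⟩)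
  left_inv z := by
    refine Prod.ext (Prod.ext ?_ ?_) (Subtype.ext ?_)
    · simp [bordered]
    · ext i; simp [bordered]
    · ext i j; simp [bordered]
  right_inv X := by
    refine Subtype.ext ?_
    ext i j
    have h := fun i j => (isHermitian_coe X).apply i j
    rcases i with ⟨⟩ | i <;> rcases j with ⟨⟩ | j
    · have := congrArg Complex.im (h (.inl ()) (.inl ()))
      simp at this
      apply Complex.ext
      · simp [bordered]
      · simp [bordered]; linarith
    · simp [bordered, ← h (.inl ()) (.inr j)]
    · simp [bordered]
    · simp [bordered]
  map_add' z w := by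
    refine Subtype.ext ?_
    ext i j
    rcases i with ⟨⟩ | i <;> rcases j with ⟨⟩ | j <;> simp [bordered]
  map_smul' c z := by
    refine Subtype.ext ?_
    ext i j
    rcases i with ⟨⟩ | i <;> rcases j with ⟨⟩ | j <;> simp [bordered]

/-- Reindexing Hermitian matrices. -/
noncomputable def reindexHerm {m n : Type*} (e : m ≃ n) : Herm m ≃ₗ[ℝ] Herm n where
  toFun X := ⟨X.1.submatrix e.symm e.symm, (isHermitian_coe X).submatrix _⟩
  invFun X := ⟨X.1.submatrix e e, (isHermitian_coe X).submatrix _⟩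
  left_inv X := Subtype.ext (by ext; simp)
  right_inv X := Subtype.ext (by ext; simp)
  map_add' X Y := rfl
  map_smul' c X := rfl

/-- Conjugation by an invertible matrix. -/
noncomputable def conjHerm {m : Type*} [Fintype m] [DecidableEq m] {C : Matrix m m ℂ}
    (hC : C.det ≠ 0) : Herm m ≃ₗ[ℝ] Herm m where
  toFun X := ⟨C * X.1 * Cᴴ, isHermitian_mul_mul_conjTranspose _ X.2⟩
  invFun X := ⟨C⁻¹ * X.1 * (C⁻¹)ᴴ, isHermitian_mul_mul_conjTranspose _ X.2⟩
  left_inv X := Subtype.ext <| by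
    have hu : IsUnit C.det := isUnit_iff_ne_zero.mpr hC
    have hu' : IsUnit (Cᴴ).det := by rw [det_conjTranspose]; exact hu.star
    simp only [conjTranspose_nonsing_inv, Matrix.mul_assoc]
    rw [mul_nonsing_inv _ hu', ← Matrix.mul_assoc, nonsing_inv_mul _ hu, Matrix.one_mul,
      Matrix.mul_one]
  right_inv X := Subtype.ext <| by
    have hu : IsUnit C.det := isUnit_iff_ne_zero.mpr hC
    have hu' : IsUnit (Cᴴ).det := by rw [det_conjTranspose]; exact hu.star
    simp only [conjTranspose_nonsing_inv, Matrix.mul_assoc]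
    rw [nonsing_inv_mul _ hu', ← Matrix.mul_assoc, mul_nonsing_inv _ hu, Matrix.one_mul,
      Matrix.mul_one]
  map_add' X Y := Subtype.ext (by simp [Matrix.mul_add, Matrix.add_mul])
  map_smul' c X := Subtype.ext (by simp)

/-- By uniqueness of Haar measure, any linear change of coordinates costs only a constant. Its value
is never needed: the total probability fixes the normalisation in the end. -/
theorem exists_lintegral_comp_linearEquiv {V V' : Type*} [NormedAddCommGroup V] [NormedSpace ℝ V]
    [FiniteDimensional ℝ V] [MeasurableSpace V] [BorelSpace V] [NormedAddCommGroup V']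
    [NormedSpace ℝ V'] [FiniteDimensional ℝ V'] [MeasurableSpace V'] [BorelSpace V']
    (f : V ≃ₗ[ℝ] V') (μ : Measure V) [μ.IsAddHaarMeasure] (ν : Measure V') [ν.IsAddHaarMeasure] :
    ∃ c : ENNReal, c ≠ 0 ∧ c ≠ ⊤ ∧ ∀ F : V' → ENNReal, ∫⁻ x, F (f x) ∂μ = c * ∫⁻ y, F y ∂ν := by
  let g : V ≃L[ℝ] V' := f.toContinuousLinearEquiv
  have hmap : (μ.map g).IsAddHaarMeasure := g.isAddHaarMeasure_map μ
  have h := Measure.isAddLeftInvariant_eq_smul (μ.map g) ν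
  set c := Measure.addHaarScalarFactor (μ.map g) ν
  have hc : 0 < c := Measure.addHaarScalarFactor_pos_of_isAddHaarMeasure _ _
  refine ⟨c, by exact_mod_cast hc.ne', ENNReal.coe_ne_top, fun F => ?_⟩
  have := lintegral_map_equiv (μ := μ) F g.toHomeomorph.toMeasurableEquiv
  change ∫⁻ a, F a ∂(μ.map g) = ∫⁻ a, F (f a) ∂μ at this
  rw [← this, h, lintegral_smul_measure, ENNReal.smul_def, smul_eq_mul]

end Coordinates

/-! ### The weight restricted to matrices with spectrum below a level. -/

section Cut

variable {m : Type*} [Fintype m] [DecidableEq m]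

theorem isClosed_posSemidef {m : Type*} [Fintype m] : IsClosed {M : Matrix m m ℂ | M.PosSemidef} := by
  have : {M : Matrix m m ℂ | M.PosSemidef} = {M | Mᴴ = M} ∩
      ⋂ v : m → ℂ, {M | 0 ≤ star v ⬝ᵥ (M *ᵥ v)} := by
    ext M
    simp [posSemidef_iff_dotProduct_mulVec, IsHermitian]
  rw [this]
  refine (isClosed_eq (by fun_prop) continuous_id).inter (isClosed_iInter fun v => ?_)
  exact isClosed_le continuous_const (by fun_prop)

theorem measurableSet_posDef {α : Type*} [TopologicalSpace α] [MeasurableSpace α]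
    [OpensMeasurableSpace α] {g : α → Matrix m m ℂ} (hg : Continuous g) :
    MeasurableSet {z | (g z).PosDef} := by
  have : {z | (g z).PosDef} = g ⁻¹' {M | M.PosSemidef} ∩ {z | (g z).det ≠ 0} := by
    ext z
    constructor
    · intro h
      exact ⟨h.posSemidef, h.posSemidef.posDef_iff_det_ne_zero.1 h⟩
    · intro h
      exact (PosSemidef.posDef_iff_det_ne_zero h.1).2 h.2
  rw [this]
  exact (isClosed_posSemidef.preimage hg).measurableSet.inter
    (isOpen_ne.preimage hg.matrix_det).measurableSet

theorem continuous_weight (p : ℝ[X]) : Continuous (weight p : Matrix m m ℂ → ℝ) := by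
  have h : Continuous fun X : Matrix m m ℂ => aeval X p := by
    simp only [aeval_eq_sum_range]
    fun_prop
  unfold weight
  exact (Complex.continuous_re.comp (by fun_prop)).neg.rexp.mul
    ((continuous_norm.comp h.matrix_det).pow 2)

/-- The weight cut off to matrices with spectrum below `s`. -/
noncomputable def cutWeight (s : ℝ) (p : ℝ[X]) : Matrix m m ℂ → ENNReal :=
  Set.indicator {X | ((s : ℂ) • 1 - X).PosDef} fun X => ENNReal.ofReal (weight p X)

theorem measurable_cutWeight {α : Type*} [TopologicalSpace α] [MeasurableSpace α]
    [OpensMeasurableSpace α] {g : α → Matrix m m ℂ} (hg : Continuous g) {u : α → ℝ}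
    (hu : Continuous u) (p : ℝ[X]) : Measurable fun z => cutWeight (u z) p (g z) := by
  have h := (((continuous_weight p).comp hg).measurable.ennreal_ofReal).indicator
    (measurableSet_posDef (g := fun z => ((u z : ℝ) : ℂ) • 1 - g z) (by fun_prop))
  exact h

theorem cutWeight_reindex {n : Type*} [Fintype n] [DecidableEq n] (e : m ≃ n) (s : ℝ) (p : ℝ[X])
    (X : Matrix m m ℂ) : cutWeight s p (X.submatrix e.symm e.symm) = cutWeight s p X := by
  have h1 : (s : ℂ) • (1 : Matrix n n ℂ) - X.submatrix e.symm e.symm =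
      ((s : ℂ) • 1 - X).submatrix e.symm e.symm := by
    ext i j; simp [one_apply]
  have h2 : (((s : ℂ) • 1 - X).submatrix e.symm e.symm).PosDef ↔ ((s : ℂ) • 1 - X).PosDef := by
    constructor
    · intro h
      simpa using h.submatrix e.injective
    · intro h
      exact h.submatrix e.symm.injective
  have h3 : weight p (X.submatrix e.symm e.symm) = weight p X := by
    have ha : ∀ Y : Matrix m m ℂ, Y.submatrix e.symm e.symm = reindexAlgEquiv ℝ ℂ e Y := fun _ => rfl
    unfold weight
    rw [ha, aeval_algHom_apply, ← map_mul, ← ha, ← ha, det_submatrix_equiv_self]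
    congr 4
    simp only [trace, submatrix_apply, diag_apply]
    exact e.symm.sum_comp fun i => (X * X) i i
  unfold cutWeight
  by_cases h : ((s : ℂ) • 1 - X).PosDef
  · rw [Set.indicator_of_mem, Set.indicator_of_mem, h3]
    · exact h
    · show Matrix.PosDef _
      rw [h1]; exact h2.2 h
  · rw [Set.indicator_of_notMem, Set.indicator_of_notMem]
    · exact h
    · show ¬ Matrix.PosDef _
      rw [h1]; exact fun h' => h (h2.1 h')

end Cut
end GUETail

namespace GUETail
open Matrix Polynomial
open scoped ComplexOrder

/-! ### The recursion obtained by integrating out the top eigenvalue. -/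

section Recursion

theorem isAddHaarMeasure_volume_prod {V V' : Type*} [NormedAddCommGroup V] [NormedSpace ℝ V]
    [FiniteDimensional ℝ V] [MeasureSpace V] [BorelSpace V] [NormedAddCommGroup V']
    [NormedSpace ℝ V'] [FiniteDimensional ℝ V'] [MeasureSpace V'] [BorelSpace V']
    [(volume : Measure V).IsAddHaarMeasure] [(volume : Measure V').IsAddHaarMeasure] :
    (volume : Measure (V × V')).IsAddHaarMeasure :=
  Measure.prod.instIsAddHaarMeasure _ _

/-- The integral of `cutWeight s p` over all Hermitian matrices. -/
noncomputable def cutMass (n : ℕ) (s : ℝ) (p : ℝ[X]) : ENNReal :=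
  ∫⁻ x : HermCoord n, cutWeight s p (toMatrix x)

theorem continuous_toMatrix {n : ℕ} : Continuous (toMatrix : HermCoord n → _) := by
  refine continuous_matrix fun i j => ?_
  simp only [toMatrix]
  split_ifs <;> fun_prop

theorem continuous_bordered {m α : Type*} [TopologicalSpace α] {a : α → ℝ} {b : α → m → ℂ}
    {D : α → Matrix m m ℂ} (ha : Continuous a) (hb : Continuous b) (hD : Continuous D) :
    Continuous fun z => bordered (a z) (b z) (D z) := by
  refine continuous_matrix fun i j => ?_
  rcases i with i | i <;> rcases j with j | j <;> simp [bordered] <;> fun_prop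

variable {m : Type*} [Fintype m] [DecidableEq m]

theorem continuous_fromEigen {α : Type*} [TopologicalSpace α] {z : α → ℝ × (m → ℂ)}
    {D : α → Matrix m m ℂ} (hz : Continuous z) (hD : Continuous D) :
    Continuous fun y => fromEigen (D y) (z y) := by
  unfold fromEigen
  fun_prop

/-- The integrand after the substitution of eigenvalue and eigenvector for the border. -/
noncomputable def eigenIntegrand (s : ℝ) (p : ℝ[X]) (D : Matrix m m ℂ) (z : ℝ × (m → ℂ)) :
    ENNReal :=
  Set.indicator {z : ℝ × (m → ℂ) | ((z.1 : ℂ) • 1 - D).PosDef} (fun z =>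
    ENNReal.ofReal ((1 + (star z.2 ⬝ᵥ z.2).re) * ‖((z.1 : ℂ) • 1 - D).det‖ ^ 2) *
      cutWeight s p (bordered (fromEigen D z).1 (fromEigen D z).2 D)) z

theorem measurable_eigenIntegrand (s : ℝ) (p : ℝ[X]) {α : Type*} [TopologicalSpace α]
    [MeasurableSpace α] [OpensMeasurableSpace α] {D : α → Matrix m m ℂ} (hD : Continuous D)
    {z : α → ℝ × (m → ℂ)} (hz : Continuous z) :
    Measurable fun y => eigenIntegrand s p (D y) (z y) := by
  have h1 : Continuous fun y => (((z y).1 : ℂ) • 1 - D y) := by fun_prop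
  have hF := continuous_fromEigen hz hD
  have h2 : Measurable fun y => ENNReal.ofReal ((1 + (star (z y).2 ⬝ᵥ (z y).2).re) *
      ‖(((z y).1 : ℂ) • 1 - D y).det‖ ^ 2) *
        cutWeight s p (bordered (fromEigen (D y) (z y)).1 (fromEigen (D y) (z y)).2 (D y)) := by
    refine Measurable.mul ?_ ?_
    · refine (Continuous.measurable ?_).ennreal_ofReal
      have := h1.matrix_det
      fun_prop
    · exact measurable_cutWeight
        (continuous_bordered (continuous_fst.comp hF) (continuous_snd.comp hF) hD)
        continuous_const p
  exact h2.indicator (measurableSet_posDef h1)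

/-- The substitution is injective, and the borders it misses lie in the proper real subspace u* b =
0, which is null. -/
theorem lintegral_bordered {D : Matrix m m ℂ} (hD : D.IsHermitian) (s : ℝ) (p : ℝ[X]) :
    ∫⁻ z : ℝ × (m → ℂ), cutWeight s p (bordered z.1 z.2 D) = ∫⁻ z, eigenIntegrand s p D z := by
  set S : Set (ℝ × (m → ℂ)) := {z | ((z.1 : ℂ) • 1 - D).PosDef} with hS
  have hSm : MeasurableSet S := measurableSet_posDef (by fun_prop)
  obtain ⟨u, hu⟩ := exists_fromEigen hD
  have hfull : ∀ᵐ z : ℝ × (m → ℂ), z ∈ fromEigen D '' S := by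
    by_cases hu0 : u = 0
    · refine Filter.Eventually.of_forall fun z => ?_
      rcases hu z.1 z.2 with ⟨y, hy, hyz⟩ | ⟨h, -⟩
      · exact ⟨y, hy, hyz⟩
      · exact absurd hu0 h
    let K : Submodule ℝ (ℝ × (m → ℂ)) := LinearMap.ker
      (((dotProductBilin ℂ ℂ (star u)).restrictScalars ℝ).comp (LinearMap.snd ℝ ℝ (m → ℂ)))
    have hK : K ≠ ⊤ := by
      intro h
      have : ((0, u) : ℝ × (m → ℂ)) ∈ K := by rw [h]; trivial
      have h2 : star u ⬝ᵥ u = 0 := by simpa [K] using this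
      exact hu0 (dotProduct_star_self_eq_zero.1 h2)
    have := isAddHaarMeasure_volume_prod (V := ℝ) (V' := m → ℂ)
    have h0 := Measure.addHaar_submodule volume K hK
    rw [ae_iff]
    refine measure_mono_null (fun z hz => ?_) h0
    rcases hu z.1 z.2 with ⟨y, hy, hyz⟩ | ⟨-, h⟩
    · exact absurd ⟨y, hy, hyz⟩ hz
    · have : star u ⬝ᵥ z.2 = 0 := by
        have h3 : star u ⬝ᵥ z.2 = star (star z.2 ⬝ᵥ u) := by rw [star_dotProduct]
        rw [h3, h, star_zero]
      simpa [K] using this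
  have := isAddHaarMeasure_volume_prod (V := ℝ) (V' := m → ℂ)
  conv_lhs => rw [← Measure.restrict_eq_self_of_ae_mem hfull]
  rw [
    lintegral_image_eq_lintegral_abs_det_fderiv_mul volume hSm
      (fun z _ => (hasFDerivAt_fromEigen hD z).hasFDerivWithinAt) (injOn_fromEigen hD),
    ← lintegral_indicator hSm]
  simp only [abs_det_fromEigenDeriv]
  rfl

/-- Congruence by C preserves positive definiteness, so the constraint D < x turns into the same
constraint on the compressed matrix A'. Since det(A' - x) differs from det(x - D) by a factor of
modulus |det C|², the Jacobian becomes the extra polynomial factor X - x. -/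
theorem eigenIntegrand_eq {D C : Matrix m m ℂ} (hD : D.IsHermitian) {w : m → ℂ}
    (hC : 1 + replicateCol Unit w * (replicateCol Unit w)ᴴ = Cᴴ * C) (hC0 : C.det ≠ 0) (s x : ℝ)
    (p : ℝ[X]) :
    eigenIntegrand s p D (x, w) =
      ENNReal.ofReal ((1 + (star w ⬝ᵥ w).re) * (‖C.det‖ ^ 4)⁻¹) *
      ((Set.Iio s).indicator (fun x => ENNReal.ofReal (Real.exp (-x ^ 2) * p.eval x ^ 2)) x *
        cutWeight x (p * (Polynomial.X - Polynomial.C x))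
          ((x : ℂ) • 1 - C * ((x : ℂ) • 1 - D) * Cᴴ)) := by
  have h0 : 0 ≤ (star w ⬝ᵥ w).re := (Complex.le_def.1 (dotProduct_star_self_nonneg w)).1
  set A' := (x : ℂ) • 1 - C * ((x : ℂ) • 1 - D) * Cᴴ with hA'
  have hshift : (x : ℂ) • 1 - A' = C * ((x : ℂ) • 1 - D) * Cᴴ := by rw [hA']; abel
  by_cases hpd : ((x : ℂ) • 1 - D).PosDef
  swap
  · have h2 : A' ∉ {X | ((x : ℂ) • 1 - X).PosDef} := by
      simp only [Set.mem_ofPred_eq, hshift, posDef_conj_iff hC0]; exact hpd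
    rw [eigenIntegrand, Set.indicator_of_notMem (by exact hpd), cutWeight,
      Set.indicator_of_notMem h2]
    simp
  have h2 : A' ∈ {X | ((x : ℂ) • 1 - X).PosDef} := by
    simp only [Set.mem_ofPred_eq, hshift, posDef_conj_iff hC0]; exact hpd
  rw [eigenIntegrand, Set.indicator_of_mem (by exact hpd)]
  simp only
  by_cases hxs : x < s
  swap
  · rw [Set.indicator_of_notMem (by exact hxs), cutWeight, Set.indicator_of_notMem]
    · simp
    · exact fun h => hxs ((posDef_shift_bordered_iff hD hpd w s).1 h)
  rw [Set.indicator_of_mem (by exact hxs), cutWeight, cutWeight, Set.indicator_of_mem h2,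
    Set.indicator_of_mem (by exact (posDef_shift_bordered_iff hD hpd w s).2 hxs),
    weight_bordered hD hC hC0, weight_mul, ← hA',
    ← ENNReal.ofReal_mul (by positivity), ← ENNReal.ofReal_mul (by positivity),
    ← ENNReal.ofReal_mul (by positivity)]
  congr 1
  have hdet : ‖(aeval A' (Polynomial.X - Polynomial.C x)).det‖ =
      ‖C.det‖ ^ 2 * ‖((x : ℂ) • 1 - D).det‖ := by
    have h3 : aeval A' (Polynomial.X - Polynomial.C x) = -(C * ((x : ℂ) • 1 - D) * Cᴴ) := by
      rw [← hshift, map_sub, aeval_X, aeval_C, neg_sub, Algebra.algebraMap_eq_smul_one]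
      congr 1
    rw [h3, det_neg, det_mul, det_mul, det_conjTranspose]
    simp [pow_two, mul_right_comm]
  rw [hdet]
  have : ‖C.det‖ ≠ 0 := by simpa using hC0
  field_simp

/-- For fixed w and x the compressed matrix depends on D through a fixed linear congruence followed
by a translation. Hence the D-integral is again a mass of size n, with a constant depending on w
alone; this separates w from x. -/
theorem lintegral_eigenIntegrand (n : ℕ) (w : Fin n → ℂ) : ∃ K : ENNReal, ∀ s x p,
    ∫⁻ y : HermCoord n, eigenIntegrand s p (toMatrix y) (x, w) =
      K * ((Set.Iio s).indicator (fun x => ENNReal.ofReal (Real.exp (-x ^ 2) * p.eval x ^ 2)) x *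
        cutMass n x (p * (Polynomial.X - Polynomial.C x))) := by
  obtain ⟨C, hC, hC0⟩ := exists_conjTranspose_mul_self (posDef_one_add w)
  let L : HermCoord n ≃ₗ[ℝ] HermCoord n :=
    (coordEquiv n).trans ((conjHerm hC0).trans (coordEquiv n).symm)
  obtain ⟨c, -, -, hc⟩ := exists_lintegral_comp_linearEquiv L volume volume
  refine ⟨ENNReal.ofReal ((1 + (star w ⬝ᵥ w).re) * (‖C.det‖ ^ 4)⁻¹) * c, fun s x p => ?_⟩
  simp_rw [fun y : HermCoord n => eigenIntegrand_eq (toMatrix_isHermitian y) hC hC0 s x p]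
  have hmul : ∀ (r : ENNReal), r ≠ ⊤ → ∀ F : HermCoord n → ENNReal,
      ∫⁻ y, r * F y = r * ∫⁻ y, F y := fun r hr F => lintegral_const_mul' r F hr
  have hind : (Set.Iio s).indicator
      (fun x => ENNReal.ofReal (Real.exp (-x ^ 2) * p.eval x ^ 2)) x ≠ ⊤ := by
    by_cases h : x ∈ Set.Iio s
    · rw [Set.indicator_of_mem h]; exact ENNReal.ofReal_ne_top
    · rw [Set.indicator_of_notMem h]; exact ENNReal.zero_ne_top
  rw [hmul _ ENNReal.ofReal_ne_top, hmul _ hind]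
  have hscalar : ((x : ℂ) • (1 : Matrix (Fin n) (Fin n) ℂ)).IsHermitian := by
    simp [IsHermitian, conjTranspose_smul]
  have hcong : ((x : ℂ) • 1 - C * ((x : ℂ) • 1) * Cᴴ).IsHermitian :=
    hscalar.sub (isHermitian_mul_mul_conjTranspose _ hscalar)
  set z : HermCoord n := (coordEquiv n).symm ⟨_, hcong⟩ with hz
  have hz' : toMatrix z = (x : ℂ) • 1 - C * ((x : ℂ) • 1) * Cᴴ :=
    congrArg Subtype.val ((coordEquiv n).apply_symm_apply ⟨_, hcong⟩)
  have hkey : ∀ y : HermCoord n, (x : ℂ) • 1 - C * ((x : ℂ) • 1 - toMatrix y) * Cᴴ =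
      toMatrix (L y + z) := by
    intro y
    have h1 : toMatrix (L y + z) = toMatrix (L y) + toMatrix z :=
      congrArg Subtype.val (map_add (coordEquiv n) (L y) z)
    have h2 : toMatrix (L y) = C * toMatrix y * Cᴴ :=
      congrArg Subtype.val ((coordEquiv n).apply_symm_apply (conjHerm hC0 (coordEquiv n y)))
    rw [h1, h2, hz', Matrix.mul_sub, Matrix.sub_mul]
    abel
  simp_rw [hkey]
  rw [hc (fun y => cutWeight x (p * (Polynomial.X - Polynomial.C x)) (toMatrix (y + z))),
    lintegral_add_right_eq_self
      (fun y => cutWeight x (p * (Polynomial.X - Polynomial.C x)) (toMatrix y)) z, cutMass]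
  ring

theorem cutWeight_mul (s : ℝ) (p q : ℝ[X]) (Y : Matrix m m ℂ) :
    cutWeight s (p * q) Y = cutWeight s p Y * ENNReal.ofReal (‖(aeval Y q).det‖ ^ 2) := by
  unfold cutWeight
  by_cases h : Y ∈ {X | ((s : ℂ) • 1 - X).PosDef}
  · rw [Set.indicator_of_mem h, Set.indicator_of_mem h, weight_mul,
      ENNReal.ofReal_mul (weight_nonneg _ _)]
  · rw [Set.indicator_of_notMem h, Set.indicator_of_notMem h, zero_mul]

theorem measurable_cutMass_mul_sub (n : ℕ) (p : ℝ[X]) :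
    Measurable fun x => cutMass n x (p * (Polynomial.X - Polynomial.C x)) := by
  simp only [cutMass, cutWeight_mul, map_sub, aeval_X, aeval_C]
  refine Measurable.lintegral_prod_right' (f := fun z : ℝ × HermCoord n =>
    cutWeight z.1 p (toMatrix z.2) *
      ENNReal.ofReal (‖(toMatrix z.2 - algebraMap ℝ _ z.1).det‖ ^ 2)) ?_
  have h := continuous_toMatrix.comp (continuous_snd (X := ℝ) (Y := HermCoord n))
  refine (measurable_cutWeight h continuous_fst p).mul ?_
  have h2 : Continuous fun z : ℝ × HermCoord n =>
      toMatrix z.2 - algebraMap ℝ (Matrix (Fin n) (Fin n) ℂ) z.1 := by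
    simp only [Algebra.algebraMap_eq_smul_one]
    exact h.sub (by fun_prop)
  have := h2.matrix_det
  exact Continuous.measurable (by fun_prop) |>.ennreal_ofReal

theorem exists_cutMass_succ {n : ℕ} (hfin : ∀ s p, cutMass n s p ≠ ⊤) :
    ∃ c : ENNReal, ∀ s p, cutMass (n + 1) s p =
      c * ∫⁻ x in Set.Iio s, ENNReal.ofReal (Real.exp (-x ^ 2) * p.eval x ^ 2) *
        cutMass n x (p * (Polynomial.X - Polynomial.C x)) := by
  let e : Unit ⊕ Fin n ≃ Fin (n + 1) :=
    (Equiv.sumComm _ _).trans ((Equiv.optionEquivSumPUnit (Fin n)).symm.trans (finSuccEquiv n).symm)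
  let f : ((ℝ × (Fin n → ℂ)) × HermCoord n) ≃ₗ[ℝ] HermCoord (n + 1) :=
    ((LinearEquiv.refl ℝ _).prodCongr (coordEquiv n)).trans
      ((borderedEquiv (Fin n)).trans ((reindexHerm e).trans (coordEquiv (n + 1)).symm))
  have := isAddHaarMeasure_volume_prod (V := ℝ) (V' := Fin n → ℂ)
  have := isAddHaarMeasure_volume_prod (V := ℝ × (Fin n → ℂ)) (V' := HermCoord n)
  have : BorelSpace ((ℝ × (Fin n → ℂ)) × HermCoord n) := Prod.borelSpace
  obtain ⟨c, hc0, hc, hcf⟩ := exists_lintegral_comp_linearEquiv f volume volume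
  choose K hK using lintegral_eigenIntegrand n
  refine ⟨c⁻¹ * ∫⁻ w, K w, fun s p => ?_⟩
  have hf : ∀ z, toMatrix (f z) = (bordered z.1.1 z.1.2 (toMatrix z.2)).submatrix e.symm e.symm :=
    fun z => congrArg Subtype.val ((coordEquiv (n + 1)).apply_symm_apply _)
  have h1 := hcf (fun y => cutWeight s p (toMatrix y))
  simp_rw [hf, cutWeight_reindex] at h1
  have h2 : cutMass (n + 1) s p = c⁻¹ * ∫⁻ z : (ℝ × (Fin n → ℂ)) × HermCoord n,
      cutWeight s p (bordered z.1.1 z.1.2 (toMatrix z.2)) := by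
    rw [h1, ← mul_assoc, ENNReal.inv_mul_cancel hc0 hc, one_mul, cutMass]
  rw [h2, mul_assoc]
  congr 1
  have hmeas : Measurable fun z : (ℝ × (Fin n → ℂ)) × HermCoord n =>
      cutWeight s p (bordered z.1.1 z.1.2 (toMatrix z.2)) :=
    measurable_cutWeight (continuous_bordered (by fun_prop) (by fun_prop)
      (continuous_toMatrix.comp continuous_snd)) continuous_const p
  have hmeas2 : Measurable fun z : (ℝ × (Fin n → ℂ)) × HermCoord n =>
      eigenIntegrand s p (toMatrix z.2) z.1 :=
    measurable_eigenIntegrand s p (continuous_toMatrix.comp continuous_snd) continuous_fst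
  have hmeas3 : Measurable fun z : ℝ × (Fin n → ℂ) =>
      ∫⁻ y : HermCoord n, eigenIntegrand s p (toMatrix y) z := hmeas2.lintegral_prod_right'
  calc ∫⁻ z : (ℝ × (Fin n → ℂ)) × HermCoord n, cutWeight s p (bordered z.1.1 z.1.2 (toMatrix z.2))
      = ∫⁻ y : HermCoord n, ∫⁻ z : ℝ × (Fin n → ℂ), eigenIntegrand s p (toMatrix y) z := by
        rw [Measure.volume_eq_prod, lintegral_prod_symm' _ hmeas]
        exact lintegral_congr fun y => lintegral_bordered (toMatrix_isHermitian y) s p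
    _ = ∫⁻ z : ℝ × (Fin n → ℂ), ∫⁻ y : HermCoord n, eigenIntegrand s p (toMatrix y) z := by
        rw [lintegral_lintegral_swap]
        exact (hmeas2.comp measurable_swap).aemeasurable
    _ = ∫⁻ x : ℝ, ∫⁻ w : Fin n → ℂ, K w * ((Set.Iio s).indicator
          (fun x => ENNReal.ofReal (Real.exp (-x ^ 2) * p.eval x ^ 2)) x *
            cutMass n x (p * (Polynomial.X - Polynomial.C x))) := by
        rw [Measure.volume_eq_prod, lintegral_prod _ hmeas3.aemeasurable]
        exact lintegral_congr fun x => lintegral_congr fun w => hK w s x p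
    _ = ∫⁻ x : ℝ, (∫⁻ w, K w) * ((Set.Iio s).indicator
          (fun x => ENNReal.ofReal (Real.exp (-x ^ 2) * p.eval x ^ 2)) x *
            cutMass n x (p * (Polynomial.X - Polynomial.C x))) := by
        -- `K` comes from a choice and is not known to be measurable in w, so the factor free of w
        -- is pulled out by finiteness; this is where `hfin` enters.
        refine lintegral_congr fun x => lintegral_mul_const' _ _ (ENNReal.mul_ne_top ?_ (hfin _ _))
        by_cases h : x ∈ Set.Iio s
        · rw [Set.indicator_of_mem h]; exact ENNReal.ofReal_ne_top
        · rw [Set.indicator_of_notMem h]; exact ENNReal.zero_ne_top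
    _ = _ := by
        have hm : Measurable fun x => (Set.Iio s).indicator
          (fun x => ENNReal.ofReal (Real.exp (-x ^ 2) * p.eval x ^ 2)) x *
            cutMass n x (p * (Polynomial.X - Polynomial.C x)) := by
          refine Measurable.mul (Measurable.indicator ?_ measurableSet_Iio)
            (measurable_cutMass_mul_sub n p)
          exact Continuous.measurable (by fun_prop) |>.ennreal_ofReal
        rw [lintegral_const_mul _ hm, ← lintegral_indicator measurableSet_Iio]
        congr 1
        refine lintegral_congr fun x => ?_
        by_cases h : x ∈ Set.Iio s
        · rw [Set.indicator_of_mem h, Set.indicator_of_mem h]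
        · rw [Set.indicator_of_notMem h, Set.indicator_of_notMem h, zero_mul]

end Recursion
end GUETail

namespace GUETail
open Matrix Polynomial

/-! ### Gram determinants of the truncated Gaussian weight. -/

section Gram

theorem integrable_eval_mul_exp (q : ℝ[X]) :
    Integrable fun x : ℝ => q.eval x * Real.exp (-x ^ 2) := by
  induction q using Polynomial.induction_on' with
  | add p q hp hq =>
    simp only [eval_add, add_mul]
    exact hp.add hq
  | monomial k a =>
    have h := (integrable_rpow_mul_exp_neg_mul_sq (b := 1) one_pos (s := k)
      (by have : (0 : ℝ) ≤ k := k.cast_nonneg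
          linarith)).const_mul a
    simpa [mul_assoc] using h

/-- The integral of a polynomial against the Gaussian weight over `(-∞, s]`. -/
noncomputable def gaussInt (s : ℝ) (q : ℝ[X]) : ℝ :=
  ∫ x in Set.Iic s, q.eval x * Real.exp (-x ^ 2)

theorem gaussInt_add (s : ℝ) (p q : ℝ[X]) : gaussInt s (p + q) = gaussInt s p + gaussInt s q := by
  simp only [gaussInt, eval_add, add_mul]
  exact integral_add (integrable_eval_mul_exp p).integrableOn
    (integrable_eval_mul_exp q).integrableOn

theorem gaussInt_smul (s a : ℝ) (q : ℝ[X]) : gaussInt s (a • q) = a * gaussInt s q := by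
  simp only [gaussInt, eval_smul, smul_eq_mul, mul_assoc]
  exact integral_const_mul _ _

/-- `gaussInt s` as a linear map. -/
noncomputable def gaussIntLin (s : ℝ) : ℝ[X] →ₗ[ℝ] ℝ where
  toFun := gaussInt s
  map_add' := gaussInt_add s
  map_smul' := gaussInt_smul s

theorem hasDerivAt_gaussInt (s : ℝ) (q : ℝ[X]) :
    HasDerivAt (fun s => gaussInt s q) (q.eval s * Real.exp (-s ^ 2)) s := by
  have hc : Continuous fun x : ℝ => q.eval x * Real.exp (-x ^ 2) := by fun_prop
  have h : ∀ u, gaussInt u q = gaussInt 0 q + ∫ x in (0 : ℝ)..u, q.eval x * Real.exp (-x ^ 2) := by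
    intro u
    rw [← intervalIntegral.integral_Iic_sub_Iic (integrable_eval_mul_exp q).integrableOn
      (integrable_eval_mul_exp q).integrableOn]
    simp [gaussInt]
  rw [show (fun s => gaussInt s q) = _ from funext h]
  exact (intervalIntegral.integral_hasDerivAt_right (hc.intervalIntegrable _ _)
    (hc.stronglyMeasurableAtFilter _ _) hc.continuousAt).const_add _

theorem tendsto_gaussInt_atTop (q : ℝ[X]) : Filter.Tendsto (fun s => gaussInt s q) Filter.atTop
    (nhds (∫ x, q.eval x * Real.exp (-x ^ 2))) :=
  (aecover_Iic Filter.tendsto_id).integral_tendsto_of_countably_generated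
    (integrable_eval_mul_exp q)

theorem gaussInt_eq_sub (s : ℝ) (q : ℝ[X]) : gaussInt s q =
    (∫ x, q.eval x * Real.exp (-x ^ 2)) - ∫ x in Set.Ioi s, q.eval x * Real.exp (-x ^ 2) := by
  have := intervalIntegral.integral_Iic_add_Ioi (b := s)
    (integrable_eval_mul_exp q).integrableOn (integrable_eval_mul_exp q).integrableOn
  rw [← this, gaussInt]; ring

theorem tendsto_gaussInt_atBot (q : ℝ[X]) :
    Filter.Tendsto (fun s => gaussInt s q) Filter.atBot (nhds 0) := by
  have h := (aecover_Ioi (μ := volume) (a := fun s : ℝ => s) Filter.tendsto_id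
    (l := Filter.atBot)).integral_tendsto_of_countably_generated (integrable_eval_mul_exp q)
  have h2 := h.const_sub (∫ x, q.eval x * Real.exp (-x ^ 2))
  rw [sub_self] at h2
  refine h2.congr fun s => (gaussInt_eq_sub s q).symm

/-- The Gram matrix of the polynomials `b j` for the weight `w(x) exp(-x²)` on `(-∞, s]`. -/
noncomputable def gram {n : ℕ} (b : Fin n → ℝ[X]) (s : ℝ) (w : ℝ[X]) : Matrix (Fin n) (Fin n) ℝ :=
  Matrix.of fun j k => gaussInt s (w * (b j * b k))

/-- The monomials. -/
noncomputable def monos (n : ℕ) (j : Fin n) : ℝ[X] := X ^ (j : ℕ)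

/-- A degree-triangular change of basis has determinant the product of the leading coefficients, and
it acts on both sides of the Gram matrix. -/
theorem det_gram {n : ℕ} (b : Fin n → ℝ[X]) (hb : ∀ j, (b j).natDegree ≤ j) (s : ℝ) (w : ℝ[X]) :
    (gram b s w).det = (∏ j, (b j).coeff j) ^ 2 * (gram (monos n) s w).det := by
  let T : Matrix (Fin n) (Fin n) ℝ := Matrix.of fun j i => (b j).coeff i
  have hT : T.det = ∏ j, (b j).coeff j := by
    refine Matrix.det_of_isLowerTriangular _ fun i j hij => ?_
    exact coeff_eq_zero_of_natDegree_lt ((hb i).trans_lt (by simpa using hij))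
  have hsum : ∀ j, b j = ∑ i : Fin n, T j i • monos n i := by
    intro j
    conv_lhs => rw [(b j).as_sum_range' n ((hb j).trans_lt j.2)]
    rw [Finset.sum_range]
    refine Finset.sum_congr rfl fun i _ => ?_
    simp [T, monos, smul_eq_C_mul, C_mul_X_pow_eq_monomial]
  have hG : gram b s w = T * gram (monos n) s w * Tᵀ := by
    ext j k
    simp only [gram, mul_apply, transpose_apply, of_apply]
    have h : w * (b j * b k) =
        ∑ i, ∑ l, (T j i * T k l) • (w * (monos n i * monos n l)) := by
      rw [hsum j, hsum k, Finset.sum_mul_sum, Finset.mul_sum]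
      refine Finset.sum_congr rfl fun i _ => ?_
      rw [Finset.mul_sum]
      refine Finset.sum_congr rfl fun l _ => ?_
      simp only [smul_mul_assoc, mul_smul_comm, smul_smul, mul_comm (T k l)]
    rw [h]
    change gaussIntLin s _ = _
    simp only [map_sum, map_smul, Finset.sum_mul]
    rw [Finset.sum_comm]
    refine Finset.sum_congr rfl fun i _ => Finset.sum_congr rfl fun l _ => ?_
    change _ * gaussInt s _ = _
    ring
  rw [hG, det_mul, det_mul, det_transpose, hT]
  ring

theorem hasDerivAt_det_of_forall_zero {n : ℕ} {H : ℝ → Matrix (Fin n) (Fin n) ℝ} {s : ℝ}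
    (h : ∀ i j, HasDerivAt (fun u => H u i j) 0 s) : HasDerivAt (fun u => (H u).det) 0 s := by
  simp only [det_apply]
  have := HasDerivAt.fun_sum (u := Finset.univ) fun (σ : Equiv.Perm (Fin n)) _ =>
    (HasDerivAt.fun_finsetProd (u := Finset.univ) (f := fun i u => H u (σ i) i)
      (f' := fun _ => 0) (x := s) fun i _ => h (σ i) i).const_smul (Equiv.Perm.sign σ)
  simpa using this

/-- In the basis 1, (X - s), (X - s)X, … every element but the first vanishes at s, so moving the
endpoint through s changes only the (0, 0) entry to first order. Its cofactor is the smaller Gram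
determinant with weight multiplied by (X - s)²: the recursion of the matrix masses. -/
theorem hasDerivAt_det_gram (n : ℕ) (s : ℝ) (p : ℝ[X]) :
    HasDerivAt (fun u => (gram (monos (n + 1)) u (p ^ 2)).det)
      (p.eval s ^ 2 * Real.exp (-s ^ 2) * (gram (monos n) s ((p * (X - C s)) ^ 2)).det) s := by
  -- The basis is frozen at s while the endpoint u varies. Its leading coefficients are 1, so the
  -- determinant is unchanged for every u.
  let b : Fin (n + 1) → ℝ[X] := Fin.cons 1 fun j => (X - C s) * X ^ (j : ℕ)
  have hdeg : ∀ j, (b j).natDegree ≤ j := by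
    intro j
    refine Fin.cases ?_ (fun j => ?_) j
    · simp [b]
    · simp only [b, Fin.cons_succ, Fin.val_succ]
      refine natDegree_mul_le.trans ?_
      rw [natDegree_X_sub_C, natDegree_X_pow, add_comm]
  have hcoeff : ∀ j, (b j).coeff j = 1 := by
    intro j
    refine Fin.cases ?_ (fun j => ?_) j
    · simp [b]
    · simp only [b, Fin.cons_succ, Fin.val_succ]
      rw [add_comm, coeff_mul_X_pow]
      simp
  have hdet : ∀ u, (gram (monos (n + 1)) u (p ^ 2)).det = (gram b u (p ^ 2)).det := by
    intro u
    rw [det_gram b hdeg]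
    simp [hcoeff]
  simp only [hdet]
  have hentry : ∀ j k, HasDerivAt (fun u => gram b u (p ^ 2) j k)
      ((p ^ 2 * (b j * b k)).eval s * Real.exp (-s ^ 2)) s := fun j k => hasDerivAt_gaussInt s _
  have hbs : ∀ j : Fin n, (b j.succ).eval s = 0 := by
    intro j; simp [b]
  have hminor : ∀ k : Fin (n + 1), HasDerivAt
      (fun u => ((gram b u (p ^ 2)).submatrix Fin.succ k.succAbove).det) 0 s := by
    intro k
    refine hasDerivAt_det_of_forall_zero fun i j => ?_
    have := hentry i.succ (k.succAbove j)
    simpa [hbs] using this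
  simp only [det_succ_row_zero]
  have hsum := HasDerivAt.fun_sum (u := Finset.univ) fun (k : Fin (n + 1)) _ =>
    ((hentry 0 k).const_mul ((-1) ^ (k : ℕ))).mul (hminor k)
  refine hsum.congr_deriv ?_
  rw [Fin.sum_univ_succ]
  have hsub : (gram b s (p ^ 2)).submatrix Fin.succ (Fin.succAbove 0) =
      gram (monos n) s ((p * (X - C s)) ^ 2) := by
    ext i j
    simp only [gram, submatrix_apply, of_apply, Fin.succAbove_zero, b, Fin.cons_succ, monos]
    congr 1
    ring
  rw [hsub]
  simp [hbs]
  left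
  simp [b]

theorem posSemidef_gram {n : ℕ} (b : Fin n → ℝ[X]) (s : ℝ) (p : ℝ[X]) :
    (gram b s (p ^ 2)).PosSemidef := by
  refine PosSemidef.of_dotProduct_mulVec_nonneg ?_ fun v => ?_
  · ext i j
    simp [gram, mul_comm (b i)]
  · have : star v ⬝ᵥ (gram b s (p ^ 2) *ᵥ v) = gaussInt s ((p * ∑ i, v i • b i) ^ 2) := by
      rw [mul_pow, pow_two (∑ i, v i • b i), Finset.sum_mul_sum]
      simp only [Finset.mul_sum, smul_mul_assoc, mul_smul_comm, smul_smul]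
      change _ = gaussIntLin s _
      simp only [map_sum, map_smul, dotProduct, mulVec, Finset.mul_sum]
      refine Finset.sum_congr rfl fun i _ => Finset.sum_congr rfl fun j _ => ?_
      change _ = _ * gaussInt s _
      simp [gram]
      ring
    rw [this, gaussInt]
    refine setIntegral_nonneg measurableSet_Iic fun x _ => ?_
    rw [eval_pow]
    positivity

theorem tendsto_det_gram_atBot (n : ℕ) (w : ℝ[X]) :
    Filter.Tendsto (fun s => (gram (monos (n + 1)) s w).det) Filter.atBot (nhds 0) := by
  have h : Filter.Tendsto (fun s => gram (monos (n + 1)) s w) Filter.atBot (nhds 0) := by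
    refine tendsto_pi_nhds.2 fun i => tendsto_pi_nhds.2 fun j => ?_
    exact tendsto_gaussInt_atBot _
  have h2 := ((continuous_id.matrix_det :
    Continuous fun M : Matrix (Fin (n + 1)) (Fin (n + 1)) ℝ => M.det).tendsto 0).comp h
  rw [id, det_zero] at h2
  exact h2

/-- Reflecting x to -x reduces this to the fundamental theorem on a right half-line. -/
theorem lintegral_Iio_deriv_of_nonneg {F F' : ℝ → ℝ} (hF : ∀ x, HasDerivAt F (F' x) x)
    (hF' : ∀ x, 0 ≤ F' x) (hlim : Filter.Tendsto F Filter.atBot (nhds 0)) (s : ℝ) :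
    ∫⁻ x in Set.Iio s, ENNReal.ofReal (F' x) = ENNReal.ofReal (F s) := by
  have hG : ∀ x ∈ Set.Ici (-s), HasDerivAt (fun u => -F (-u)) (F' (-x)) x := by
    intro x _
    have := ((hF (-x)).comp x (hasDerivAt_neg x)).neg
    simp only [mul_neg, mul_one, neg_neg] at this
    exact this
  have hlimG : Filter.Tendsto (fun u => -F (-u)) Filter.atTop (nhds 0) := by
    simpa using (hlim.comp Filter.tendsto_neg_atTop_atBot).neg
  have hint := integrableOn_Ioi_deriv_of_nonneg' hG (fun x _ => hF' _) hlimG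
  have hval := integral_Ioi_of_hasDerivAt_of_nonneg' hG (fun x _ => hF' _) hlimG
  have h1 : ∫⁻ x in Set.Iio s, ENNReal.ofReal (F' x) =
      ∫⁻ x in Set.Ioi (-s), ENNReal.ofReal (F' (-x)) := by
    have := (Measure.measurePreserving_neg (volume : Measure ℝ)).setLIntegral_comp_preimage_emb
      (MeasurableEquiv.neg ℝ).measurableEmbedding (fun x => ENNReal.ofReal (F' x)) (Set.Iio s)
    rw [← this]
    congr 2
    ext x; simp
  rw [h1, ← ofReal_integral_eq_lintegral_ofReal hint (Filter.Eventually.of_forall fun x => hF' _),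
    hval]
  simp

end Gram
end GUETail

namespace GUETail
open Matrix Polynomial
open scoped ComplexOrder

/-! ### Identification of matrix masses with Gram determinants. -/

section Mass

theorem sum_eq_lowerPair {n : ℕ} (f : Fin n → Fin n → ℝ) :
    ∑ i, ∑ j, f i j = ∑ i, f i i + ∑ p : LowerPair n, (f p.1.1 p.1.2 + f p.1.2 p.1.1) := by
  have h1 : ∀ i j, f i j = (if i = j then f i j else 0) + ((if j < i then f i j else 0) +
      (if i < j then f i j else 0)) := by
    intro i j
    rcases lt_trichotomy i j with h | h | h
    · simp [h, h.ne, h.not_gt]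
    · simp [h]
    · simp [h, h.ne', h.not_gt]
  have h2 : ∀ g : Fin n → Fin n → ℝ, ∑ p : LowerPair n, g p.1.1 p.1.2 =
      ∑ i, ∑ j, if j < i then g i j else 0 := by
    intro g
    rw [← Finset.sum_product' (f := fun i j => if j < i then g i j else 0), ← Finset.sum_filter]
    exact (Finset.sum_subtype (p := fun p : Fin n × Fin n => p.2 < p.1)
      (Finset.univ.filter fun p : Fin n × Fin n => p.2 < p.1) (by simp) (fun p => g p.1 p.2)).symm
  rw [Finset.sum_add_distrib, h2 f, h2 fun i j => f j i]
  have h3 : ∑ i, ∑ j, f i j = ∑ i, ∑ j, ((if i = j then f i j else 0) +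
      ((if j < i then f i j else 0) + (if i < j then f i j else 0))) :=
    Finset.sum_congr rfl fun i _ => Finset.sum_congr rfl fun j _ => h1 i j
  rw [h3]
  simp only [Finset.sum_add_distrib]
  congr 1
  · simp
  · congr 1
    exact Finset.sum_comm

/-- The variance parameters `1, 2, 2` of the Gaussian exponent. -/
def rate {n : ℕ} : Fin n ⊕ LowerPair n ⊕ LowerPair n → ℝ
  | .inl _ => 1
  | .inr _ => 2

theorem trace_toMatrix_sq {n : ℕ} (x : HermCoord n) :
    (toMatrix x * toMatrix x).trace.re = ∑ i, rate i * x i ^ 2 := by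
  have h1 : (toMatrix x * toMatrix x).trace.re =
      ∑ i, ∑ j, (toMatrix x i j * toMatrix x j i).re := by
    simp [trace, mul_apply]
  rw [h1, sum_eq_lowerPair]
  simp only [Fintype.sum_sum_type, rate]
  rw [← Finset.sum_add_distrib]
  congr 1
  · refine Finset.sum_congr rfl fun i _ => ?_
    simp [toMatrix]; ring
  · refine Finset.sum_congr rfl fun p _ => ?_
    have h := p.2
    simp [toMatrix, h, h.not_gt]
    ring

theorem weight_one {n : ℕ} (x : HermCoord n) :
    weight 1 (toMatrix x) = Real.exp (-∑ i, rate i * x i ^ 2) := by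
  simp [weight, trace_toMatrix_sq]

theorem rate_pos {n : ℕ} (i : Fin n ⊕ LowerPair n ⊕ LowerPair n) : 0 < rate i := by
  rcases i with i | i <;> simp [rate]

theorem integrable_weight_one (n : ℕ) : Integrable fun x : HermCoord n => weight 1 (toMatrix x) := by
  simp only [weight_one, ← Finset.sum_neg_distrib, Real.exp_sum]
  refine Integrable.fintype_prod (f := fun i (t : ℝ) => Real.exp (-(rate i * t ^ 2))) fun i => ?_
  simpa using integrable_exp_neg_mul_sq (rate_pos i)

theorem cutMass_one_ne_top (n : ℕ) (s : ℝ) : cutMass n s 1 ≠ ⊤ := by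
  have h := (integrable_weight_one n).lintegral_lt_top
  refine ((lintegral_mono fun x => ?_).trans_lt h).ne
  exact Set.indicator_le_self _ _ _

theorem exists_posDef_shift {n : ℕ} {A : Matrix (Fin n) (Fin n) ℂ} (hA : A.IsHermitian) :
    ∃ k : ℕ, (((k : ℝ) : ℂ) • 1 - A).PosDef := by
  obtain ⟨k, hk⟩ := exists_nat_gt (∑ i, |hA.eigenvalues i|)
  refine ⟨k, (posDef_shift_iff hA k).2 fun i => lt_of_le_of_lt ?_ hk⟩
  exact (le_abs_self _).trans
    (Finset.single_le_sum (f := fun i => |hA.eigenvalues i|) (fun _ _ => abs_nonneg _)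
      (Finset.mem_univ i))

theorem exists_cutMass_one_ne_zero (n : ℕ) : ∃ s, cutMass n s 1 ≠ 0 := by
  by_contra! h
  have h1 : ∀ k : ℕ, ∀ᵐ x : HermCoord n, cutWeight (k : ℝ) 1 (toMatrix x) = 0 := fun k =>
    (lintegral_eq_zero_iff (measurable_cutWeight continuous_toMatrix continuous_const 1)).1 (h k)
  have h2 : ∀ᵐ x : HermCoord n, False := by
    filter_upwards [ae_all_iff.2 h1] with x hx
    obtain ⟨k, hk⟩ := exists_posDef_shift (toMatrix_isHermitian x)
    have := hx k
    rw [cutWeight, Set.indicator_of_mem (by exact hk), weight_one, ENNReal.ofReal_eq_zero] at this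
    exact absurd this (not_le.2 (Real.exp_pos _))
  have h3 : (volume : Measure (HermCoord n)) = 0 := by simpa using h2
  exact (NeZero.ne (volume : Measure (HermCoord n))) h3

/-- Both sides obey the same recursion, and the Gram determinant of positive size vanishes at -∞, so
it is the integral of its derivative. The induction runs over all p at once, since the step replaces
p by p·(X - x). -/
theorem exists_cutMass_eq (n : ℕ) : ∃ c : ENNReal, c ≠ ⊤ ∧ ∀ s p,
    cutMass n s p = c * ENNReal.ofReal (gram (monos n) s (p ^ 2)).det := by
  induction n with
  | zero =>
    refine ⟨1, ENNReal.one_ne_top, fun s p => ?_⟩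
    have h : ∀ X : Matrix (Fin 0) (Fin 0) ℂ, cutWeight s p X = 1 := by
      intro X
      have h1 : X ∈ {X : Matrix (Fin 0) (Fin 0) ℂ | ((s : ℂ) • 1 - X).PosDef} := by
        have : (s : ℂ) • 1 - X = 1 := Subsingleton.elim _ _
        simp only [Set.mem_ofPred_eq, this]
        exact PosDef.one
      rw [cutWeight, Set.indicator_of_mem h1]
      simp [weight, trace]
    have : IsEmpty (LowerPair 0) := ⟨fun p => p.1.1.elim0⟩
    simp only [cutMass, h, lintegral_one]
    rw [volume_pi, Measure.pi_of_empty]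
    simp
  | succ n ih =>
    obtain ⟨c, hc, ih⟩ := ih
    obtain ⟨c', hc'⟩ := exists_cutMass_succ (n := n) fun s p => by
      rw [ih]; exact ENNReal.mul_ne_top hc ENNReal.ofReal_ne_top
    have key : ∀ s p, cutMass (n + 1) s p =
        c' * c * ENNReal.ofReal (gram (monos (n + 1)) s (p ^ 2)).det := by
      intro s p
      rw [hc', mul_assoc]
      congr 1
      rw [← lintegral_Iio_deriv_of_nonneg (fun x => hasDerivAt_det_gram n x p)
        (fun x => mul_nonneg (by positivity) (posSemidef_gram _ _ _).det_nonneg)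
        (tendsto_det_gram_atBot n _) s, ← lintegral_const_mul' _ _ hc]
      refine lintegral_congr fun x => ?_
      rw [ih, mul_comm (p.eval x ^ 2),
        ENNReal.ofReal_mul (p := Real.exp (-x ^ 2) * p.eval x ^ 2) (by positivity), mul_left_comm]
    -- The constant includes an integral over w that has not been bounded. Were it infinite, the
    -- pure Gaussian mass would be infinite at a level where it is nonzero.
    refine ⟨c' * c, fun htop => ?_, key⟩
    obtain ⟨s, hs⟩ := exists_cutMass_one_ne_zero (n + 1)
    have h1 := cutMass_one_ne_top (n + 1) s
    rw [key, htop] at h1 hs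
    exact h1 (ENNReal.top_mul (right_ne_zero_of_mul hs))

end Mass

/-! ### The distribution function of the largest eigenvalue. -/

section Law

theorem gaussianPDF_diag (x : ℝ) : gaussianPDF 0 (1 / 2) x =
    ENNReal.ofReal ((√Real.pi)⁻¹ * Real.exp (-(1 * x ^ 2))) := by
  rw [gaussianPDF, gaussianPDFReal]
  congr 2
  · norm_num
    rw [mul_left_comm, mul_inv_cancel₀ (by positivity), mul_one]
  · norm_num

theorem gaussianPDF_offDiag (x : ℝ) : gaussianPDF 0 (1 / 4) x =
    ENNReal.ofReal ((√(Real.pi / 2))⁻¹ * Real.exp (-(2 * x ^ 2))) := by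
  rw [gaussianPDF, gaussianPDFReal]
  congr 2
  · norm_num
    rw [mul_left_comm, ← div_eq_mul_inv 2, Real.div_sqrt, mul_comm, div_eq_mul_inv]
  · norm_num
    ring_nf

/-- The normalising constants of the coordinates. -/
noncomputable def normConst {n : ℕ} : Fin n ⊕ LowerPair n ⊕ LowerPair n → ℝ
  | .inl _ => (√Real.pi)⁻¹
  | .inr _ => (√(Real.pi / 2))⁻¹

/-- The variances of the coordinates. -/
noncomputable def coordVar {n : ℕ} : Fin n ⊕ LowerPair n ⊕ LowerPair n → NNReal
  | .inl _ => 1 / 2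
  | .inr _ => 1 / 4

theorem coordVar_ne_zero {n : ℕ} (i : Fin n ⊕ LowerPair n ⊕ LowerPair n) : coordVar i ≠ 0 := by
  rcases i with i | i <;> simp [coordVar]

theorem gaussianPDF_coordVar {n : ℕ} (i : Fin n ⊕ LowerPair n ⊕ LowerPair n) (x : ℝ) :
    gaussianPDF 0 (coordVar i) x =
      ENNReal.ofReal (normConst i * Real.exp (-(rate i * x ^ 2))) := by
  rcases i with i | i
  · exact gaussianPDF_diag x
  · exact gaussianPDF_offDiag x

theorem pi_gaussian_eq (n : ℕ) :
    Measure.pi (fun i : Fin n ⊕ LowerPair n ⊕ LowerPair n => gaussianReal 0 (coordVar i)) =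
      (volume : Measure (HermCoord n)).withDensity
        fun x => ENNReal.ofReal (∏ i : Fin n ⊕ LowerPair n ⊕ LowerPair n, normConst i) *
          ENNReal.ofReal (weight 1 (toMatrix x)) := by
  have hnc : ∀ i : Fin n ⊕ LowerPair n ⊕ LowerPair n, 0 ≤ normConst i := by
    intro i; rcases i with i | i <;> simp only [normConst] <;> positivity
  refine (Measure.pi_eq fun t ht => ?_)
  rw [withDensity_apply _ (MeasurableSet.univ_pi ht)]
  have h1 : ∀ x : HermCoord n,
      ENNReal.ofReal (∏ i : Fin n ⊕ LowerPair n ⊕ LowerPair n, normConst i) *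
          ENNReal.ofReal (weight 1 (toMatrix x)) = ∏ i, gaussianPDF 0 (coordVar i) (x i) := by
    intro x
    simp only [gaussianPDF_coordVar]
    rw [← ENNReal.ofReal_mul (Finset.prod_nonneg fun i _ => hnc i), weight_one,
      ← Finset.sum_neg_distrib, Real.exp_sum, ← Finset.prod_mul_distrib,
      ENNReal.ofReal_prod_of_nonneg]
    exact fun i _ => mul_nonneg (hnc i) (Real.exp_pos _).le
  simp only [h1]
  have h2 : ∀ x : HermCoord n, ∏ i, gaussianPDF 0 (coordVar i) (x i) =
      ENNReal.ofReal (∏ i, gaussianPDFReal 0 (coordVar i) (x i)) := fun x =>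
    (ENNReal.ofReal_prod_of_nonneg fun i _ => gaussianPDFReal_nonneg _ _ _).symm
  simp only [h2]
  rw [volume_pi, Measure.restrict_pi_pi, ← ofReal_integral_eq_lintegral_ofReal,
    integral_fintype_prod_eq_prod
      (f := fun i (y : ℝ) => gaussianPDFReal 0 (coordVar (n := n) i) y),
    ENNReal.ofReal_prod_of_nonneg]
  · refine Finset.prod_congr rfl fun i _ => ?_
    rw [gaussianReal_apply_eq_integral 0 (coordVar_ne_zero i)]
  · exact fun i _ => integral_nonneg fun y => gaussianPDFReal_nonneg _ _ _
  · exact Integrable.fintype_prod_dep fun i => (integrable_gaussianPDFReal _ _).restrict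
  · exact Filter.Eventually.of_forall fun x =>
      Finset.prod_nonneg fun i _ => gaussianPDFReal_nonneg _ _ _

theorem hermitianCoord_eq_coord {Ω : Type*} {N : ℕ} (A : Ω → Matrix (Fin N) (Fin N) ℂ) (ω : Ω) :
    (fun i => hermitianCoord A i ω) = coord (A ω) := by
  ext i
  rcases i with i | i | i <;> rfl

theorem largestEigenvalue_lt_iff {N : ℕ} (hN : 0 < N) {A : Matrix (Fin N) (Fin N) ℂ}
    (hA : A.IsHermitian) (s : ℝ) : largestEigenvalue A < s ↔ ((s : ℂ) • 1 - A).PosDef := by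
  have h := isGreatest_largestEigenvalue hN hA
  rw [posDef_shift_iff hA]
  have h2 : spectrum ℝ A = Set.range hA.eigenvalues := hA.spectrum_real_eq_range_eigenvalues
  rw [h2] at h
  constructor
  · exact fun hs i => (h.2 ⟨i, rfl⟩).trans_lt hs
  · intro hs
    obtain ⟨i, hi⟩ := h.1
    rw [← hi]; exact hs i

theorem map_coord_of_isGUE {Ω : Type*} [MeasurableSpace Ω] {P : Measure Ω} [IsProbabilityMeasure P]
    {N : ℕ} {A : Ω → Matrix (Fin N) (Fin N) ℂ} (hA : IsGUE P A) :
    AEMeasurable (fun ω => coord (A ω)) P ∧ P.map (fun ω => coord (A ω)) =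
      Measure.pi fun i : Fin N ⊕ LowerPair N ⊕ LowerPair N => gaussianReal 0 (coordVar i) := by
  have hlaw : ∀ i, HasLaw (hermitianCoord A i) (gaussianReal 0 (coordVar i)) P := by
    intro i
    rcases i with i | p | p
    · exact hA.law_diag i
    · exact hA.law_re _ _ p.2
    · exact hA.law_im _ _ p.2
  have hae : ∀ i, AEMeasurable (hermitianCoord A i) P := fun i => (hlaw i).aemeasurable
  have h := (iIndepFun_iff_map_fun_eq_pi_map hae).1 hA.indep
  have hfun : (fun ω i => hermitianCoord A i ω) = fun ω => coord (A ω) :=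
    funext fun ω => hermitianCoord_eq_coord A ω
  rw [hfun] at h
  refine ⟨?_, ?_⟩
  · have := aemeasurable_pi_lambda (fun ω i => hermitianCoord A i ω) hae
    rwa [hfun] at this
  · rw [h]
    congr 1
    ext1 i
    exact (hlaw i).map_eq

theorem exists_prob_lt_eq {N : ℕ} (hN : 0 < N) : ∃ κ : ℝ, 0 ≤ κ ∧
    ∀ {Ω : Type*} [MeasurableSpace Ω] (P : Measure Ω) [IsProbabilityMeasure P]
      {A : Ω → Matrix (Fin N) (Fin N) ℂ}, IsGUE P A → ∀ s,
      P {ω | ¬ largestEigenvalue (A ω) < s} = 1 - P {ω | largestEigenvalue (A ω) < s} ∧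
      P.real {ω | largestEigenvalue (A ω) < s} = κ * (gram (monos N) s 1).det := by
  obtain ⟨c, hc, hcut⟩ := exists_cutMass_eq N
  refine ⟨(ENNReal.ofReal (∏ i : Fin N ⊕ LowerPair N ⊕ LowerPair N, normConst i) * c).toReal,
    ENNReal.toReal_nonneg, fun P _ A hA s => ?_⟩
  obtain ⟨hae, hmap⟩ := map_coord_of_isGUE hA
  have hset : {ω | largestEigenvalue (A ω) < s} =
      (fun ω => coord (A ω)) ⁻¹' {x | ((s : ℂ) • 1 - toMatrix x).PosDef} := by
    ext ω
    simp only [Set.mem_ofPred_eq, Set.mem_preimage, toMatrix_coord (hA.isHermitian ω)]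
    exact largestEigenvalue_lt_iff hN (hA.isHermitian ω) s
  have hm : MeasurableSet {x : HermCoord N | ((s : ℂ) • 1 - toMatrix x).PosDef} :=
    measurableSet_posDef (by have := continuous_toMatrix (n := N); fun_prop)
  have hprob : P {ω | largestEigenvalue (A ω) < s} =
      ENNReal.ofReal (∏ i : Fin N ⊕ LowerPair N ⊕ LowerPair N, normConst i) * cutMass N s 1 := by
    rw [hset, ← Measure.map_apply_of_aemeasurable hae hm, hmap, pi_gaussian_eq,
      withDensity_apply _ hm, lintegral_const_mul' _ _ ENNReal.ofReal_ne_top, cutMass,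
      ← lintegral_indicator hm]
    rfl
  refine ⟨?_, ?_⟩
  · have hnull : NullMeasurableSet {ω | largestEigenvalue (A ω) < s} P := by
      rw [hset]; exact hae.nullMeasurable hm
    exact prob_compl_eq_one_sub₀ hnull
  · rw [Measure.real, hprob, hcut, ENNReal.toReal_mul, ENNReal.toReal_mul, ENNReal.toReal_mul,
      ENNReal.toReal_ofReal (r := Matrix.det _), one_pow]
    · ring
    · exact (posSemidef_gram _ _ _).det_nonneg

/-- The distribution function and the orthonormal Gram determinant are proportional, and both tend
to 1 as s → ∞, so they coincide. -/
theorem prob_lt_eq_det {N : ℕ} (hN : 0 < N) {h : Fin N → ℝ[X]} (hdeg : ∀ j, (h j).natDegree ≤ j)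
    (horth : ∀ j k, ∫ x, (h j * h k).eval x * Real.exp (-x ^ 2) = if j = k then 1 else 0)
    {Ω : Type*} [MeasurableSpace Ω] (P : Measure Ω) [IsProbabilityMeasure P]
    {A : Ω → Matrix (Fin N) (Fin N) ℂ} (hA : IsGUE P A) (s : ℝ) :
    P.real {ω | s ≤ largestEigenvalue (A ω)} = 1 - (gram h s 1).det := by
  obtain ⟨κ, -, hκ⟩ := exists_prob_lt_eq hN
  set a := (∏ j, (h j).coeff j) ^ 2 with ha
  have hdet : ∀ s, (gram h s 1).det = a * (gram (monos N) s 1).det := fun s => det_gram h hdeg s 1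
  have hlim1 : Filter.Tendsto (fun s => (gram h s 1).det) Filter.atTop (nhds 1) := by
    have h1 : Filter.Tendsto (fun s => gram h s 1) Filter.atTop (nhds 1) := by
      refine tendsto_pi_nhds.2 fun i => tendsto_pi_nhds.2 fun j => ?_
      have := tendsto_gaussInt_atTop (1 * (h i * h j))
      rw [one_mul, horth] at this
      simpa [gram, one_apply] using this
    have h2 := ((continuous_id.matrix_det :
      Continuous fun M : Matrix (Fin N) (Fin N) ℝ => M.det).tendsto 1).comp h1
    rw [id, det_one] at h2
    exact h2
  -- The leading coefficients need not be computed: if one vanished, the determinant would be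
  -- identically 0 and could not tend to 1.
  have ha0 : a ≠ 0 := by
    intro h0
    simp only [hdet, h0, zero_mul] at hlim1
    exact zero_ne_one (tendsto_nhds_unique tendsto_const_nhds hlim1)
  have hF : ∀ s, P.real {ω | largestEigenvalue (A ω) < s} = κ / a * (gram h s 1).det := by
    intro s
    rw [(hκ P hA s).2, hdet]
    field_simp
  have hlim2 : Filter.Tendsto (fun k : ℕ => P.real {ω | largestEigenvalue (A ω) < (k : ℝ)})
      Filter.atTop (nhds 1) := by
    have hmono : Monotone fun k : ℕ => {ω | largestEigenvalue (A ω) < (k : ℝ)} := by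
      intro k l hkl ω hω
      have h1 : largestEigenvalue (A ω) < (k : ℝ) := hω
      exact h1.trans_le (by exact_mod_cast hkl)
    have h1 := tendsto_measure_iUnion_atTop (μ := P) hmono
    have h2 : ⋃ k : ℕ, {ω | largestEigenvalue (A ω) < (k : ℝ)} = Set.univ := by
      ext ω
      simpa using exists_nat_gt _
    rw [h2, measure_univ] at h1
    exact (ENNReal.tendsto_toReal ENNReal.one_ne_top).comp h1
  have hκa : κ / a = 1 := by
    have h3 := (hlim1.comp tendsto_natCast_atTop_atTop).const_mul (κ / a)
    rw [mul_one] at h3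
    refine tendsto_nhds_unique h3 (hlim2.congr fun k => ?_)
    rw [hF]; rfl
  have hcompl := (hκ P hA s).1
  have hset : {ω | s ≤ largestEigenvalue (A ω)} = {ω | ¬ largestEigenvalue (A ω) < s} := by
    ext; simp
  rw [hset, Measure.real, hcompl, ENNReal.toReal_sub_of_le prob_le_one ENNReal.one_ne_top]
  have := hF s
  rw [hκa, one_mul, Measure.real] at this
  rw [this, ENNReal.toReal_one]

theorem one_sub_prod_le {ι : Type*} {g : ι → ℝ} (h0 : ∀ i, 0 ≤ g i) (h1 : ∀ i, g i ≤ 1)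
    (S : Finset ι) : 1 - ∏ i ∈ S, g i ≤ ∑ i ∈ S, (1 - g i) := by
  classical
  induction S using Finset.induction_on with
  | empty => simp
  | insert a S ha ih =>
    rw [Finset.prod_insert ha, Finset.sum_insert ha]
    have h2 : ∏ i ∈ S, g i ≤ 1 := Finset.prod_le_one (fun i _ => h0 i) fun i _ => h1 i
    nlinarith [h0 a, h1 a]

/-- By orthonormality 1 - G is the Gram matrix over (s, ∞), so the eigenvalues g of G lie in [0, 1].
The bounds are 1 - ∏ g ≤ ∑ (1 - g) and g ≤ exp(-(1 - g)), the sum being the trace of 1 - G. -/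
theorem det_gram_bounds {N : ℕ} {h : Fin N → ℝ[X]}
    (horth : ∀ j k, ∫ x, (h j * h k).eval x * Real.exp (-x ^ 2) = if j = k then 1 else 0) (s : ℝ) :
    1 - (gram h s 1).det ≤ ∑ j, ∫ x in Set.Ioi s, (h j).eval x ^ 2 * Real.exp (-x ^ 2) ∧
    1 - Real.exp (-∑ j, ∫ x in Set.Ioi s, (h j).eval x ^ 2 * Real.exp (-x ^ 2)) ≤
      1 - (gram h s 1).det := by
  have hG : (gram h s 1).PosSemidef := by simpa using posSemidef_gram h s 1
  have hG1 : (1 - gram h s 1).PosSemidef := by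
    refine PosSemidef.of_dotProduct_mulVec_nonneg (isHermitian_one.sub hG.1) fun v => ?_
    have : star v ⬝ᵥ ((1 - gram h s 1) *ᵥ v) =
        ∫ x in Set.Ioi s, (∑ i, v i * (h i).eval x) ^ 2 * Real.exp (-x ^ 2) := by
      have h1 : ∀ x : ℝ, (∑ i, v i * (h i).eval x) ^ 2 * Real.exp (-x ^ 2) =
          ∑ i, ∑ j, v i * v j * ((h i * h j).eval x * Real.exp (-x ^ 2)) := by
        intro x
        rw [pow_two, Finset.sum_mul_sum, Finset.sum_mul]
        refine Finset.sum_congr rfl fun i _ => ?_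
        rw [Finset.sum_mul]
        refine Finset.sum_congr rfl fun j _ => ?_
        rw [eval_mul]; ring
      simp only [h1]
      have hint : ∀ i j, IntegrableOn (fun x =>
          v i * v j * ((h i * h j).eval x * Real.exp (-x ^ 2))) (Set.Ioi s) := fun i j =>
        ((integrable_eval_mul_exp _).const_mul _).integrableOn
      rw [integral_finsetSum _ fun i _ => integrable_finsetSum _ fun j _ => hint i j]
      simp only [dotProduct, mulVec, Finset.mul_sum]
      refine Finset.sum_congr rfl fun i _ => ?_
      rw [integral_finsetSum _ fun j _ => hint i j]
      refine Finset.sum_congr rfl fun j _ => ?_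
      rw [integral_const_mul]
      have h2 := gaussInt_eq_sub s (1 * (h i * h j))
      rw [one_mul, horth] at h2
      have h3 : (1 - gram h s 1) i j = (if i = j then 1 else 0) - gaussInt s (h i * h j) := by
        rw [Matrix.sub_apply, one_apply, gram, of_apply, one_mul]
      rw [h3, h2, star_trivial]
      ring
    rw [this]
    exact setIntegral_nonneg measurableSet_Ioi fun x _ => by positivity
  have hle : ∀ i, hG.1.eigenvalues i ≤ 1 := by
    intro i
    have h1 := hG1.dotProduct_mulVec_nonneg (hG.1.eigenvectorBasis i).ofLp
    have hv : (hG.1.eigenvectorBasis i).ofLp ≠ 0 := fun h0 =>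
      hG.1.eigenvectorBasis.orthonormal.ne_zero i (by ext j; simpa using congrFun h0 j)
    rw [sub_mulVec, hG.1.mulVec_eigenvectorBasis i, one_mulVec, dotProduct_sub,
      dotProduct_smul, smul_eq_mul] at h1
    have h2 := dotProduct_star_self_pos_iff.2 hv
    nlinarith
  have htr : ∑ j, ∫ x in Set.Ioi s, (h j).eval x ^ 2 * Real.exp (-x ^ 2) =
      ∑ i, (1 - hG.1.eigenvalues i) := by
    have h1 := hG.1.trace_eq_sum_eigenvalues
    rw [Finset.sum_sub_distrib]
    simp only [RCLike.ofReal_real_eq_id, id] at h1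
    rw [← h1, trace, ← Finset.sum_sub_distrib]
    refine Finset.sum_congr rfl fun j _ => ?_
    have h2 := gaussInt_eq_sub s (1 * (h j * h j))
    rw [one_mul, horth, if_pos rfl] at h2
    simp only [diag_apply, gram, of_apply, one_mul, h2, eval_mul, pow_two]
    ring
  have hdet : (gram h s 1).det = ∏ i, hG.1.eigenvalues i := by
    simpa using hG.1.det_eq_prod_eigenvalues
  rw [htr, hdet]
  have hnn := hG.eigenvalues_nonneg
  constructor
  · exact one_sub_prod_le hnn hle Finset.univ
  · have : ∏ i, hG.1.eigenvalues i ≤ Real.exp (-∑ i, (1 - hG.1.eigenvalues i)) := by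
      rw [← Finset.sum_neg_distrib, Real.exp_sum]
      refine Finset.prod_le_prod (fun i _ => hnn i) fun i _ => ?_
      have := Real.add_one_le_exp (-(1 - hG.1.eigenvalues i))
      linarith
    linarith

end Law
end GUETail

namespace GUETail
open Polynomial

/-! ### Hermite polynomials and the one-point density. -/

section Hermite

/-- The physicists' Hermite polynomials. -/
noncomputable def herm : ℕ → ℝ[X]
  | 0 => 1
  | n + 1 => C 2 * X * herm n - derivative (herm n)

theorem derivative_herm_succ (n : ℕ) :
    derivative (herm (n + 1)) = C (2 * ((n : ℝ) + 1)) * herm n := by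
  induction n with
  | zero => simp [herm]
  | succ n ih =>
    rw [herm, derivative_sub, derivative_mul, ih, derivative_mul, derivative_C, derivative_C_mul,
      derivative_X, show derivative (herm n) = C 2 * X * herm n - herm (n + 1) by rw [herm]; ring]
    push_cast
    simp only [map_mul, map_add, map_one]
    ring

theorem herm_succ_succ (n : ℕ) :
    herm (n + 2) = C 2 * X * herm (n + 1) - C (2 * ((n : ℝ) + 1)) * herm n := by
  rw [herm, derivative_herm_succ]

theorem natDegree_herm_le (n : ℕ) : (herm n).natDegree ≤ n := by
  induction n with
  | zero => simp [herm]
  | succ n ih =>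
    rw [herm]
    refine (natDegree_sub_le _ _).trans (max_le ?_ ?_)
    · refine natDegree_mul_le.trans ?_
      have : (C (2 : ℝ) * X).natDegree ≤ 1 :=
        (natDegree_C_mul_le _ _).trans natDegree_X_le
      omega
    · exact (natDegree_derivative_le _).trans (by omega)

theorem coeff_herm_self (n : ℕ) : (herm n).coeff n = 2 ^ n := by
  induction n with
  | zero => simp [herm]
  | succ n ih =>
    rw [herm, coeff_sub, mul_assoc, coeff_C_mul, coeff_X_mul, ih, coeff_derivative,
      coeff_eq_zero_of_natDegree_lt ((natDegree_herm_le n).trans_lt (by omega))]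
    ring

theorem hasDerivAt_eval_mul_exp (q : ℝ[X]) (x : ℝ) :
    HasDerivAt (fun x => q.eval x * Real.exp (-x ^ 2))
      ((derivative q - C 2 * X * q).eval x * Real.exp (-x ^ 2)) x := by
  have h1 := (q.hasDerivAt x).mul ((hasDerivAt_pow 2 x).neg.exp)
  refine h1.congr_deriv ?_
  simp
  ring

/-- Integration by parts: H_{n+1} exp(-x²) is minus the derivative of H_n exp(-x²). -/
theorem integral_herm_succ_mul (n : ℕ) (q : ℝ[X]) :
    ∫ x, (herm (n + 1) * q).eval x * Real.exp (-x ^ 2) =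
      ∫ x, (herm n * derivative q).eval x * Real.exp (-x ^ 2) := by
  have h1 := integral_eq_zero_of_hasDerivAt_of_integrable
    (hasDerivAt_eval_mul_exp (herm n * q)) (integrable_eval_mul_exp _) (integrable_eval_mul_exp _)
  have h2 : derivative (herm n * q) - C 2 * X * (herm n * q) =
      herm n * derivative q - herm (n + 1) * q := by
    rw [derivative_mul, herm]; ring
  rw [h2] at h1
  simp only [eval_sub, sub_mul] at h1
  rw [integral_sub (integrable_eval_mul_exp _) (integrable_eval_mul_exp _)] at h1
  linarith

/-- The squared norms of the Hermite polynomials. -/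
noncomputable def hermNorm (n : ℕ) : ℝ := 2 ^ n * n.factorial * √Real.pi

theorem hermNorm_pos (n : ℕ) : 0 < hermNorm n := by unfold hermNorm; positivity

theorem hermNorm_succ (n : ℕ) : hermNorm (n + 1) = 2 * (n + 1) * hermNorm n := by
  rw [hermNorm, hermNorm, Nat.factorial_succ]; push_cast; ring

theorem integral_herm_mul_herm (n m : ℕ) :
    ∫ x, (herm n * herm m).eval x * Real.exp (-x ^ 2) = if n = m then hermNorm n else 0 := by
  induction n generalizing m with
  | zero =>
    cases m with
    | zero =>
      have := integral_gaussian 1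
      simpa [herm, hermNorm] using this
    | succ m =>
      rw [mul_comm, integral_herm_succ_mul]
      simp [herm]
  | succ n ih =>
    rw [integral_herm_succ_mul]
    cases m with
    | zero => simp [herm]
    | succ m =>
      rw [derivative_herm_succ]
      have h : ∀ x, (herm n * (C (2 * ((m : ℝ) + 1)) * herm m)).eval x * Real.exp (-x ^ 2) =
          2 * ((m : ℝ) + 1) * ((herm n * herm m).eval x * Real.exp (-x ^ 2)) := by
        intro x; simp; ring
      simp only [h]
      rw [integral_const_mul, ih]
      by_cases hnm : n = m
      · subst hnm; simp [hermNorm_succ]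
      · simp [hnm]

/-- The orthonormal Hermite polynomials. -/
noncomputable def hermOrtho (n : ℕ) : ℝ[X] := C (√(hermNorm n))⁻¹ * herm n

theorem natDegree_hermOrtho_le (n : ℕ) : (hermOrtho n).natDegree ≤ n :=
  (natDegree_C_mul_le _ _).trans (natDegree_herm_le n)

theorem integral_hermOrtho (n m : ℕ) :
    ∫ x, (hermOrtho n * hermOrtho m).eval x * Real.exp (-x ^ 2) = if n = m then 1 else 0 := by
  have h : ∀ x, (hermOrtho n * hermOrtho m).eval x * Real.exp (-x ^ 2) =
      ((√(hermNorm n))⁻¹ * (√(hermNorm m))⁻¹) *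
        ((herm n * herm m).eval x * Real.exp (-x ^ 2)) := by
    intro x; simp [hermOrtho]; ring
  simp only [h]
  rw [integral_const_mul, integral_herm_mul_herm]
  by_cases hnm : n = m
  · subst hnm
    have := hermNorm_pos n
    rw [if_pos rfl, if_pos rfl, ← mul_inv, Real.mul_self_sqrt this.le, inv_mul_cancel₀ this.ne']
  · simp [hnm]

/-- The one-point function `∑_{j < N} h_j(x)² exp(-x²)`. -/
noncomputable def density (N : ℕ) (x : ℝ) : ℝ :=
  ∑ j ∈ Finset.range N, (herm j).eval x ^ 2 / hermNorm j * Real.exp (-x ^ 2)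

theorem density_nonneg (N : ℕ) (x : ℝ) : 0 ≤ density N x :=
  Finset.sum_nonneg fun j _ => by have := hermNorm_pos j; positivity

/-- A differential form of Christoffel–Darboux: by the three-term recurrence the derivatives of the
summands telescope to one product. -/
theorem hasDerivAt_density (n : ℕ) (x : ℝ) : HasDerivAt (density (n + 1))
    (-((herm (n + 1)).eval x * (herm n).eval x / hermNorm n * Real.exp (-x ^ 2))) x := by
  have hterm : ∀ j, HasDerivAt (fun x => (herm j).eval x ^ 2 / hermNorm j * Real.exp (-x ^ 2))
      ((2 * (herm j).eval x * (derivative (herm j)).eval x - 2 * x * (herm j).eval x ^ 2) /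
        hermNorm j * Real.exp (-x ^ 2)) x := by
    intro j
    have h := (hasDerivAt_eval_mul_exp (herm j ^ 2) x).div_const (hermNorm j)
    simp only [eval_pow, eval_sub, derivative_pow, eval_mul, eval_C, eval_X] at h
    refine (h.congr_deriv ?_).congr_of_eventuallyEq (Filter.Eventually.of_forall fun y => ?_)
    · simp; ring
    · simp only; ring
  induction n with
  | zero =>
    have h := hterm 0
    have he : density (0 + 1) = fun x => (herm 0).eval x ^ 2 / hermNorm 0 * Real.exp (-x ^ 2) := by
      ext x; simp [density]
    rw [he]
    refine h.congr_deriv ?_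
    simp [herm]; ring
  | succ n ih =>
    have he : density (n + 1 + 1) = fun x => density (n + 1) x +
        (herm (n + 1)).eval x ^ 2 / hermNorm (n + 1) * Real.exp (-x ^ 2) := by
      ext x; rw [density, Finset.sum_range_succ]; rfl
    rw [he]
    refine (ih.add (hterm (n + 1))).congr_deriv ?_
    rw [derivative_herm_succ, herm_succ_succ, hermNorm_succ]
    have := hermNorm_pos n
    have hn : (0 : ℝ) < n + 1 := by positivity
    simp only [eval_mul, eval_sub, eval_C, eval_X]
    field_simp
    ring

theorem integrable_density_term (j : ℕ) :
    Integrable fun x => (herm j).eval x ^ 2 / hermNorm j * Real.exp (-x ^ 2) := by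
  refine ((integrable_eval_mul_exp (herm j ^ 2)).div_const (hermNorm j)).congr
    (Filter.Eventually.of_forall fun x => ?_)
  simp only [eval_pow]; ring

theorem integrable_density (N : ℕ) : Integrable (density N) :=
  integrable_finsetSum _ fun j _ => integrable_density_term j

theorem sum_integral_hermOrtho (N : ℕ) (s : ℝ) :
    ∑ j : Fin N, ∫ x in Set.Ioi s, (hermOrtho j).eval x ^ 2 * Real.exp (-x ^ 2) =
      ∫ x in Set.Ioi s, density N x := by
  rw [Fin.sum_univ_eq_sum_range
    (fun j => ∫ x in Set.Ioi s, (hermOrtho j).eval x ^ 2 * Real.exp (-x ^ 2))]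
  simp only [density]
  rw [integral_finsetSum _ fun j _ => (integrable_density_term j).integrableOn]
  refine Finset.sum_congr rfl fun j _ => ?_
  congr 1
  ext x
  rw [hermOrtho, eval_mul, eval_C, mul_pow, inv_pow, Real.sq_sqrt (hermNorm_pos j).le]
  ring

theorem tendsto_eval_mul_exp_neg (q : ℝ[X]) {b : ℝ} (hb : 0 < b) :
    Filter.Tendsto (fun x => q.eval x * Real.exp (-b * x ^ 2)) Filter.atTop (nhds 0) := by
  induction q using Polynomial.induction_on' with
  | add p q hp hq => simpa [add_mul] using hp.add hq
  | monomial k a =>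
    have h := tendsto_rpow_abs_mul_exp_neg_mul_sq_cocompact hb (k : ℝ)
    have h2 := (h.mono_left atTop_le_cocompact).const_mul a
    rw [mul_zero] at h2
    refine h2.congr' ?_
    filter_upwards [Filter.eventually_ge_atTop 0] with x hx
    rw [abs_of_nonneg hx, Real.rpow_natCast, eval_monomial, mul_assoc]

theorem tendsto_density (N : ℕ) : Filter.Tendsto (density N) Filter.atTop (nhds 0) := by
  have h := tendsto_finsetSum (Finset.range N) fun j _ =>
    (tendsto_eval_mul_exp_neg (herm j ^ 2) one_pos).div_const (hermNorm j)
  simp only [zero_div, Finset.sum_const_zero] at h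
  refine h.congr fun x => ?_
  rw [density]
  refine Finset.sum_congr rfl fun j _ => ?_
  rw [eval_pow, neg_one_mul]; ring

/-- Inductively 2(n+1)H_n ≤ x² H_n ≤ x H_{n+1}, so the recurrence leaves at least 2x H_{n+1} - x
H_{n+1}. This gives positivity past the turning point and lets consecutive polynomials be exchanged.
-/
theorem herm_ratio {x : ℝ} (hx : 0 < x) (n : ℕ) (hn : 2 * (n : ℝ) ≤ x ^ 2) :
    0 < (herm n).eval x ∧ x * (herm n).eval x ≤ (herm (n + 1)).eval x := by
  induction n with
  | zero => simp [herm]; linarith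
  | succ n ih =>
    push_cast at hn
    obtain ⟨h1, h2⟩ := ih (by linarith)
    have h3 : 0 < (herm (n + 1)).eval x := lt_of_lt_of_le (by positivity) h2
    refine ⟨h3, ?_⟩
    rw [herm_succ_succ]
    simp only [eval_mul, eval_sub, eval_C, eval_X]
    have h4 : 2 * ((n : ℝ) + 1) * (herm n).eval x ≤ x * (herm (n + 1)).eval x := by
      calc 2 * ((n : ℝ) + 1) * (herm n).eval x ≤ x ^ 2 * (herm n).eval x := by
            gcongr
        _ = x * (x * (herm n).eval x) := by ring
        _ ≤ _ := by gcongr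
    linarith

end Hermite
end GUETail

namespace GUETail
open Polynomial Filter

/-! ### WKB bounds beyond a turning point. -/

section WKB

theorem le_of_deriv_nonneg_of_tendsto {f f' : ℝ → ℝ} {a l : ℝ}
    (hf : ∀ x, a < x → HasDerivAt f (f' x) x) (hf' : ∀ x, a < x → 0 ≤ f' x)
    (hl : Tendsto f atTop (nhds l)) {x : ℝ} (hx : a < x) : f x ≤ l := by
  have hmono : MonotoneOn f (Set.Ici x) := by
    refine monotoneOn_of_deriv_nonneg (convex_Ici x)
      (fun y hy => (hf y (hx.trans_le hy)).continuousAt.continuousWithinAt)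
      (fun y hy => ?_) fun y hy => ?_
    · rw [interior_Ici] at hy
      exact (hf y (hx.trans hy)).differentiableAt.differentiableWithinAt
    · rw [interior_Ici] at hy
      rw [(hf y (hx.trans hy)).deriv]
      exact hf' y (hx.trans hy)
  refine ge_of_tendsto hl ?_
  filter_upwards [eventually_ge_atTop x] with y hy
  exact hmono Set.self_mem_Ici hy hy

theorem ge_of_deriv_nonpos_of_tendsto {f f' : ℝ → ℝ} {a l : ℝ}
    (hf : ∀ x, a < x → HasDerivAt f (f' x) x) (hf' : ∀ x, a < x → f' x ≤ 0)
    (hl : Tendsto f atTop (nhds l)) {x : ℝ} (hx : a < x) : l ≤ f x := by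
  have := le_of_deriv_nonneg_of_tendsto (f := fun x => -f x) (f' := fun x => -f' x)
    (fun y hy => (hf y hy).neg) (fun y hy => by linarith [hf' y hy]) hl.neg hx
  linarith

/-- The momentum `√(x² - a²)`. -/
noncomputable def mom (a x : ℝ) : ℝ := √(x ^ 2 - a ^ 2)

/-- The action `∫_a^x √(y² - a²) dy`. -/
noncomputable def action (a x : ℝ) : ℝ :=
  (x * mom a x - a ^ 2 * Real.log ((x + mom a x) / a)) / 2

variable {a x : ℝ}

theorem sq_sub_pos (ha : 0 < a) (hx : a < x) : 0 < x ^ 2 - a ^ 2 := by nlinarith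

theorem mom_pos (ha : 0 < a) (hx : a < x) : 0 < mom a x := Real.sqrt_pos.2 (sq_sub_pos ha hx)

theorem mom_sq (ha : 0 < a) (hx : a ≤ x) : mom a x ^ 2 = x ^ 2 - a ^ 2 :=
  Real.sq_sqrt (by nlinarith)

theorem hasDerivAt_mom (ha : 0 < a) (hx : a < x) : HasDerivAt (mom a) (x / mom a x) x := by
  have h := ((hasDerivAt_pow 2 x).sub_const (a ^ 2)).sqrt (sq_sub_pos ha hx).ne'
  refine h.congr_deriv ?_
  have := mom_pos ha hx
  simp only [mom] at this ⊢
  field_simp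
  norm_num

theorem hasDerivAt_action (ha : 0 < a) (hx : a < x) : HasDerivAt (action a) (mom a x) x := by
  have hq := mom_pos ha hx
  have hx0 : 0 < x := ha.trans hx
  have h1 := hasDerivAt_mom ha hx
  have hlog := (((hasDerivAt_id x).add h1).div_const a).log (by
    simp only [Pi.add_apply, id]; positivity)
  have h := (((hasDerivAt_id x).mul h1).sub (hlog.const_mul (a ^ 2))).div_const 2
  refine h.congr_deriv ?_
  have h2 := mom_sq ha hx.le
  simp only [Pi.add_apply, id]
  have h3 : x + mom a x ≠ 0 := by positivity
  field_simp
  nlinarith [h2]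

theorem continuousOn_action (ha : 0 < a) : ContinuousOn (action a) (Set.Ici a) := by
  unfold action mom
  refine ContinuousOn.div_const (ContinuousOn.sub (by fun_prop) (ContinuousOn.mul (by fun_prop)
    (ContinuousOn.log (by fun_prop) fun y hy => ?_))) _
  have : 0 < y := ha.trans_le hy
  have := Real.sqrt_nonneg (y ^ 2 - a ^ 2)
  positivity

theorem action_self (ha : 0 < a) : action a a = 0 := by
  simp [action, mom, ha.ne']

theorem mom_mono (ha : 0 < a) {y : ℝ} (hx : a ≤ x) (hxy : x ≤ y) : mom a x ≤ mom a y :=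
  Real.sqrt_le_sqrt (by nlinarith)

theorem action_sub_bounds (ha : 0 < a) {y : ℝ} (hx : a ≤ x) (hxy : x ≤ y) :
    mom a x * (y - x) ≤ action a y - action a x ∧
      action a y - action a x ≤ mom a y * (y - x) := by
  rcases hxy.eq_or_lt with rfl | hxy
  · simp
  obtain ⟨z, hz, hz'⟩ := exists_hasDerivAt_eq_slope (action a) (mom a) hxy
    ((continuousOn_action ha).mono fun z hz => hx.trans hz.1)
    fun z hz => hasDerivAt_action ha (hx.trans_lt hz.1)
  have h1 : action a y - action a x = mom a z * (y - x) := by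
    rw [hz']; field_simp [(sub_pos.2 hxy).ne']
  rw [h1]
  have := sub_pos.2 hxy
  exact ⟨mul_le_mul_of_nonneg_right (mom_mono ha hx hz.1.le) this.le,
    mul_le_mul_of_nonneg_right (mom_mono ha (hx.trans hz.1.le) hz.2.le) this.le⟩

theorem action_nonneg (ha : 0 < a) (hx : a ≤ x) : 0 ≤ action a x := by
  have h := (action_sub_bounds ha le_rfl hx).1
  rw [action_self ha, sub_zero] at h
  refine le_trans ?_ h
  exact mul_nonneg (Real.sqrt_nonneg _) (sub_nonneg.2 hx)

/-- The reciprocal of the WKB solution. -/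
noncomputable def wkbInv (a x : ℝ) : ℝ := Real.exp (action a x + Real.log (mom a x) / 2)

theorem wkbInv_pos : 0 < wkbInv a x := Real.exp_pos _

/-- The logarithmic derivative of the WKB solution. -/
noncomputable def wkbLog (a x : ℝ) : ℝ := -(mom a x) - x / (2 * mom a x ^ 2)

theorem hasDerivAt_wkbInv (ha : 0 < a) (hx : a < x) :
    HasDerivAt (wkbInv a) (-(wkbLog a x) * wkbInv a x) x := by
  have hq := mom_pos ha hx
  have h := ((hasDerivAt_action ha hx).add (((hasDerivAt_mom ha hx).log hq.ne').div_const 2)).exp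
  refine h.congr_deriv ?_
  change wkbInv a x * _ = _
  rw [wkbLog]
  field_simp
  ring

/-- Riccati form of φ'' = (`mom`² + r) φ for the WKB function φ = 1/`wkbInv`, with excess r = (3x² +
2a²)/(4 `mom`⁴). The positivity of r drives the comparison with a true solution. -/
theorem hasDerivAt_wkbLog (ha : 0 < a) (hx : a < x) :
    HasDerivAt (wkbLog a) (mom a x ^ 2 + (3 * x ^ 2 + 2 * a ^ 2) / (4 * mom a x ^ 4) -
      wkbLog a x ^ 2) x := by
  have hq := mom_pos ha hx
  have h1 := hasDerivAt_mom ha hx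
  have h := h1.neg.sub ((hasDerivAt_id x).div ((h1.pow 2).const_mul 2) (by simp only [Pi.pow_apply]; positivity))
  refine h.congr_deriv ?_
  have h2 : a ^ 2 = x ^ 2 - mom a x ^ 2 := by rw [mom_sq ha hx.le]; ring
  rw [wkbLog, h2]
  simp only [id, Pi.pow_apply]
  field_simp
  ring

/-- The relative error of the WKB approximation. -/
noncomputable def wkbErr (a x : ℝ) : ℝ := x / (4 * mom a x ^ 3)

/-- The derivative of `wkbErr`, with the opposite sign. -/
noncomputable def wkbErrDeriv (a x : ℝ) : ℝ := (2 * x ^ 2 + a ^ 2) / (4 * mom a x ^ 5)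

theorem hasDerivAt_wkbErr (ha : 0 < a) (hx : a < x) :
    HasDerivAt (wkbErr a) (-wkbErrDeriv a x) x := by
  have hq := mom_pos ha hx
  have h1 := hasDerivAt_mom ha hx
  have h := (hasDerivAt_id x).div ((h1.pow 3).const_mul 4) (by simp only [Pi.pow_apply]; positivity)
  refine h.congr_deriv ?_
  have h2 : a ^ 2 = x ^ 2 - mom a x ^ 2 := by rw [mom_sq ha hx.le]; ring
  rw [wkbErrDeriv, h2]
  simp only [id, Pi.pow_apply]
  field_simp
  ring

theorem hasDerivAt_wkbErrDeriv (ha : 0 < a) (hx : a < x) :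
    HasDerivAt (wkbErrDeriv a) (-(x * (6 * x ^ 2 + 9 * a ^ 2) / (4 * mom a x ^ 7))) x := by
  have hq := mom_pos ha hx
  have h1 := hasDerivAt_mom ha hx
  have h := (((hasDerivAt_pow 2 x).const_mul 2).add_const (a ^ 2)).div
    ((h1.pow 5).const_mul 4) (by simp only [Pi.pow_apply]; positivity)
  refine h.congr_deriv ?_
  have h2 : a ^ 2 = x ^ 2 - mom a x ^ 2 := by rw [mom_sq ha hx.le]; ring
  rw [h2]
  simp only [Pi.pow_apply]
  field_simp
  ring

/-- Two-sided WKB bounds for a positive recessive solution of `f'' = (x² - a²) f`. -/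
theorem wkb_bounds {f f' : ℝ → ℝ} {L : ℝ} (ha : 0 < a)
    (hf : ∀ x, a < x → HasDerivAt f (f' x) x)
    (hf' : ∀ x, a < x → HasDerivAt f' ((x ^ 2 - a ^ 2) * f x) x) (hpos : ∀ x, a < x → 0 < f x)
    (hL : Tendsto (fun x => f x * wkbInv a x) atTop (nhds L))
    (hlim : Tendsto (fun x => (f' x - wkbLog a x * f x) / wkbInv a x) atTop (nhds 0))
    (hlim2 : Tendsto (fun x => wkbErrDeriv a x / wkbInv a x ^ 2) atTop (nhds 0))
    (hlim3 : Tendsto (wkbErr a) atTop (nhds 0)) {x : ℝ} (hx : a < x) :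
    f x * wkbInv a x ≤ L ∧ L * (1 - wkbErr a x) ≤ f x * wkbInv a x := by
  -- This is the Wronskian f'φ - fφ' with φ = 1/`wkbInv`. It satisfies w' = -r f φ ≤ 0 and tends to
  -- 0, so w ≥ 0; then (f/φ)' = w/φ² shows that f/φ increases to L.
  set w : ℝ → ℝ := fun x => (f' x - wkbLog a x * f x) / wkbInv a x with hw
  have hwd : ∀ y, a < y → HasDerivAt w
      (-((3 * y ^ 2 + 2 * a ^ 2) / (4 * mom a y ^ 4) * f y / wkbInv a y)) y := by
    intro y hy
    have hE : 0 < wkbInv a y := wkbInv_pos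
    have h := ((hf' y hy).sub ((hasDerivAt_wkbLog ha hy).mul (hf y hy))).div
      (hasDerivAt_wkbInv ha hy) hE.ne'
    refine h.congr_deriv ?_
    rw [← mom_sq ha hy.le]
    simp only [Pi.mul_apply, Pi.sub_apply]
    generalize wkbLog a y = z
    generalize (3 * y ^ 2 + 2 * a ^ 2) / (4 * mom a y ^ 4) = r
    field_simp
    ring
  have hw0 : ∀ y, a < y → 0 ≤ w y := by
    intro y hy
    refine ge_of_deriv_nonpos_of_tendsto hwd (fun u hu => ?_) hlim hy
    have h1 := hpos u hu
    have h2 : 0 < wkbInv a u := wkbInv_pos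
    have h3 := mom_pos ha hu
    rw [neg_nonpos]
    positivity
  have hRd : ∀ y, a < y → HasDerivAt (fun x => f x * wkbInv a x) (w y * wkbInv a y ^ 2) y := by
    intro y hy
    have hE : 0 < wkbInv a y := wkbInv_pos
    refine ((hf y hy).mul (hasDerivAt_wkbInv ha hy)).congr_deriv ?_
    simp only [hw]
    field_simp
    ring
  have hR : ∀ y, a < y → f y * wkbInv a y ≤ L := by
    intro y hy
    exact le_of_deriv_nonneg_of_tendsto hRd
      (fun u hu => mul_nonneg (hw0 u hu) (by positivity)) hL hy
  have hL0 : 0 ≤ L := (mul_pos (hpos x hx) wkbInv_pos).le.trans (hR x hx)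
  -- The bound f ≤ Lφ is fed back into w' = -r f φ to bound w from above.
  have hwB : ∀ y, a < y → w y - L * (wkbErrDeriv a y / wkbInv a y ^ 2) ≤ 0 := by
    intro y hy
    refine le_of_deriv_nonneg_of_tendsto (l := 0) (a := a)
      (f := fun y => w y - L * (wkbErrDeriv a y / wkbInv a y ^ 2))
      (f' := fun y => -((3 * y ^ 2 + 2 * a ^ 2) / (4 * mom a y ^ 4) * f y / wkbInv a y) -
        L * ((-(y * (6 * y ^ 2 + 9 * a ^ 2) / (4 * mom a y ^ 7)) +
          2 * wkbLog a y * wkbErrDeriv a y) / wkbInv a y ^ 2)) (fun u hu => ?_) (fun u hu => ?_) ?_ hy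
    · have hE : 0 < wkbInv a u := wkbInv_pos
      refine (hwd u hu).sub (HasDerivAt.const_mul L ?_)
      refine ((hasDerivAt_wkbErrDeriv ha hu).div ((hasDerivAt_wkbInv ha hu).pow 2)
        (by simp only [Pi.pow_apply]; positivity)).congr_deriv ?_
      simp only [Pi.pow_apply]
      field_simp
      ring
    · have hE : 0 < wkbInv a u := wkbInv_pos
      have hq := mom_pos ha hu
      have hu0 : 0 < u := ha.trans hu
      have h1 : f u ≤ L / wkbInv a u := by
        rw [le_div_iff₀ hE]; exact hR u hu
      have h2 : (3 * u ^ 2 + 2 * a ^ 2) / (4 * mom a u ^ 4) * f u / wkbInv a u ≤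
          L * ((3 * u ^ 2 + 2 * a ^ 2) / (4 * mom a u ^ 4)) / wkbInv a u ^ 2 := by
        calc _ ≤ (3 * u ^ 2 + 2 * a ^ 2) / (4 * mom a u ^ 4) * (L / wkbInv a u) / wkbInv a u := by
              gcongr
          _ = _ := by field_simp
      -- The choice of `wkbErr` is made for this inequality: 2·`mom`·`wkbErrDeriv` = (4u² + 2a²)/(4
      -- `mom`⁴) already dominates r, and the remaining terms have the right sign.
      have h3 : (3 * u ^ 2 + 2 * a ^ 2) / (4 * mom a u ^ 4) ≤
          u * (6 * u ^ 2 + 9 * a ^ 2) / (4 * mom a u ^ 7) - 2 * wkbLog a u * wkbErrDeriv a u := by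
        have h4 : 2 * wkbLog a u * wkbErrDeriv a u =
            -((2 * u ^ 2 + a ^ 2) / (2 * mom a u ^ 4)) -
              u * (2 * u ^ 2 + a ^ 2) / (4 * mom a u ^ 7) := by
          rw [wkbLog, wkbErrDeriv]; field_simp; ring
        have h5 : (3 * u ^ 2 + 2 * a ^ 2) / (4 * mom a u ^ 4) ≤
            (2 * u ^ 2 + a ^ 2) / (2 * mom a u ^ 4) := by
          rw [div_le_div_iff₀ (by positivity) (by positivity)]
          have : 0 < mom a u ^ 4 := by positivity
          nlinarith [sq_nonneg u]
        have h6 : 0 ≤ u * (6 * u ^ 2 + 9 * a ^ 2) / (4 * mom a u ^ 7) := by positivity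
        have h7 : 0 ≤ u * (2 * u ^ 2 + a ^ 2) / (4 * mom a u ^ 7) := by positivity
        rw [h4]; linarith
      have h8 : L * ((3 * u ^ 2 + 2 * a ^ 2) / (4 * mom a u ^ 4)) / wkbInv a u ^ 2 ≤
          L * (u * (6 * u ^ 2 + 9 * a ^ 2) / (4 * mom a u ^ 7) -
            2 * wkbLog a u * wkbErrDeriv a u) / wkbInv a u ^ 2 := by gcongr
      have h9 : L * (u * (6 * u ^ 2 + 9 * a ^ 2) / (4 * mom a u ^ 7) -
            2 * wkbLog a u * wkbErrDeriv a u) / wkbInv a u ^ 2 =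
          -(L * ((-(u * (6 * u ^ 2 + 9 * a ^ 2) / (4 * mom a u ^ 7)) +
          2 * wkbLog a u * wkbErrDeriv a u) / wkbInv a u ^ 2)) := by ring
      linarith
    · have := hlim.sub (hlim2.const_mul L)
      simpa using this
  refine ⟨hR x hx, ?_⟩
  have h := ge_of_deriv_nonpos_of_tendsto (a := a) (l := L)
    (f := fun x => f x * wkbInv a x + L * wkbErr a x)
    (f' := fun y => w y * wkbInv a y ^ 2 + L * -wkbErrDeriv a y)
    (fun y hy => (hRd y hy).add ((hasDerivAt_wkbErr ha hy).const_mul L)) (fun y hy => ?_)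
    (by simpa using hL.add (hlim3.const_mul L)) hx
  · linarith
  · have hE : 0 < wkbInv a y ^ 2 := pow_pos wkbInv_pos 2
    have h1 := hwB y hy
    have h2 : w y * wkbInv a y ^ 2 ≤ L * wkbErrDeriv a y := by
      have : w y ≤ L * wkbErrDeriv a y / wkbInv a y ^ 2 := by
        rw [mul_div_assoc]; linarith
      rwa [le_div_iff₀ hE] at this
    linarith

end WKB
end GUETail

namespace GUETail
open Polynomial Filter

/-! ### WKB bounds for Hermite functions and their connection constants. -/

section HermiteWKB

theorem derivative_derivative_herm (n : ℕ) :
    derivative (derivative (herm n)) =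
      C 2 * X * derivative (herm n) - C (2 * (n : ℝ)) * herm n := by
  cases n with
  | zero => simp [herm]
  | succ m =>
    rw [derivative_herm_succ, derivative_C_mul, herm]
    push_cast
    ring

theorem hasDerivAt_eval_mul_exp_half (q : ℝ[X]) (x : ℝ) :
    HasDerivAt (fun x => q.eval x * Real.exp (-(1 / 2) * x ^ 2))
      ((derivative q - X * q).eval x * Real.exp (-(1 / 2) * x ^ 2)) x := by
  have h1 := (q.hasDerivAt x).mul (((hasDerivAt_pow 2 x).const_mul (-(1 / 2))).exp)
  refine h1.congr_deriv ?_
  simp only [eval_sub, eval_mul, eval_X]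
  push_cast
  ring

variable {a x : ℝ}

theorem half_le_mom (ha : 0 < a) (hx : 2 * a ≤ x) : x / 2 ≤ mom a x := by
  refine Real.le_sqrt_of_sq_le ?_
  nlinarith

theorem tendsto_wkbErr (ha : 0 < a) : Tendsto (wkbErr a) atTop (nhds 0) := by
  refine squeeze_zero' (g := fun x => 2 * x⁻¹) ?_ ?_
    (by simpa using (tendsto_inv_atTop_zero (𝕜 := ℝ)).const_mul 2)
  · filter_upwards [eventually_gt_atTop a] with x hx
    have := mom_pos ha hx
    have := ha.trans hx
    rw [wkbErr]; positivity
  · filter_upwards [eventually_ge_atTop (2 * a), eventually_ge_atTop 2] with x hx hx2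
    have h1 := half_le_mom ha hx
    have hq : 0 < mom a x := by linarith
    have h2 : (x / 2) ^ 3 ≤ mom a x ^ 3 := by gcongr
    rw [wkbErr, ← div_eq_mul_inv, div_le_div_iff₀ (by positivity) (by positivity)]
    have : x ≤ x ^ 3 := le_self_pow₀ (by linarith) (by norm_num)
    nlinarith [mul_self_nonneg (x - 2), sq_nonneg x]

theorem tendsto_wkbErrDeriv (ha : 0 < a) : Tendsto (wkbErrDeriv a) atTop (nhds 0) := by
  refine squeeze_zero' (g := fun x => 24 * x⁻¹) ?_ ?_
    (by simpa using (tendsto_inv_atTop_zero (𝕜 := ℝ)).const_mul 24)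
  · filter_upwards [eventually_gt_atTop a] with x hx
    have := mom_pos ha hx
    rw [wkbErrDeriv]; positivity
  · filter_upwards [eventually_ge_atTop (2 * a), eventually_ge_atTop 2] with x hx hx2
    have h1 := half_le_mom ha hx
    have hq : 0 < mom a x := by linarith
    have h2 : (x / 2) ^ 5 ≤ mom a x ^ 5 := by gcongr
    rw [wkbErrDeriv, ← div_eq_mul_inv, div_le_div_iff₀ (by positivity) (by positivity)]
    have h3 : x ^ 3 ≤ x ^ 5 := pow_le_pow_right₀ (by linarith) (by norm_num)
    have h4 : a ^ 2 * x ≤ x ^ 3 := by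
      have : a ^ 2 ≤ x ^ 2 := by nlinarith
      nlinarith
    nlinarith

theorem one_le_wkbInv (ha : 0 < a) (hx : a ≤ x) (h1 : 1 ≤ mom a x) : 1 ≤ wkbInv a x := by
  rw [wkbInv]
  exact Real.one_le_exp (add_nonneg (action_nonneg ha hx) (div_nonneg (Real.log_nonneg h1) zero_le_two))

theorem mom_le (hx : 0 ≤ x) : mom a x ≤ x := by
  refine (Real.sqrt_le_sqrt (by nlinarith [sq_nonneg a] : x ^ 2 - a ^ 2 ≤ x ^ 2)).trans_eq
    (Real.sqrt_sq hx)

theorem tendsto_mom_div : Tendsto (fun x => mom a x / x) atTop (nhds 1) := by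
  have h : Tendsto (fun x : ℝ => √(1 - a ^ 2 * (x⁻¹) ^ 2)) atTop (nhds 1) := by
    have := (((tendsto_inv_atTop_zero (𝕜 := ℝ)).pow 2).const_mul (a ^ 2)).const_sub 1
    have := (Real.continuous_sqrt.tendsto _).comp this
    simpa [Function.comp_def] using this
  refine h.congr' ?_
  filter_upwards [eventually_gt_atTop 0] with x hx
  rw [mom, eq_div_iff hx.ne', ← Real.sqrt_sq hx.le, ← Real.sqrt_mul' _ (by positivity),
    Real.sqrt_sq hx.le]
  congr 1
  field_simp

/-- The turning point of the Hermite function of order `n`. -/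
noncomputable def turning (n : ℕ) : ℝ := √(2 * n + 1)

theorem turning_pos (n : ℕ) : 0 < turning n := Real.sqrt_pos.2 (by positivity)

theorem turning_sq (n : ℕ) : turning n ^ 2 = 2 * n + 1 := Real.sq_sqrt (by positivity)

/-- The WKB connection constant of the Hermite function of order `n`. -/
noncomputable def wkbConst (n : ℕ) : ℝ :=
  2 ^ n * Real.exp (-(turning n ^ 2 / 4) - (n + 1 / 2) * Real.log (2 / turning n))

theorem tendsto_herm_div_pow (n : ℕ) :
    Tendsto (fun x => (herm n).eval x / x ^ n) atTop (nhds (2 ^ n)) := by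
  have hc := coeff_herm_self n
  have hne : herm n ≠ 0 := by
    intro h
    rw [h, coeff_zero] at hc
    exact (pow_ne_zero n two_ne_zero) hc.symm
  have hnd : (herm n).natDegree = n :=
    le_antisymm (natDegree_herm_le n) (le_natDegree_of_ne_zero (by rw [hc]; positivity))
  have hd : (herm n).degree = (X ^ n : ℝ[X]).degree := by
    rw [degree_X_pow, degree_eq_natDegree hne, hnd]
  have h := div_tendsto_atTop_leadingCoeff_div_of_degree_eq (herm n) (X ^ n) hd
  rw [leadingCoeff_X_pow, div_one, leadingCoeff, hnd, hc] at h
  simpa using h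

/-- For large x, action = x²/2 - a²/4 - (a²/2) log(2x/a) + o(1). With a² = 2n + 1 and the half
logarithm of `mom`, the powers of x add up to x^{-n}, which cancels the growth of H_n. -/
theorem tendsto_herm_mul_wkbInv (n : ℕ) :
    Tendsto (fun x => (herm n).eval x * Real.exp (-(1 / 2) * x ^ 2) * wkbInv (turning n) x) atTop
      (nhds (wkbConst n)) := by
  have ha := turning_pos n
  have hr := tendsto_mom_div (a := turning n)
  have h1r : Tendsto (fun x => 1 + mom (turning n) x / x) atTop (nhds 2) := by
    have := hr.const_add 1
    norm_num at this
    exact this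
  have e1 : Tendsto (fun x => turning n ^ 2 / (2 * (1 + mom (turning n) x / x))) atTop
      (nhds (turning n ^ 2 / 4)) := by
    have := (tendsto_const_nhds (x := turning n ^ 2)).div (h1r.const_mul 2) (by norm_num)
    norm_num at this
    exact this
  have e2 : Tendsto (fun x => Real.log ((1 + mom (turning n) x / x) / turning n)) atTop
      (nhds (Real.log (2 / turning n))) := (h1r.div_const _).log (by positivity)
  have e3 : Tendsto (fun x => Real.log (mom (turning n) x / x)) atTop (nhds 0) := by
    have := hr.log one_ne_zero
    rwa [Real.log_one] at this
  have h := (tendsto_herm_div_pow n).mul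
    (((e1.neg.sub (e2.const_mul ((n : ℝ) + 1 / 2))).add (e3.const_mul (1 / 2))).rexp)
  rw [mul_zero, add_zero] at h
  refine h.congr' ?_
  filter_upwards [eventually_gt_atTop (turning n)] with x hx
  have hq := mom_pos ha hx
  have hx0 := ha.trans hx
  have hsq := mom_sq ha hx.le
  have hxn : x ^ n = Real.exp (n * Real.log x) := by
    rw [mul_comm, Real.exp_mul, Real.exp_log hx0, Real.rpow_natCast]
  rw [mul_assoc, wkbInv, ← Real.exp_add, hxn, div_mul_eq_mul_div, mul_div_assoc, ← Real.exp_sub]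
  congr 2
  have l1 : Real.log ((x + mom (turning n) x) / turning n) =
      Real.log x + Real.log ((1 + mom (turning n) x / x) / turning n) := by
    rw [← Real.log_mul hx0.ne' (by positivity)]
    congr 1
    field_simp
  have l2 : Real.log (mom (turning n) x) = Real.log x + Real.log (mom (turning n) x / x) := by
    rw [← Real.log_mul hx0.ne' (by positivity)]
    congr 1
    field_simp
  have l3 : turning n ^ 2 / (2 * (1 + mom (turning n) x / x)) =
      x * (x - mom (turning n) x) / 2 := by
    have : turning n ^ 2 = (x - mom (turning n) x) * (x + mom (turning n) x) := by nlinarith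
    rw [this]
    field_simp
  rw [action, l1, l2, l3, turning_sq]
  ring

theorem herm_wkb_bounds (n : ℕ) {x : ℝ} (hx : turning n < x) :
    (herm n).eval x * Real.exp (-(1 / 2) * x ^ 2) * wkbInv (turning n) x ≤ wkbConst n ∧
      wkbConst n * (1 - wkbErr (turning n) x) ≤
        (herm n).eval x * Real.exp (-(1 / 2) * x ^ 2) * wkbInv (turning n) x := by
  have ha := turning_pos n
  have hinv : ∀ᶠ x in atTop, 1 ≤ mom (turning n) x ∧ 1 ≤ wkbInv (turning n) x ∧
      turning n < x := by
    filter_upwards [eventually_ge_atTop (2 * turning n), eventually_ge_atTop 2] with x hx hx2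
    have h1 : 1 ≤ mom (turning n) x := by linarith [half_le_mom ha hx]
    exact ⟨h1, one_le_wkbInv ha (by linarith) h1, by linarith⟩
  refine wkb_bounds (f := fun x => (herm n).eval x * Real.exp (-(1 / 2) * x ^ 2))
    (f' := fun x => (derivative (herm n) - X * herm n).eval x * Real.exp (-(1 / 2) * x ^ 2))
    ha (fun y _ => hasDerivAt_eval_mul_exp_half _ y) (fun y _ => ?_) (fun y hy => ?_)
    (tendsto_herm_mul_wkbInv n) ?_ ?_ (tendsto_wkbErr ha) hx
  · refine (hasDerivAt_eval_mul_exp_half _ y).congr_deriv ?_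
    rw [turning_sq, derivative_sub, derivative_derivative_herm, derivative_mul, derivative_X]
    simp only [eval_sub, eval_mul, eval_add, eval_X, eval_C, eval_one]
    ring
  · have h0 : 0 < y := ha.trans hy
    have h1 : 2 * (n : ℝ) ≤ y ^ 2 := by
      have := turning_sq n
      nlinarith
    exact mul_pos (herm_ratio h0 n h1).1 (Real.exp_pos _)
  · refine squeeze_zero_norm' (a := fun x => ‖(derivative (herm n) - X * herm n).eval x *
      Real.exp (-(1 / 2) * x ^ 2)‖ + ‖(C 2 * X * herm n).eval x * Real.exp (-(1 / 2) * x ^ 2)‖) ?_ ?_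
    · filter_upwards [hinv] with x ⟨h1, h2, h3⟩
      have hx0 := ha.trans h3
      rw [norm_div, Real.norm_of_nonneg (zero_le_one.trans h2)]
      refine (div_le_self (norm_nonneg _) h2).trans ((norm_sub_le _ _).trans ?_)
      refine add_le_add le_rfl ?_
      simp only [eval_mul, eval_C, eval_X, norm_mul]
      rw [← mul_assoc]
      gcongr
      rw [wkbLog, ← neg_add', norm_neg, Real.norm_of_nonneg (by positivity),
        Real.norm_of_nonneg zero_le_two, Real.norm_of_nonneg hx0.le, two_mul x]
      refine add_le_add (mom_le hx0.le) (div_le_self hx0.le ?_)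
      nlinarith
    · have := (tendsto_eval_mul_exp_neg (derivative (herm n) - X * herm n) one_half_pos).norm.add
        (tendsto_eval_mul_exp_neg (C 2 * X * herm n) one_half_pos).norm
      rwa [norm_zero, add_zero] at this
  · refine squeeze_zero' ?_ ?_ (tendsto_wkbErrDeriv ha)
    · filter_upwards [hinv] with x ⟨h1, h2, h3⟩
      rw [wkbErrDeriv]; positivity
    · filter_upwards [hinv] with x ⟨h1, h2, h3⟩
      refine div_le_self ?_ (one_le_pow₀ h2)
      rw [wkbErrDeriv]; positivity

theorem wkbConst_pos (n : ℕ) : 0 < wkbConst n := by rw [wkbConst]; positivity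

theorem wkbConst_sq (n : ℕ) : wkbConst n ^ 2 =
    2 ^ n * Real.exp (-(n + 1 / 2)) * (n + 1 / 2) ^ n * turning n / 2 := by
  have ha := turning_pos n
  have h := turning_sq n
  have h1 : wkbConst n ^ 2 = (2 ^ n) ^ 2 *
      (Real.exp (-(n + 1 / 2)) * Real.exp (Real.log (2 / turning n) * (-(2 * n + 1 : ℕ)))) := by
    rw [wkbConst, mul_pow, ← Real.exp_nat_mul, ← Real.exp_add, h]
    congr 2
    push_cast
    ring
  have h3 : (2 / turning n) ^ (2 * n + 1) = (2 / (n + 1 / 2)) ^ n * (2 / turning n) := by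
    rw [pow_succ, pow_mul, div_pow, h]
    congr 2
    field_simp
  rw [h1, Real.exp_mul, Real.exp_log (by positivity), Real.rpow_neg (by positivity),
    Real.rpow_natCast, h3, div_pow]
  field_simp

theorem exp_mul_pow_eq (n : ℕ) : ((n : ℝ) / Real.exp 1) ^ n = n ^ n * Real.exp (-n) := by
  rw [div_pow, ← Real.exp_nat_mul, mul_one, Real.exp_neg, div_eq_mul_inv]

/-- Stirling's lower bound for n!, with (1 + 1/(2n))^n ≤ e^{1/2} cancelling the excess in exp(-(n +
1/2)). -/
theorem wkbConst_sq_le {n : ℕ} (hn : 1 ≤ n) : wkbConst n ^ 2 ≤ hermNorm n := by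
  have hn0 : (1 : ℝ) ≤ n := by exact_mod_cast hn
  have h1 := Stirling.le_factorial_stirling n
  rw [exp_mul_pow_eq, Real.sqrt_mul (by positivity)] at h1
  have h2 : ((n : ℝ) + 1 / 2) ^ n ≤ n ^ n * Real.exp (1 / 2) := by
    have : (n : ℝ) + 1 / 2 ≤ n * Real.exp (1 / (2 * n)) := by
      have := Real.add_one_le_exp (1 / (2 * (n : ℝ)))
      calc (n : ℝ) + 1 / 2 = n * (1 / (2 * n) + 1) := by field_simp; ring
        _ ≤ _ := by gcongr
    refine (pow_le_pow_left₀ (by positivity) this n).trans_eq ?_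
    rw [mul_pow, ← Real.exp_nat_mul]
    congr 2
    field_simp
  have h3 : turning n ≤ 2 * √n := by
    rw [turning, Real.sqrt_le_left (by positivity), mul_pow, Real.sq_sqrt (by positivity)]
    linarith
  have h4 : 1 ≤ √(2 * Real.pi) * √Real.pi := by
    have : 1 ≤ √Real.pi := Real.one_le_sqrt.2 (by linarith [Real.pi_gt_three])
    have : 1 ≤ √(2 * Real.pi) := Real.one_le_sqrt.2 (by linarith [Real.pi_gt_three])
    nlinarith
  have h5 := turning_pos n
  rw [wkbConst_sq, hermNorm]
  calc 2 ^ n * Real.exp (-(n + 1 / 2)) * ((n : ℝ) + 1 / 2) ^ n * turning n / 2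
      ≤ 2 ^ n * Real.exp (-(n + 1 / 2)) * (n ^ n * Real.exp (1 / 2)) * (2 * √n) / 2 := by gcongr
    _ = 2 ^ n * (√n * (n ^ n * (Real.exp (-(n + 1 / 2)) * Real.exp (1 / 2)))) * 1 := by ring
    _ ≤ 2 ^ n * (√n * (n ^ n * (Real.exp (-(n + 1 / 2)) * Real.exp (1 / 2)))) *
        (√(2 * Real.pi) * √Real.pi) := by gcongr
    _ = 2 ^ n * (√(2 * Real.pi) * √n * (n ^ n * Real.exp (-n))) * √Real.pi := by
      rw [← Real.exp_add]; ring_nf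
    _ ≤ _ := by gcongr

/-- The Stirling sequence decreases, hence stays below its first value e/√2; this gives an upper
bound for n!. The exponent -3/2 collects this e and the e^{-1/2} of exp(-(n + 1/2)). -/
theorem le_wkbConst_sq {n : ℕ} (hn : 1 ≤ n) :
    Real.exp (-(3 / 2)) / √(2 * Real.pi) * hermNorm n ≤ wkbConst n ^ 2 := by
  have hn0 : (1 : ℝ) ≤ n := by exact_mod_cast hn
  have h1 : Stirling.stirlingSeq n ≤ Stirling.stirlingSeq 1 := by
    have := Stirling.stirlingSeq'_antitone (Nat.zero_le (n - 1))
    simpa [Nat.sub_add_cancel hn] using this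
  rw [Stirling.stirlingSeq_one, Stirling.stirlingSeq, exp_mul_pow_eq, Real.sqrt_mul zero_le_two,
    div_le_iff₀ (by positivity)] at h1
  have h2 : (n : ℝ) ^ n ≤ (n + 1 / 2) ^ n := by gcongr; linarith
  have h3 : √2 * √n ≤ turning n := by
    rw [turning, ← Real.sqrt_mul zero_le_two]
    exact Real.sqrt_le_sqrt (by linarith)
  have h4 : √2 * √2 = (2 : ℝ) := Real.mul_self_sqrt zero_le_two
  rw [wkbConst_sq, hermNorm]
  calc Real.exp (-(3 / 2)) / √(2 * Real.pi) * (2 ^ n * n.factorial * √Real.pi)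
      ≤ Real.exp (-(3 / 2)) / √(2 * Real.pi) *
        (2 ^ n * (Real.exp 1 / √2 * (√2 * √n * (n ^ n * Real.exp (-n)))) * √Real.pi) := by gcongr
    _ = 2 ^ n * (Real.exp (-(3 / 2)) * Real.exp 1 * Real.exp (-n)) * n ^ n * (√2 * √n) / 2 := by
      rw [Real.sqrt_mul zero_le_two]
      field_simp
      linear_combination -h4
    _ = 2 ^ n * Real.exp (-(n + 1 / 2)) * n ^ n * (√2 * √n) / 2 := by
      rw [← Real.exp_add, ← Real.exp_add]; ring_nf
    _ ≤ _ := by gcongr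

end HermiteWKB
end GUETail

namespace GUETail
open Polynomial Filter

/-! ### The action at √(2N)(1 + r²), with r² = t. -/

section ActionComparison

variable {a b r : ℝ}

theorem hasDerivAt_two_mul_action (ha : 0 < a) (h : a < b * (1 + r ^ 2)) :
    HasDerivAt (fun u => 2 * action a (b * (1 + u ^ 2)))
      (4 * b * r * mom a (b * (1 + r ^ 2))) r := by
  have h1 : HasDerivAt (fun u : ℝ => b * (1 + u ^ 2)) (b * (2 * r)) r := by
    simpa using ((hasDerivAt_pow 2 r).const_add 1).const_mul b
  refine (((hasDerivAt_action ha h).comp r h1).const_mul 2).congr_deriv ?_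
  ring

/-- Compare derivatives in r, starting from r = 0, which is already beyond the turning point. Here
b² = 2N and a² = 2N - 1 belongs to H_{N-1}. -/
theorem two_mul_action_le (ha : 0 < a) (hb : 0 < b) (hab : a ^ 2 = b ^ 2 - 1) (hr : 0 ≤ r) :
    2 * action a (b * (1 + r ^ 2)) ≤
      2 + (4 * √2 / 3 * b ^ 2 * r ^ 3 + √2 * r + √2 / 5 * b ^ 2 * r ^ 5) := by
  have h2 : √2 ^ 2 = (2 : ℝ) := Real.sq_sqrt zero_le_two
  have hlt : a < b := by nlinarith
  have hle : ∀ u : ℝ, a < b * (1 + u ^ 2) := fun u => by nlinarith [mul_nonneg hb.le (sq_nonneg u)]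
  have hd : ∀ u : ℝ, HasDerivAt (fun u => 2 * action a (b * (1 + u ^ 2)) -
      (4 * √2 / 3 * b ^ 2 * u ^ 3 + √2 * u + √2 / 5 * b ^ 2 * u ^ 5))
      (4 * b * u * mom a (b * (1 + u ^ 2)) - √2 * (4 * b ^ 2 * u ^ 2 + 1 + b ^ 2 * u ^ 4)) u := by
    intro u
    refine ((hasDerivAt_two_mul_action ha (hle u)).sub
      ((((hasDerivAt_pow 3 u).const_mul _).add ((hasDerivAt_id u).const_mul _)).add
        ((hasDerivAt_pow 5 u).const_mul _))).congr_deriv ?_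
    push_cast
    ring
  have hanti := antitoneOn_of_deriv_nonpos (convex_Ici (0 : ℝ))
    (fun u _ => (hd u).continuousAt.continuousWithinAt)
    (fun u _ => (hd u).differentiableAt.differentiableWithinAt) (fun u hu => by
      rw [interior_Ici] at hu
      have hu : 0 < u := hu
      rw [(hd u).deriv, sub_nonpos]
      refine le_of_sq_le_sq ?_ (by positivity)
      rw [mul_pow, mul_pow _ (_ + _), mom_sq ha (hle u).le, h2, hab]
      -- The difference of the two squares is exactly 2(1 + b²u⁴)²: the bound is the tangent-line
      -- estimate for the square root.
      nlinarith [sq_nonneg (1 + b ^ 2 * u ^ 4)])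
  have h := hanti Set.self_mem_Ici hr hr
  have h0 : 2 * action a b ≤ 2 := by
    have h1 := (action_sub_bounds ha le_rfl hlt.le).2
    rw [action_self ha] at h1
    have h3 : mom a b = 1 := by rw [mom, hab]; norm_num
    have h4 : b ≤ a + 1 := by nlinarith
    rw [h3] at h1
    linarith
  norm_num at h
  linarith

/-- Here a² = 2N + 1 belongs to H_N and a > b, so r = 0 lies inside the turning point. The
comparison starts at r₁ with 2b²r₁² = 1, where the left side is negative and the action is not. -/
theorem le_two_mul_action (ha : 0 < a) (hb : 0 < b) (hab : a ^ 2 = b ^ 2 + 1) (hr : 0 < r)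
    (h1 : 1 ≤ 2 * b ^ 2 * r ^ 2) :
    4 * √2 / 3 * b ^ 2 * r ^ 3 - 2 * √2 * r ≤ 2 * action a (b * (1 + r ^ 2)) := by
  have h2 : √2 ^ 2 = (2 : ℝ) := Real.sq_sqrt zero_le_two
  set r₁ : ℝ := 1 / (√2 * b) with hr₁
  have hr₁0 : 0 < r₁ := by positivity
  have hr₁2 : 2 * b ^ 2 * r₁ ^ 2 = 1 := by
    rw [hr₁, div_pow, mul_pow, h2]; field_simp
  have hle : ∀ u : ℝ, r₁ ≤ u → a < b * (1 + u ^ 2) := fun u hu => by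
    have h3 : r₁ ^ 2 ≤ u ^ 2 := by gcongr
    have h4 : 1 ≤ 2 * b ^ 2 * u ^ 2 := by rw [← hr₁2]; gcongr
    refine lt_of_pow_lt_pow_left₀ 2 (by positivity) ?_
    rw [hab]
    have : 0 < (b * u ^ 2) ^ 2 := by
      have : 0 < u := hr₁0.trans_le hu
      positivity
    nlinarith
  have hd : ∀ u : ℝ, r₁ ≤ u → HasDerivAt (fun u => 2 * action a (b * (1 + u ^ 2)) -
      (4 * √2 / 3 * b ^ 2 * u ^ 3 - 2 * √2 * u))
      (4 * b * u * mom a (b * (1 + u ^ 2)) - √2 * (4 * b ^ 2 * u ^ 2 - 2)) u := by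
    intro u hu
    refine ((hasDerivAt_two_mul_action ha (hle u hu)).sub
      (((hasDerivAt_pow 3 u).const_mul _).sub ((hasDerivAt_id u).const_mul _))).congr_deriv ?_
    push_cast
    ring
  have hmono := monotoneOn_of_deriv_nonneg (convex_Ici r₁)
    (fun u hu => (hd u hu).continuousAt.continuousWithinAt)
    (fun u hu => (hd u (interior_subset hu)).differentiableAt.differentiableWithinAt)
    (fun u hu => by
      have hu : r₁ ≤ u := interior_subset hu
      have hu0 : 0 < u := hr₁0.trans_le hu
      have h3 : r₁ ^ 2 ≤ u ^ 2 := by gcongr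
      have h4 : 1 ≤ 2 * b ^ 2 * u ^ 2 := by rw [← hr₁2]; gcongr
      have hq := mom_pos ha (hle u hu)
      rw [(hd u hu).deriv, sub_nonneg]
      refine le_of_sq_le_sq ?_ (by positivity)
      rw [mul_pow, mul_pow _ (mom _ _), mom_sq ha (hle u hu).le, h2, hab]
      have : 0 ≤ b ^ 4 * u ^ 6 := by positivity
      nlinarith)
  have hr₁r : r₁ ≤ r := le_of_sq_le_sq (by
    have : 0 < b ^ 2 := by positivity
    nlinarith) hr.le
  have h := hmono Set.self_mem_Ici hr₁r hr₁r
  have h5 := action_nonneg ha (hle r₁ le_rfl).le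
  have h6 : 4 * √2 / 3 * b ^ 2 * r₁ ^ 3 - 2 * √2 * r₁ ≤ 0 := by
    have : 4 * √2 / 3 * b ^ 2 * r₁ ^ 3 = 2 * √2 / 3 * r₁ * (2 * b ^ 2 * r₁ ^ 2) := by ring
    rw [this, hr₁2]
    have : 0 < √2 * r₁ := by positivity
    linarith
  simp only at h
  linarith

end ActionComparison
end GUETail

namespace GUETail
open Polynomial Filter

/-! ### Two-sided bounds for the tail integral of the density. -/

section DensityTail

theorem wkbInv_sq {a x : ℝ} (ha : 0 < a) (hx : a < x) :
    wkbInv a x ^ 2 = Real.exp (2 * action a x) * mom a x := by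
  conv_rhs => rw [← Real.exp_log (mom_pos ha hx), ← Real.exp_add]
  rw [wkbInv, ← Real.exp_nat_mul]
  congr 1
  push_cast
  ring

theorem exp_half_sq (x : ℝ) : Real.exp (-(1 / 2) * x ^ 2) ^ 2 = Real.exp (-x ^ 2) := by
  rw [← Real.exp_nat_mul]
  congr 1
  push_cast
  ring

theorem turning_sq_lt {n : ℕ} {x : ℝ} (hx : turning n < x) : 0 < x ∧ 2 * (n : ℝ) + 1 < x ^ 2 := by
  have h1 := turning_pos n
  have h2 := turning_sq n
  exact ⟨h1.trans hx, by nlinarith⟩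

theorem herm_sq_le {n : ℕ} (hn : 1 ≤ n) {x : ℝ} (hx : turning n < x) :
    (herm n).eval x ^ 2 / hermNorm n * Real.exp (-x ^ 2) ≤
      Real.exp (-(2 * action (turning n) x)) / mom (turning n) x := by
  have ha := turning_pos n
  have hq := mom_pos ha hx
  obtain ⟨h0, h1⟩ := turning_sq_lt hx
  have hH := (herm_ratio h0 n (by linarith)).1
  have h := (herm_wkb_bounds n hx).1
  have hE : 0 < wkbInv (turning n) x := wkbInv_pos
  have h2 := (pow_le_pow_left₀ (by positivity) h 2).trans (wkbConst_sq_le hn)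
  rw [mul_pow, mul_pow, wkbInv_sq ha hx, exp_half_sq] at h2
  have := hermNorm_pos n
  rw [Real.exp_neg (2 * _), div_mul_eq_mul_div, div_le_iff₀ this, inv_eq_one_div, div_div,
    div_mul_eq_mul_div, le_div_iff₀ (by positivity), one_mul]
  exact h2

theorem le_herm_sq {n : ℕ} (hn : 1 ≤ n) {x : ℝ} (hx : turning n < x)
    (herr : wkbErr (turning n) x ≤ 1 / 2) :
    Real.exp (-(3 / 2)) / √(2 * Real.pi) / 4 *
      (Real.exp (-(2 * action (turning n) x)) / mom (turning n) x) ≤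
      (herm n).eval x ^ 2 / hermNorm n * Real.exp (-x ^ 2) := by
  have ha := turning_pos n
  have hq := mom_pos ha hx
  have h := (herm_wkb_bounds n hx).2
  have hL := wkbConst_pos n
  have hE : 0 < wkbInv (turning n) x := wkbInv_pos
  have h2 : wkbConst n / 2 ≤
      (herm n).eval x * Real.exp (-(1 / 2) * x ^ 2) * wkbInv (turning n) x := by
    refine le_trans ?_ h
    nlinarith
  have h3 := pow_le_pow_left₀ (by positivity) h2 2
  rw [mul_pow, mul_pow, wkbInv_sq ha hx, exp_half_sq, div_pow] at h3
  have h4 := le_wkbConst_sq hn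
  have := hermNorm_pos n
  rw [Real.exp_neg (2 * _), div_mul_eq_mul_div _ (hermNorm n), le_div_iff₀ this, inv_eq_one_div,
    div_div _ (Real.exp _), mul_one_div, div_mul_eq_mul_div, div_le_iff₀ (by positivity)]
  linarith

/-- The negative of the derivative of `density (n + 1)`. -/
noncomputable def densityDrop (n : ℕ) (x : ℝ) : ℝ :=
  (herm (n + 1)).eval x * (herm n).eval x / hermNorm n * Real.exp (-x ^ 2)

/-- For x ≥ √(2(n+1)), H_{n+1} ≥ √(2(n+1)) H_n, where 2(n+1) is also the ratio of the squared norms.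
So the product is bounded above by a square of H_{n+1} and, in the companion lower bound, below by a
square of H_n. -/
theorem densityDrop_le (n : ℕ) {x : ℝ} (hx : turning (n + 1) < x) :
    densityDrop n x ≤ √(2 * (n + 1)) *
      ((herm (n + 1)).eval x ^ 2 / hermNorm (n + 1) * Real.exp (-x ^ 2)) := by
  obtain ⟨h0, h1⟩ := turning_sq_lt hx
  push_cast at h1
  obtain ⟨hH, hR⟩ := herm_ratio h0 n (by linarith)
  have hN := hermNorm_pos n
  set b : ℝ := √(2 * (n + 1)) with hb
  have hb0 : 0 < b := by positivity
  have hb2 : b * b = 2 * (n + 1) := Real.mul_self_sqrt (by positivity)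
  have hbx : b ≤ x := by nlinarith
  have h2 : b * (herm n).eval x ≤ (herm (n + 1)).eval x :=
    (mul_le_mul_of_nonneg_right hbx hH.le).trans hR
  have h3 : 0 < (herm (n + 1)).eval x := (mul_pos h0 hH).trans_le hR
  rw [densityDrop, hermNorm_succ, ← mul_assoc]
  gcongr ?_ * _
  rw [← hb2, ← mul_div_assoc, div_le_div_iff₀ hN (by positivity)]
  have : 0 < b * hermNorm n * (herm (n + 1)).eval x := by positivity
  nlinarith

theorem le_densityDrop (n : ℕ) {x : ℝ} (hx : turning n < x) (hb : √(2 * (n + 1)) ≤ x) :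
    √(2 * (n + 1)) * ((herm n).eval x ^ 2 / hermNorm n * Real.exp (-x ^ 2)) ≤ densityDrop n x := by
  obtain ⟨h0, h1⟩ := turning_sq_lt hx
  obtain ⟨hH, hR⟩ := herm_ratio h0 n (by linarith)
  have hN := hermNorm_pos n
  rw [densityDrop, ← mul_assoc, ← mul_div_assoc]
  gcongr ?_ / _ * _
  have := (mul_le_mul_of_nonneg_right hb hH.le).trans hR
  nlinarith

/-- The derivative `mom` of the action is increasing, so past s the drop of the density is at most B
exp(-2m(x - s)). Two integrations to infinity each contribute 1/(2m). -/
theorem integral_density_le (n : ℕ) {s : ℝ} (hs : turning (n + 1) < s) :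
    ∫ x in Set.Ioi s, density (n + 1) x ≤
      √(2 * (n + 1)) * Real.exp (-(2 * action (turning (n + 1)) s)) /
        (4 * mom (turning (n + 1)) s ^ 3) := by
  have ha := turning_pos (n + 1)
  have hm := mom_pos ha hs
  set a := turning (n + 1)
  set m := mom a s
  set B : ℝ := √(2 * (n + 1)) * Real.exp (-(2 * action a s)) / m with hB
  have hE : ∀ x, HasDerivAt (fun x => Real.exp (-(2 * m) * (x - s)))
      (-(2 * m) * Real.exp (-(2 * m) * (x - s))) x := by
    intro x
    have h1 := ((((hasDerivAt_id x).sub_const s).const_mul (-(2 * m))).exp)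
    refine h1.congr_deriv ?_
    simp only [id, mul_one]
    ring
  have hEeq : ∀ x, Real.exp (-(2 * m) * (x - s)) =
      Real.exp (2 * m * s) * Real.exp (-(2 * m) * x) := fun x => by
    rw [← Real.exp_add]; ring_nf
  have hElim : Tendsto (fun x => Real.exp (-(2 * m) * (x - s))) atTop (nhds 0) := by
    refine Real.tendsto_exp_atBot.comp
      ((tendsto_atTop_add_const_right _ (-s) tendsto_id).const_mul_atTop_of_neg (by linarith))
  have hdrop : ∀ x, s < x → densityDrop n x ≤ B * Real.exp (-(2 * m) * (x - s)) := by
    intro x hx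
    have h1 := densityDrop_le n (hs.trans hx)
    have h2 := herm_sq_le (Nat.le_add_left 1 n) (hs.trans hx)
    have h3 := (action_sub_bounds ha hs.le hx.le).1
    have h4 : m ≤ mom a x := mom_mono ha hs.le hx.le
    calc densityDrop n x ≤ √(2 * (n + 1)) * (Real.exp (-(2 * action a x)) / mom a x) :=
          h1.trans (by gcongr)
      _ ≤ √(2 * (n + 1)) * (Real.exp (-(2 * action a s) + -(2 * m) * (x - s)) / m) := by
          gcongr
          linarith
      _ = _ := by rw [Real.exp_add, hB]; ring
  have hdens : ∀ x, s < x → density (n + 1) x ≤ B / (2 * m) * Real.exp (-(2 * m) * (x - s)) := by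
    intro x hx
    have h := le_of_deriv_nonneg_of_tendsto (a := s) (l := 0)
      (f := fun x => density (n + 1) x - B / (2 * m) * Real.exp (-(2 * m) * (x - s)))
      (fun y _ => (hasDerivAt_density n y).sub ((hE y).const_mul (B / (2 * m))))
      (fun y hy => ?_)
      (by simpa using (tendsto_density (n + 1)).sub (hElim.const_mul (B / (2 * m)))) hx
    · linarith
    · have h1 := hdrop y hy
      rw [densityDrop] at h1
      have : B / (2 * m) * (-(2 * m) * Real.exp (-(2 * m) * (y - s))) =
          -(B * Real.exp (-(2 * m) * (y - s))) := by field_simp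
      rw [this]
      linarith
  have hneg : -(2 * m) < 0 := by linarith
  calc ∫ x in Set.Ioi s, density (n + 1) x
      ≤ ∫ x in Set.Ioi s, B / (2 * m) * Real.exp (-(2 * m) * (x - s)) := by
        refine setIntegral_mono_on (integrable_density _).integrableOn ?_ measurableSet_Ioi hdens
        simp only [hEeq]
        exact ((integrableOn_exp_mul_Ioi hneg s).const_mul _).const_mul _
    _ = B / (2 * m) * (1 / (2 * m)) := by
        simp only [hEeq]
        rw [integral_const_mul, integral_const_mul, integral_exp_mul_Ioi hneg, neg_div_neg_eq,
          mul_div_assoc', ← Real.exp_add]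
        simp
    _ = _ := by rw [hB]; field_simp; ring

/-- On a window of length 2/m the action grows by a bounded amount, so the drop is at least a
constant β there. The density is then at least β/m on the first half, and the integral at least
β/m². -/
theorem le_integral_density {n : ℕ} (hn : 1 ≤ n) {s : ℝ} (hs : √(2 * (n + 1)) ≤ s)
    (hm2 : 2 ≤ mom (turning n) s) (hms : 2 * s ≤ mom (turning n) s ^ 3) :
    Real.exp (-(19 / 2)) / (8 * √(2 * Real.pi)) *
      (√(2 * (n + 1)) * Real.exp (-(2 * action (turning n) s)) / mom (turning n) s ^ 3) ≤
      ∫ x in Set.Ioi s, density (n + 1) x := by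
  have ha := turning_pos n
  have has : turning n < s := lt_of_lt_of_le (Real.sqrt_lt_sqrt (by positivity) (by linarith)) hs
  have hs0 := ha.trans has
  set a := turning n
  set m := mom a s with hm
  have hm0 : 0 < m := by linarith
  set b : ℝ := √(2 * (n + 1))
  set c : ℝ := Real.exp (-(3 / 2)) / √(2 * Real.pi) / 4 with hc
  set β : ℝ := b * (c * (Real.exp (-(2 * action a s + 8)) / (2 * m))) with hβ
  have hβ0 : 0 ≤ β := by positivity
  set δ : ℝ := 1 / m with hδ
  have hδ0 : 0 < δ := by positivity
  have hδ1 : δ ≤ 1 / 2 := by rw [hδ]; gcongr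
  have hmδ : m * δ = 1 := by rw [hδ]; field_simp
  have hm3 : 8 ≤ m ^ 3 := by nlinarith [pow_le_pow_left₀ zero_le_two hm2 3]
  -- The hypothesis 2s ≤ m³ keeps the momentum from more than doubling on the window. Twice the
  -- action then grows by at most 2·(2m)·(2δ) = 8, the source of exp(-8).
  have hmom : mom a (s + 2 * δ) ≤ 2 * m := by
    refine Real.sqrt_le_iff.2 ⟨by positivity, ?_⟩
    have h1 : m ^ 2 = s ^ 2 - a ^ 2 := mom_sq ha has.le
    have h2 : 2 * s * δ ≤ m ^ 2 := by
      calc 2 * s * δ ≤ m ^ 3 * δ := by gcongr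
        _ = m ^ 2 * (m * δ) := by ring
        _ = m ^ 2 := by rw [hmδ, mul_one]
    nlinarith
  have hdrop : ∀ x ∈ Set.Ioo s (s + 2 * δ), β ≤ densityDrop n x := by
    rintro x ⟨hx, hx'⟩
    have hax := has.trans hx
    have hmx : m ≤ mom a x := mom_mono ha has.le hx.le
    have hmx' : mom a x ≤ 2 * m := (mom_mono ha hax.le hx'.le).trans hmom
    have herr : wkbErr a x ≤ 1 / 2 := by
      have hmx0 : 0 < mom a x := hm0.trans_le hmx
      have : m ^ 3 ≤ mom a x ^ 3 := by gcongr
      rw [wkbErr, div_le_div_iff₀ (by positivity) zero_lt_two]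
      linarith
    have hact : 2 * action a x ≤ 2 * action a s + 8 := by
      have h1 := (action_sub_bounds ha has.le hx.le).2
      have h2 : mom a x * (x - s) ≤ 2 * m * (2 * δ) := by
        gcongr
        linarith
      nlinarith
    refine le_trans ?_ (le_densityDrop n hax (hs.trans hx.le))
    rw [hβ]
    refine mul_le_mul_of_nonneg_left ?_ (Real.sqrt_nonneg _)
    refine le_trans ?_ (le_herm_sq hn hax herr)
    rw [← hc]
    have : 0 < mom a x := hm0.trans_le hmx
    gcongr
  have hdens : ∀ x ∈ Set.Ioc s (s + δ), β * δ ≤ density (n + 1) x := by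
    rintro x ⟨hx, hx'⟩
    have hanti : AntitoneOn (fun y => density (n + 1) y + β * y) (Set.Icc s (s + 2 * δ)) := by
      have hd : ∀ y, HasDerivAt (fun y => density (n + 1) y + β * y) (-densityDrop n y + β) y := by
        intro y
        refine ((hasDerivAt_density n y).add ((hasDerivAt_id y).const_mul β)).congr_deriv ?_
        rw [densityDrop, mul_one]
      refine antitoneOn_of_deriv_nonpos (convex_Icc _ _)
        (fun y _ => (hd y).continuousAt.continuousWithinAt)
        (fun y _ => (hd y).differentiableAt.differentiableWithinAt) fun y hy => ?_
      rw [interior_Icc] at hy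
      rw [(hd y).deriv]
      linarith [hdrop y hy]
    have h := hanti ⟨hx.le, by linarith⟩ (Set.right_mem_Icc.2 (by linarith))
      (by linarith : x ≤ s + 2 * δ)
    simp only at h
    have := density_nonneg (n + 1) (s + 2 * δ)
    nlinarith
  calc _ = β * δ * δ := by
        have h8 : Real.exp (-(2 * action a s + 8)) =
            Real.exp (-(2 * action a s)) * Real.exp (-8) := by rw [← Real.exp_add]; ring_nf
        have h9 : Real.exp (-(19 / 2)) = Real.exp (-(3 / 2)) * Real.exp (-8) := by
          rw [← Real.exp_add]; norm_num
        rw [hβ, hδ, hc, h8, h9]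
        field_simp
        ring
    _ = β * δ * volume.real (Set.Ioc s (s + δ)) := by
        rw [Real.volume_real_Ioc_of_le (by linarith)]; ring
    _ ≤ ∫ x in Set.Ioc s (s + δ), density (n + 1) x :=
        setIntegral_ge_of_const_le_real measurableSet_Ioc measure_Ioc_lt_top.ne hdens
          (integrable_density _).integrableOn
    _ ≤ _ := setIntegral_mono_set (integrable_density _).integrableOn
        (ae_of_all _ fun x => density_nonneg _ x) (Set.Ioc_subset_Ioi_self).eventuallyLE

end DensityTail
end GUETail

namespace GUETail

/-! ### Explicit tail bounds in N = n + 1 and r = √t. -/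

section FinalEstimates

variable {n : ℕ} {r : ℝ}

theorem integral_density_tail_le (hr : 0 < r) (hr1 : r < 1) (hN : 1 ≤ ((n : ℝ) + 1) * r ^ 3) :
    ∫ x in Set.Ioi (√(2 * (n + 1)) * (1 + r ^ 2)), density (n + 1) x ≤
      Real.exp 3 / ((n + 1) * r ^ 3) * Real.exp (-(8 * √2 / 3) * (n + 1) * r ^ 3) := by
  have ha := turning_pos (n + 1)
  have hab := turning_sq (n + 1)
  have hb0 : 0 < √(2 * ((n : ℝ) + 1)) := by positivity
  have hb2 : √(2 * ((n : ℝ) + 1)) ^ 2 = 2 * (n + 1) := Real.sq_sqrt (by positivity)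
  set b : ℝ := √(2 * (n + 1))
  set a : ℝ := turning (n + 1)
  push_cast at hab
  have hr2 : r ^ 3 ≤ r ^ 2 := pow_le_pow_of_le_one hr.le hr1.le (by norm_num)
  have hNr2 : 1 ≤ ((n : ℝ) + 1) * r ^ 2 := hN.trans (by gcongr)
  have hsq : (b * (1 + r ^ 2)) ^ 2 = 2 * (n + 1) * (1 + r ^ 2) ^ 2 := by rw [mul_pow, hb2]
  have hNr4 : 0 ≤ ((n : ℝ) + 1) * r ^ 4 := by positivity
  have has : a < b * (1 + r ^ 2) := by
    refine lt_of_pow_lt_pow_left₀ 2 (by positivity) ?_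
    rw [hsq, hab]
    nlinarith
  -- `mom`² = b²(2r² + r⁴) - 1, and the -1 is absorbed because b²r² = 2Nr² ≥ 2.
  have hm : b * r ≤ mom a (b * (1 + r ^ 2)) := by
    refine Real.le_sqrt_of_sq_le ?_
    rw [hsq, hab, mul_pow, hb2]
    nlinarith
  have h1 : (b * r) ^ 3 ≤ mom a (b * (1 + r ^ 2)) ^ 3 := by gcongr
  have h2 := le_two_mul_action ha hb0 (by rw [hab, hb2]) hr (by rw [hb2]; linarith)
  have h3 : 2 * √2 * r ≤ 3 := by
    have : √2 ≤ 3 / 2 := Real.sqrt_le_iff.2 ⟨by norm_num, by norm_num⟩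
    nlinarith [Real.sqrt_nonneg 2]
  rw [hb2] at h2
  calc _ ≤ b * Real.exp (-(2 * action a (b * (1 + r ^ 2)))) /
        (4 * mom a (b * (1 + r ^ 2)) ^ 3) := integral_density_le n has
    _ ≤ b * Real.exp (3 + -(8 * √2 / 3) * (n + 1) * r ^ 3) / (1 * (b * r) ^ 3 * 2) := by
        have h4 : 1 * (b * r) ^ 3 * 2 ≤ 4 * mom a (b * (1 + r ^ 2)) ^ 3 := by
          have : 0 ≤ (b * r) ^ 3 := by positivity
          linarith
        gcongr
        linarith
    _ = Real.exp 3 / (2 * b ^ 2 * r ^ 3) * Real.exp (-(8 * √2 / 3) * (n + 1) * r ^ 3) := by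
        rw [Real.exp_add]
        field_simp
    _ ≤ _ := by
        gcongr
        rw [hb2]
        nlinarith

theorem le_integral_density_tail (hn : 1 ≤ n) (hr : 0 < r) (hr1 : r < 1)
    (hN : 1 ≤ ((n : ℝ) + 1) * r ^ 3) :
    Real.exp (-(19 / 2)) / (8 * √(2 * Real.pi)) * Real.exp (-4) / 16 / ((n + 1) * r ^ 3) *
        Real.exp (-(8 * √2 / 3) * (n + 1) * (r ^ 3 + r ^ 5)) ≤
      ∫ x in Set.Ioi (√(2 * (n + 1)) * (1 + r ^ 2)), density (n + 1) x := by
  have ha := turning_pos n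
  have hab := turning_sq n
  have hb0 : 0 < √(2 * ((n : ℝ) + 1)) := by positivity
  have hb2 : √(2 * ((n : ℝ) + 1)) ^ 2 = 2 * (n + 1) := Real.sq_sqrt (by positivity)
  have h22 : √2 ^ 2 = (2 : ℝ) := Real.sq_sqrt zero_le_two
  have h21 : 1 ≤ √2 := Real.one_le_sqrt.2 one_le_two
  have h23 : √2 ≤ 3 / 2 := Real.sqrt_le_iff.2 ⟨by norm_num, by norm_num⟩
  set c : ℝ := Real.exp (-(19 / 2)) / (8 * √(2 * Real.pi))
  set b : ℝ := √(2 * (n + 1)) with hb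
  set a : ℝ := turning n
  have hr2 : r ^ 3 ≤ r ^ 2 := pow_le_pow_of_le_one hr.le hr1.le (by norm_num)
  have hr4 : r ^ 4 ≤ r ^ 2 := pow_le_pow_of_le_one hr.le hr1.le (by norm_num)
  have hNr2 : 1 ≤ ((n : ℝ) + 1) * r ^ 2 := hN.trans (by gcongr)
  have hNr4' : ((n : ℝ) + 1) * r ^ 4 ≤ ((n : ℝ) + 1) * r ^ 2 := by gcongr
  have hsq : (b * (1 + r ^ 2)) ^ 2 = 2 * (n + 1) * (1 + r ^ 2) ^ 2 := by rw [mul_pow, hb2]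
  have hNr4 : 0 ≤ ((n : ℝ) + 1) * r ^ 4 := by positivity
  have hm1 : √2 * b * r ≤ mom a (b * (1 + r ^ 2)) := by
    refine Real.le_sqrt_of_sq_le ?_
    rw [hsq, hab, mul_pow, mul_pow, hb2, h22]
    nlinarith
  have hm2 : mom a (b * (1 + r ^ 2)) ≤ 2 * b * r := by
    refine Real.sqrt_le_iff.2 ⟨by positivity, ?_⟩
    rw [hsq, hab, mul_pow, mul_pow, hb2]
    nlinarith
  have hm3 : 2 ≤ mom a (b * (1 + r ^ 2)) := by
    refine Real.le_sqrt_of_sq_le ?_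
    rw [hsq, hab]
    nlinarith
  have hbs : b ≤ b * (1 + r ^ 2) := le_mul_of_one_le_right hb0.le (by nlinarith)
  have hms : 2 * (b * (1 + r ^ 2)) ≤ mom a (b * (1 + r ^ 2)) ^ 3 := by
    refine le_trans ?_ (pow_le_pow_left₀ (by positivity) hm1 3)
    have h1 : (√2 * b * r) ^ 3 = 4 * √2 * b * ((n + 1) * r ^ 3) := by
      calc (√2 * b * r) ^ 3 = √2 ^ 2 * √2 * b ^ 2 * b * r ^ 3 := by ring
        _ = _ := by rw [h22, hb2]; ring
    rw [h1]
    calc 2 * (b * (1 + r ^ 2)) ≤ 2 * (b * (1 + 1)) := by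
          gcongr
          exact pow_le_one₀ hr.le hr1.le
      _ = 4 * 1 * b * 1 := by ring
      _ ≤ _ := by gcongr
  have hact := two_mul_action_le ha hb0 (by rw [hab, hb2]; ring) hr.le
  rw [hb2] at hact
  -- The fifth-order term (2√2/5)(n+1)r⁵ fits inside (8√2/3)(n+1)r⁵, so C = 1 suffices; 2 + √2 r ≤ 4
  -- yields the factor exp(-4).
  have hexp : 2 * action a (b * (1 + r ^ 2)) ≤ 4 + 8 * √2 / 3 * (n + 1) * (r ^ 3 + r ^ 5) := by
    have h1 : √2 * r ≤ 2 := by nlinarith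
    have h2 : 0 ≤ √2 * ((n + 1) * r ^ 5) := by positivity
    linarith
  refine le_trans ?_ (le_integral_density hn hbs hm3 hms)
  have hm0 : 0 < mom a (b * (1 + r ^ 2)) := by linarith
  have hc0 : 0 ≤ c := by positivity
  calc _ = c * (b * (Real.exp (-4) * Real.exp (-(8 * √2 / 3) * (n + 1) * (r ^ 3 + r ^ 5))) /
        (8 * (b * b ^ 2) * r ^ 3)) := by
        rw [hb2]
        field_simp
        ring
    _ = c * (b * Real.exp (-(4 + 8 * √2 / 3 * (n + 1) * (r ^ 3 + r ^ 5))) / (2 * b * r) ^ 3) := by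
        rw [← Real.exp_add]
        ring_nf
    _ ≤ _ := by gcongr

theorem half_le_one_sub_exp_neg {x : ℝ} (hx : 0 ≤ x) (hx1 : x ≤ 1) :
    x / 2 ≤ 1 - Real.exp (-x) := by
  have h := Real.add_one_le_exp x
  have h1 : Real.exp (-x) ≤ 1 / (x + 1) := by
    rw [Real.exp_neg, inv_eq_one_div]
    gcongr
  have h2 : 1 / (x + 1) ≤ 1 - x / 2 := by
    rw [div_le_iff₀ (by linarith)]
    nlinarith
  linarith

end FinalEstimates

end GUETail

/-! ### Assembly of the tail bounds. -/

theorem lemmaA1 :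
    ∃ c₁ c₂ n₀ C : ℝ, 0 < c₁ ∧ 0 < c₂ ∧ 0 < n₀ ∧ 0 < C ∧
      ∀ (N : ℕ) (t : ℝ), t ∈ Set.Ioo (0 : ℝ) 1 → n₀ ≤ (N : ℝ) * t ^ (3 / 2 : ℝ) →
        ∀ (Ω : Type*) [MeasurableSpace Ω] (P : Measure Ω) [IsProbabilityMeasure P]
          (A : Ω → Matrix (Fin N) (Fin N) ℂ), IsGUE P A →
          c₁ / ((N : ℝ) * t ^ (3 / 2 : ℝ)) *
                Real.exp (-(8 * √2 / 3) * (N : ℝ) * (t ^ (3 / 2 : ℝ) + C * t ^ (5 / 2 : ℝ)))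
              ≤ P.real {ω | √(2 * (N : ℝ)) * (1 + t) ≤ largestEigenvalue (A ω)} ∧
            P.real {ω | √(2 * (N : ℝ)) * (1 + t) ≤ largestEigenvalue (A ω)}
              ≤ c₂ / ((N : ℝ) * t ^ (3 / 2 : ℝ)) *
                Real.exp (-(8 * √2 / 3) * (N : ℝ) * t ^ (3 / 2 : ℝ)) := by
  -- The last factor 1/2 of c₁ pays for 1 - exp(-τ) ≥ τ/2 on [0, 1].
  refine ⟨Real.exp (-(19 / 2)) / (8 * √(2 * Real.pi)) * Real.exp (-4) / 16 / 2, Real.exp 3, 1, 1,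
    by positivity, by positivity, one_pos, one_pos, ?_⟩
  intro N t ht hN Ω _ P _ A hA
  have hr : 0 < √t := Real.sqrt_pos.2 ht.1
  have hr1 : √t < 1 := (Real.sqrt_lt' one_pos).2 (by simpa using ht.2)
  have ht2 : t = √t ^ 2 := (Real.sq_sqrt ht.1.le).symm
  have hpow : ∀ k : ℕ, t ^ ((k : ℝ) / 2) = √t ^ k := fun k => by
    rw [Real.sqrt_eq_rpow, ← Real.rpow_natCast, ← Real.rpow_mul ht.1.le]
    ring_nf
  have h3 := hpow 3
  have h5 := hpow 5
  push_cast at h3 h5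
  rw [h3] at hN
  rw [h3, h5, one_mul]
  generalize √t = r at *
  subst ht2
  obtain ⟨n, rfl⟩ : ∃ n, N = n + 1 := Nat.exists_eq_succ_of_ne_zero (by rintro rfl; norm_num at hN)
  -- N = 1 is excluded by N r³ ≥ 1 and r < 1; the lower bound uses H_n with n = N - 1, and its
  -- Stirling estimate needs n ≥ 1.
  have hn : 1 ≤ n := by
    by_contra! h
    obtain rfl : n = 0 := by omega
    have : r ^ 3 < 1 := pow_lt_one₀ hr.le hr1 (by norm_num)
    norm_num at hN
    linarith
  have horth : ∀ j k : Fin (n + 1), ∫ x, (GUETail.hermOrtho j * GUETail.hermOrtho k).eval x *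
      Real.exp (-x ^ 2) = if j = k then 1 else 0 := fun j k => by
    rw [GUETail.integral_hermOrtho]
    simp only [Fin.ext_iff]
  have hdet := GUETail.det_gram_bounds horth (√(2 * ((n + 1 : ℕ) : ℝ)) * (1 + r ^ 2))
  rw [GUETail.prob_lt_eq_det (Nat.succ_pos n)
    (fun j => GUETail.natDegree_hermOrtho_le j) horth P hA]
  rw [GUETail.sum_integral_hermOrtho] at hdet
  push_cast at hdet hN ⊢
  refine ⟨le_trans ?_ hdet.2, hdet.1.trans (GUETail.integral_density_tail_le hr hr1 hN)⟩
  have hlow := GUETail.le_integral_density_tail hn hr hr1 hN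
  set τ := Real.exp (-(19 / 2)) / (8 * √(2 * Real.pi)) * Real.exp (-4) / 16 / ((n + 1) * r ^ 3) *
        Real.exp (-(8 * √2 / 3) * (n + 1) * (r ^ 3 + r ^ 5)) with hτ
  have hτ0 : 0 ≤ τ := by positivity
  have hτ1 : τ ≤ 1 := by
    have e1 : Real.exp (-(19 / 2)) ≤ 1 := Real.exp_le_one_iff.2 (by norm_num)
    have e2 : Real.exp (-4) ≤ 1 := Real.exp_le_one_iff.2 (by norm_num)
    have e3 : Real.exp (-(8 * √2 / 3) * (n + 1) * (r ^ 3 + r ^ 5)) ≤ 1 := by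
      refine Real.exp_le_one_iff.2 ?_
      rw [neg_mul, neg_mul, neg_nonpos]
      positivity
    have e4 : 1 ≤ √(2 * Real.pi) := Real.one_le_sqrt.2 (by linarith [Real.pi_gt_three])
    calc τ ≤ 1 / (8 * 1) * 1 / 16 / 1 * 1 := by rw [hτ]; gcongr
      _ ≤ 1 := by norm_num
  calc _ = τ / 2 := by rw [hτ]; ring
    _ ≤ 1 - Real.exp (-τ) := GUETail.half_le_one_sub_exp_neg hτ0 hτ1
    _ ≤ _ := by gcongr
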